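/- Let $n\ge 0$, $j\ge 1$, let $a=\mathrm{diag}(a_1,\dots,a_n)\in u(n)$ and let $b\in u(n)$ be a polynomial in $a$, $b=p(a)$ with $p\in\mathbb C[X]$. Let $\mathcal U_a^\perp\subset u(n)$ be the space of skew-Hermitian matrices orthogonal, for the trace form, to the centralizer of $a$ in $u(n)$. For a Schwartz function $v:\mathbb R\to\mathcal U_a^\perp$ let $Q_{b,0}(v)=b$, and let $Q_{b,k}(v)$, $k\ge 1$, be determined by $$(Q_{b,k}(v))_x+[v,Q_{b,k}(v)]=[Q_{b,k+1}(v),a]\quad(k\ge 0),\qquad \lim_{x\to-\infty}Q_{b,k}(v)(x)=0\quad(k\ge 1).$$ Let $\mathcal M_{a,b,j}$ be the set of smooth maps $u:\mathbb R^2\to\mathcal U_a^\perp$ such that $u(\cdot,t)$ is in the Schwartz class for every $t$ and $u_t=(Q_{b,j}(u))_x+[u,Q_{b,j}(u)]$, where $Q_{b,k}(u)(x,t)=Q_{b,k}(u(\cdot,t))(x)$. The trivialization of $u\in\mathcal M_{a,b,j}$ is the solution $E(x,t,\lambda)$, smooth in $(x,t)\in\mathbb R^2$ for each $\lambda\in\mathbb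 C$, of $$E_x=E\,(a\lambda+u),\qquad E_t=E\sum_{k=0}^{j}Q_{b,j-k}(u)\lambda^{k},\qquad E(0,0,\lambda)=I .$$ For $z\in\mathbb C\setminus\mathbb R$ and a Hermitian projection $\pi$ of $\mathbb C^n$ put $g_{z,\pi}(\lambda)=\pi+\frac{\lambda-z}{\lambda-\bar z}(I-\pi)$. Let $G_+$ be the group of entire maps $f:\mathbb C\to GL(n,\mathbb C)$ with $f(\bar\lambda)^*f(\lambda)=I$, and $G_-^m$ the group of rational maps $g$ with $g(\infty)=I$ and $g(\bar\lambda)^*g(\lambda)=I$. Let $u\in\mathcal M_{a,b,j}$, let $E$ be the trivialization of $u$, $z\in\mathbb C\setminus\mathbb R$, $V\subset\mathbb C^n$ a complex linear subspace, $\pi$ the Hermitian projection onto $V$, and $\tilde\pi(x,t)$ the Hermitian projection of $\mathbb C^n$ onto $E(x,t,z)^*(V)$. Then: 1. $\tilde u=u+(z-\bar z)[\tilde\pi,a]$ is again in $\mathcal M_{a,b,j}$. 2. $\tilde\pi$ is smooth on $\mathbb R^2$ and solves $$\tilde\pi_x+[az+u,\tilde\pi]=(\bar z-z)[\tilde\pi,a]\tilde\pi,\qquad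 \tilde\pi_t=\sum_{k=0}^{j}[\tilde\pi,Q_{b,j-k}(u)]\,(z+(\bar z-z)\tilde\pi)^k,$$ $$\tilde\pi^*=\tilde\pi,\qquad \tilde\pi^2=\tilde\pi,\qquad \tilde\pi(0,0)=\pi.$$ 3. The map $\tilde E(x,t,\lambda)=g_{z,\pi}(\lambda)E(x,t,\lambda)g_{z,\tilde\pi(x,t)}(\lambda)^{-1}$, $\lambda\ne z,\bar z$, extends over $\lambda=z,\bar z$ to the trivialization of $\tilde u$, and for all $(x,t)$ one has $g_{z,\pi}E(x,t)=\tilde E(x,t)\,g_{z,\tilde\pi(x,t)}$ with $\tilde E(x,t)\in G_+$ and $g_{z,\tilde\pi(x,t)}\in G_-^m$. -/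

import Mathlib

open scoped SchwartzMap ContDiff ComplexConjugate

/-- Complex `n × n` matrices; `u(n)` is `skewAdjoint (CMat n)`. -/
abbrev CMat (n : ℕ) : Type := Matrix (Fin n) (Fin n) ℂ

/-- The derivative of a matrix-valued function of a real variable, entry by entry. -/
noncomputable def matDeriv {n : ℕ} (f : ℝ → CMat n) (x : ℝ) : CMat n :=
  Matrix.of fun i k => deriv (fun y => f y i k) x

/-- Smoothness of a matrix-valued function of `(x, t) ∈ ℝ²`, entry by entry. -/
def MatSmooth {n : ℕ} (f : ℝ → ℝ → CMat n) : Prop :=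
  ∀ i k, ContDiff ℝ ∞ fun p : ℝ × ℝ => f p.1 p.2 i k

/-- `𝒰_a^⊥` for `𝒰 = u(n)`: the skew-Hermitian matrices which are orthogonal, with respect to the
trace form, to the centralizer `𝒰_a` of `a` in `u(n)`. -/
def unitaryPerp {n : ℕ} (a : CMat n) : Set (CMat n) :=
  {y | y ∈ skewAdjoint (CMat n) ∧
    ∀ x ∈ skewAdjoint (CMat n), Commute a x → Matrix.trace (x * y) = 0}

/-- The projection of `gl(n)` onto the centralizer of `a = diag(α)`, along the image of
`ad(a)`. -/
noncomputable def centralizerPart {n : ℕ} (α : Fin n → ℂ) (Y : CMat n) : CMat n :=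
  Matrix.of fun i k => if α i = α k then Y i k else 0

/-- The projection of `gl(n)` onto the image of `ad(a)`, `a = diag(α)`, along the centralizer of
`a`, followed by the inverse of `ad(a)` on that image. -/
noncomputable def adInv {n : ℕ} (α : Fin n → ℂ) (Y : CMat n) : CMat n :=
  Matrix.of fun i k => if α i = α k then 0 else (α i - α k)⁻¹ * Y i k

/-- The sequence `Q_{b,0}(v), Q_{b,1}(v), …` for `a = diag(α)`. It is the solution of
`(Q_k)_x + [v, Q_k] = [Q_{k+1}, a]`, `Q_0 = b`, with `Q_k → 0` as `x → -∞` for `k ≥ 1`: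
the part of `Q_{k+1}` in the image of `ad(a)` is
`P = -ad(a)⁻¹ ((Q_k)_x + [v, Q_k])`, and the part `T` in the centralizer of `a` is determined by
`T_x = -π₀ [v, P]` and `T → 0` as `x → -∞`. -/
noncomputable def fluxQ {n : ℕ} (α : Fin n → ℂ) (b : CMat n) (v : ℝ → CMat n) :
    ℕ → ℝ → CMat n
  | 0 => fun _ => b
  | k + 1 =>
    let P : ℝ → CMat n := fun y => -adInv α (matDeriv (fluxQ α b v k) y + ⁅v y, fluxQ α b v k y⁆)
    fun x => P x - Matrix.of fun i l => ∫ y in Set.Iic x, centralizerPart α ⁅v y, P y⁆ i l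

/-- `Q_{b,k}(u)` at `(x, t)` for a function `u` of `(x, t)`: the operator acts in the variable `x`
at fixed `t`. -/
noncomputable def fluxAt {n : ℕ} (α : Fin n → ℂ) (b : CMat n) (u : ℝ → ℝ → CMat n) (k : ℕ)
    (x t : ℝ) : CMat n :=
  fluxQ α b (fun y => u y t) k x

/-- `u ∈ ℳ_{a,b,j}`, `a = diag(α)`: `u` is a smooth map from `ℝ²` to `𝒰_a^⊥`, in the Schwartz class
in `x` for every `t`, and solves the `j`-th flow `u_t = (Q_{b,j}(u))_x + [u, Q_{b,j}(u)]`. -/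
structure IsFlowSolution {n : ℕ} (α : Fin n → ℂ) (b : CMat n) (j : ℕ)
    (u : ℝ → ℝ → CMat n) : Prop where
  smooth : MatSmooth u
  mem_perp : ∀ x t, u x t ∈ unitaryPerp (Matrix.diagonal α)
  schwartz : ∀ t i k, ∃ f : 𝓢(ℝ, ℂ), ∀ x, f x = u x t i k
  flow : ∀ x t, matDeriv (fun s => u x s) t =
    matDeriv (fun y => fluxAt α b u j y t) x + ⁅u x t, fluxAt α b u j x t⁆

/-- `E` is the trivialization of `u` normalized at `(0,0)`: `E_x = E (aξ + u)`,
`E_t = E (bξ^j + Q_{b,1}(u) ξ^{j-1} + ⋯ + Q_{b,j}(u))`, `E(0,0,ξ) = I`. -/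
structure IsTrivialization {n : ℕ} (α : Fin n → ℂ) (b : CMat n) (j : ℕ)
    (u : ℝ → ℝ → CMat n) (E : ℝ → ℝ → ℂ → CMat n) : Prop where
  smooth : ∀ ξ, MatSmooth fun x t => E x t ξ
  deriv_x : ∀ x t ξ, matDeriv (fun y => E y t ξ) x = E x t ξ * (ξ • Matrix.diagonal α + u x t)
  deriv_t : ∀ x t ξ, matDeriv (fun s => E x s ξ) t =
    E x t ξ * ∑ k ∈ Finset.range (j + 1), ξ ^ k • fluxAt α b u (j - k) x t
  init : ∀ ξ, E 0 0 ξ = 1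

/-- The matrix of the Hermitian (orthogonal) projection of `ℂⁿ` onto `V`. -/
noncomputable def hermProj {n : ℕ} (V : Submodule ℂ (EuclideanSpace ℂ (Fin n))) : CMat n :=
  (Matrix.toEuclideanCLM (n := Fin n) (𝕜 := ℂ)).symm V.starProjection

/-- The image `M(V)` of a subspace `V` of `ℂⁿ` under a matrix `M`. -/
noncomputable def imageSubspace {n : ℕ} (M : CMat n)
    (V : Submodule ℂ (EuclideanSpace ℂ (Fin n))) : Submodule ℂ (EuclideanSpace ℂ (Fin n)) :=
  V.map (Matrix.toEuclideanLin M)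

/-- The simple element `g_{z,π}(ξ) = π + (ξ - z)/(ξ - z̄) π^⊥`; it has a pole at `ξ = z̄`, where
the value of this function is meaningless. -/
noncomputable def simpleElement {n : ℕ} (z : ℂ) (π : CMat n) (ξ : ℂ) : CMat n :=
  π + ((ξ - z) / (ξ - conj z)) • (1 - π)

/-- `f ∈ G_+`: `f` is holomorphic on `ℂ` and satisfies the `U(n)`-reality condition (which forces
its values to be invertible). -/
def MemGPlus {n : ℕ} (f : ℂ → CMat n) : Prop :=
  (∀ i k, Differentiable ℂ fun ξ => f ξ i k) ∧ ∀ ξ, (f (conj ξ)).conjTranspose * f ξ = 1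

/-- `g ∈ G_-^m`: `g` is a rational map, equal to `q⁻¹ P` off the zeros of `q`, with `g(∞) = I`,
satisfying the `U(n)`-reality condition. The values of `g` at the zeros of `q` are ignored. -/
def MemGMinus {n : ℕ} (g : ℂ → CMat n) : Prop :=
  ∃ (q : Polynomial ℂ) (P : Matrix (Fin n) (Fin n) (Polynomial ℂ)), q ≠ 0 ∧
    (∀ ξ, q.eval ξ ≠ 0 → g ξ = (q.eval ξ)⁻¹ • P.map (Polynomial.eval ξ)) ∧
    Filter.Tendsto g (Filter.cocompact ℂ) (nhds 1) ∧
    ∀ ξ, q.eval ξ ≠ 0 → q.eval (conj ξ) ≠ 0 → (g (conj ξ)).conjTranspose * g ξ = 1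

/-- `ρ` is a smooth solution, with initial value `π`, of the pair of ordinary differential equations
`ρ_x + [az + u, ρ] = (z̄ - z)[ρ, a]ρ`, `ρ_t = ∑_{k=0}^j [ρ, Q_{b,j-k}(u)](z + (z̄ - z)ρ)^k`
in Hermitian projections. -/
structure IsProjectionSystemSolution {n : ℕ} (α : Fin n → ℂ) (b : CMat n) (j : ℕ)
    (u : ℝ → ℝ → CMat n) (z : ℂ) (π : CMat n) (ρ : ℝ → ℝ → CMat n) : Prop where
  smooth : MatSmooth ρ
  deriv_x : ∀ x t, matDeriv (fun y => ρ y t) x + ⁅z • Matrix.diagonal α + u x t, ρ x t⁆ =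
    (conj z - z) • (⁅ρ x t, Matrix.diagonal α⁆ * ρ x t)
  deriv_t : ∀ x t, matDeriv (fun s => ρ x s) t =
    ∑ k ∈ Finset.range (j + 1),
      ⁅ρ x t, fluxAt α b u (j - k) x t⁆ * (z • (1 : CMat n) + (conj z - z) • ρ x t) ^ k
  hermitian : ∀ x t, (ρ x t).conjTranspose = ρ x t
  idempotent : ∀ x t, ρ x t * ρ x t = ρ x t
  init : ρ 0 0 = π

/-! ### Entrywise calculus of matrix-valued functions. -/

section MatrixCalculus

variable {n : ℕ}

/-! Put `A = z + (z̄ - z)π̃` (`dressMatrix`), so that `g_{z,π̃}(ξ) = (ξ - A)/(ξ - z̄)`. The theorem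
is then about the gauge transformation by the linear factor `ξ - A`.

The projection onto `E(z)*(V)` is given by a Gram matrix formula, so it is smooth. If `E' = EB`, its
derivative is `(1 - R)B*R + RB(1 - R)` (`hermProj_imageSubspace_deriv`). For `B` polynomial in `z`
with skew-Hermitian coefficients this is the stated system, and the system says that `ξ - A`
intertwines the connection coefficient `aξ + u` with `aξ + ũ`.

The recursion for the fluxes, with its limits at `-∞`, has exactly one solution
(`IsFluxSequence.eq_fluxQ`). The coefficients of `(ξ - A)(∑ Q_k ξ^{-k})(ξ - A)⁻¹` (`gaugeFlux`)
solve the recursion of `ũ`, hence they are the fluxes of `ũ`, and the flow equation for `ũ` becomes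
an algebraic identity.

The analytic core is that `ũ` is Schwartz in `x`, that is, that the entries of `π̃` between
different eigenspaces of `a` are. Let `N` be the sum of their squared norms. Up to the perturbation
`u` the equation in `x` is gradient-like: the trace of `π̃` weighted by the eigenvalues of `a/i` is
monotone with speed comparable to `N`. The compression of `π̃` to an eigenspace of `a` is idempotent
up to `O(N)`, so its trace is within `O(N)` of an integer. The limits of these traces are integers,
so the weighted trace is within `O(N)` of its limit. This Łojasiewicz inequality forces `N` to decay
as fast as the perturbation allows (`rapid_decay_of_near_int`), and the differential equation then
controls the derivatives.

Variation of constants shows that `E` is entire in `ξ`. The product `(ξ - A(0,0)) E (ξ - A*)`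
vanishes at `z` and `z̄`, and dividing by `(ξ - z)(ξ - z̄)` gives an entire `Ẽ`. Its equations
follow from the product rule off `z, z̄`, and at these two points by a limit which Grönwall's and
Schwarz's inequalities make locally uniform in `(x, t)` (`isSolutionAt_of_punctured`). -/

/-- `f` has derivative `f'` at `x`, entry by entry. -/
def HasMatDerivAt (f : ℝ → CMat n) (f' : CMat n) (x : ℝ) : Prop :=
  ∀ i k, HasDerivAt (fun y => f y i k) (f' i k) x

namespace HasMatDerivAt

variable {f g : ℝ → CMat n} {f' g' : CMat n} {x : ℝ}

theorem matDeriv_eq (h : HasMatDerivAt f f' x) : matDeriv f x = f' := by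
  ext i k
  exact (h i k).deriv

theorem congr_deriv (h : HasMatDerivAt f f' x) (e : f' = g') : HasMatDerivAt f g' x := e ▸ h

theorem const (c : CMat n) (x : ℝ) : HasMatDerivAt (fun _ => c) 0 x :=
  fun i k => hasDerivAt_const x (c i k)

theorem add (hf : HasMatDerivAt f f' x) (hg : HasMatDerivAt g g' x) :
    HasMatDerivAt (fun y => f y + g y) (f' + g') x :=
  fun i k => (hf i k).add (hg i k)

theorem sub (hf : HasMatDerivAt f f' x) (hg : HasMatDerivAt g g' x) :
    HasMatDerivAt (fun y => f y - g y) (f' - g') x :=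
  fun i k => (hf i k).sub (hg i k)

theorem neg (hf : HasMatDerivAt f f' x) : HasMatDerivAt (fun y => -f y) (-f') x :=
  fun i k => (hf i k).neg

theorem smul (c : ℂ) (hf : HasMatDerivAt f f' x) :
    HasMatDerivAt (fun y => c • f y) (c • f') x :=
  fun i k => (hf i k).const_mul c

theorem mul (hf : HasMatDerivAt f f' x) (hg : HasMatDerivAt g g' x) :
    HasMatDerivAt (fun y => f y * g y) (f' * g x + f x * g') x := by
  intro i k
  simp only [Matrix.mul_apply, Matrix.add_apply, ← Finset.sum_add_distrib]
  exact HasDerivAt.fun_sum fun l _ => (hf i l).mul (hg l k)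

theorem mul_const (hf : HasMatDerivAt f f' x) (c : CMat n) :
    HasMatDerivAt (fun y => f y * c) (f' * c) x :=
  (hf.mul (const c x)).congr_deriv (by simp)

theorem const_mul (c : CMat n) (hf : HasMatDerivAt f f' x) :
    HasMatDerivAt (fun y => c * f y) (c * f') x :=
  ((const c x).mul hf).congr_deriv (by simp)

theorem conjTranspose (hf : HasMatDerivAt f f' x) :
    HasMatDerivAt (fun y => (f y).conjTranspose) f'.conjTranspose x :=
  fun i k => (hf k i).star

theorem comp_neg (hf : HasMatDerivAt f f' (-x)) :
    HasMatDerivAt (fun y => f (-y)) (-f') x := by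
  intro i k
  have := (hf i k).scomp x (hasDerivAt_neg x)
  simpa [Function.comp_def] using this

theorem unique (h : HasMatDerivAt f f' x) (h' : HasMatDerivAt f g' x) : f' = g' :=
  h.matDeriv_eq.symm.trans h'.matDeriv_eq

end HasMatDerivAt

/-- A matrix-valued function with vanishing derivative is constant. -/
theorem eq_of_hasMatDerivAt_zero {f : ℝ → CMat n} (h : ∀ x, HasMatDerivAt f 0 x) (x y : ℝ) :
    f x = f y := by
  ext i k
  exact is_const_of_deriv_eq_zero (fun s => (h s i k).differentiableAt)
    (fun s => (h s i k).deriv) x y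

theorem matDeriv_hasMatDerivAt {f : ℝ → CMat n} {x : ℝ}
    (h : ∀ i k, DifferentiableAt ℝ (fun y => f y i k) x) : HasMatDerivAt f (matDeriv f x) x :=
  fun i k => (h i k).hasDerivAt

namespace MatSmooth

variable {f g : ℝ → ℝ → CMat n}

theorem const (c : CMat n) : MatSmooth (fun _ _ => c) := fun _ _ => contDiff_const

theorem add (hf : MatSmooth f) (hg : MatSmooth g) : MatSmooth (fun x t => f x t + g x t) :=
  fun i k => (hf i k).add (hg i k)

theorem sub (hf : MatSmooth f) (hg : MatSmooth g) : MatSmooth (fun x t => f x t - g x t) :=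
  fun i k => (hf i k).sub (hg i k)

theorem smul (c : ℂ) (hf : MatSmooth f) : MatSmooth (fun x t => c • f x t) :=
  fun i k => contDiff_const.mul (hf i k)

theorem mul (hf : MatSmooth f) (hg : MatSmooth g) : MatSmooth (fun x t => f x t * g x t) := by
  intro i k
  simp only [Matrix.mul_apply]
  exact ContDiff.sum fun l _ => (hf i l).mul (hg l k)

theorem sum {ι : Type*} (s : Finset ι) {F : ι → ℝ → ℝ → CMat n} (h : ∀ i ∈ s, MatSmooth (F i)) :
    MatSmooth (fun x t => ∑ i ∈ s, F i x t) := by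
  intro i k
  simp only [Matrix.sum_apply]
  exact ContDiff.sum fun l hl => h l hl i k

theorem lie (hf : MatSmooth f) (hg : MatSmooth g) : MatSmooth (fun x t => ⁅f x t, g x t⁆) := by
  simpa only [Ring.lie_def] using (hf.mul hg).sub (hg.mul hf)

theorem conjTranspose (hf : MatSmooth f) : MatSmooth (fun x t => (f x t).conjTranspose) :=
  fun i k => Complex.conjCLE.contDiff.comp (hf k i)

theorem smooth_x (hf : MatSmooth f) (t : ℝ) (i k : Fin n) :
    ContDiff ℝ ∞ fun x => f x t i k :=
  (hf i k).comp (contDiff_id.prodMk contDiff_const)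

theorem smooth_t (hf : MatSmooth f) (x : ℝ) (i k : Fin n) :
    ContDiff ℝ ∞ fun t => f x t i k :=
  (hf i k).comp (contDiff_const.prodMk contDiff_id)

theorem hasMatDerivAt_x (hf : MatSmooth f) (x t : ℝ) :
    HasMatDerivAt (fun y => f y t) (matDeriv (fun y => f y t) x) x :=
  matDeriv_hasMatDerivAt fun i k => (hf.smooth_x t i k).differentiable (by simp) x

theorem hasMatDerivAt_t (hf : MatSmooth f) (x t : ℝ) :
    HasMatDerivAt (fun s => f x s) (matDeriv (fun s => f x s) t) t :=
  matDeriv_hasMatDerivAt fun i k => (hf.smooth_t x i k).differentiable (by simp) t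

/-- The total derivative of an entry in terms of the partial derivatives. -/
theorem hasFDerivAt (hf : MatSmooth f) (x t : ℝ) (i k : Fin n) :
    HasFDerivAt (fun p : ℝ × ℝ => f p.1 p.2 i k)
      ((ContinuousLinearMap.fst ℝ ℝ ℝ).smulRight (matDeriv (fun y => f y t) x i k) +
        (ContinuousLinearMap.snd ℝ ℝ ℝ).smulRight (matDeriv (fun s => f x s) t i k)) (x, t) := by
  have h := ((hf i k).differentiable (by simp) (x, t)).hasFDerivAt
  have hx : HasDerivAt (fun y => f y t i k)
      (fderiv ℝ (fun p : ℝ × ℝ => f p.1 p.2 i k) (x, t) (1, 0)) x :=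
    h.comp_hasDerivAt x (f := fun y => (y, t)) ((hasDerivAt_id x).prodMk (hasDerivAt_const x t))
  have ht : HasDerivAt (fun s => f x s i k)
      (fderiv ℝ (fun p : ℝ × ℝ => f p.1 p.2 i k) (x, t) (0, 1)) t :=
    h.comp_hasDerivAt t (f := fun s => (x, s)) ((hasDerivAt_const t x).prodMk (hasDerivAt_id t))
  refine h.congr_fderiv (ContinuousLinearMap.prod_ext ?_ ?_)
  · ext
    simp [← (hf.hasMatDerivAt_x x t i k).unique hx]
  · ext
    simp [← (hf.hasMatDerivAt_t x t i k).unique ht]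

theorem matDeriv_t (hf : MatSmooth f) : MatSmooth (fun x t => matDeriv (fun s => f x s) t) := by
  intro i k
  have h : ContDiff ℝ ∞ fun p : ℝ × ℝ =>
      fderiv ℝ (fun p : ℝ × ℝ => f p.1 p.2 i k) p ((0, 1) : ℝ × ℝ) :=
    (((hf i k).fderiv_right (m := ∞) (by simp)).clm_apply contDiff_const)
  convert h using 2 with p
  rw [(hf.hasFDerivAt p.1 p.2 i k).fderiv]
  simp

theorem continuous (hf : MatSmooth f) (i k : Fin n) :
    Continuous fun p : ℝ × ℝ => f p.1 p.2 i k := (hf i k).continuous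

/-- The pointwise inverse of a smooth family of invertible matrices is smooth. -/
theorem inv (hf : MatSmooth f) (hu : ∀ x t, (f x t).det ≠ 0) :
    MatSmooth (fun x t => (f x t)⁻¹) := by
  have hdet : ∀ F : ℝ → ℝ → CMat n, MatSmooth F →
      ContDiff ℝ ∞ fun p : ℝ × ℝ => (F p.1 p.2).det := by
    intro F hF
    simp only [Matrix.det_apply]
    exact ContDiff.sum fun σ _ => ContDiff.const_smul _ (contDiff_prod fun i _ => hF _ _)
  intro i k
  simp only [Matrix.inv_def, Ring.inverse_eq_inv', Matrix.smul_apply, smul_eq_mul,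
    Matrix.adjugate_apply]
  refine ((hdet f hf).inv fun p => hu p.1 p.2).mul
    (hdet (fun x t => (f x t).updateRow k (Pi.single i 1)) fun l m => ?_)
  by_cases h : l = k
  · subst h
    simpa using contDiff_const
  · simpa [Matrix.updateRow_ne h] using hf l m

end MatSmooth

end MatrixCalculus

/-! ### The Hermitian projection onto a moving subspace `M*(V)`. -/

section Projection

variable {n : ℕ}

theorem hermProj_conjTranspose (V : Submodule ℂ (EuclideanSpace ℂ (Fin n))) :
    (hermProj V).conjTranspose = hermProj V := by
  apply EquivLike.injective (Matrix.toEuclideanCLM (n := Fin n) (𝕜 := ℂ))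
  rw [← Matrix.star_eq_conjTranspose, map_star, hermProj, StarAlgEquiv.apply_symm_apply]
  exact isSelfAdjoint_starProjection V

theorem hermProj_mul_self (V : Submodule ℂ (EuclideanSpace ℂ (Fin n))) :
    hermProj V * hermProj V = hermProj V := by
  rw [hermProj, ← map_mul]
  congr 1
  exact V.isIdempotentElem_starProjection

/-- A Hermitian idempotent is the Hermitian projection onto its image. -/
theorem hermProj_eq_of_range {R : CMat n} (hs : R.conjTranspose = R) (hi : R * R = R)
    {V : Submodule ℂ (EuclideanSpace ℂ (Fin n))}
    (hV : LinearMap.range (Matrix.toEuclideanLin R) = V) : hermProj V = R := by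
  rw [hermProj, StarAlgEquiv.symm_apply_eq]
  refine ContinuousLinearMap.IsStarProjection.ext isStarProjection_starProjection
    ⟨?_, ?_⟩ ?_
  · rw [IsIdempotentElem, ← map_mul, hi]
  · rw [IsSelfAdjoint, ← map_star, Matrix.star_eq_conjTranspose, hs]
  · rw [V.range_starProjection, ← hV]
    rfl

theorem range_toEuclideanLin_hermProj (V : Submodule ℂ (EuclideanSpace ℂ (Fin n))) :
    LinearMap.range (Matrix.toEuclideanLin (hermProj V)) = V := by
  rw [← Matrix.coe_toEuclideanCLM_eq_toEuclideanLin, hermProj, StarAlgEquiv.apply_symm_apply]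
  exact V.range_starProjection

theorem toEuclideanLin_mul (A B : CMat n) :
    Matrix.toEuclideanLin (A * B) = Matrix.toEuclideanLin A ∘ₗ Matrix.toEuclideanLin B := by
  rw [← Matrix.coe_toEuclideanCLM_eq_toEuclideanLin, map_mul]
  rfl

theorem imageSubspace_eq_range (M : CMat n) (V : Submodule ℂ (EuclideanSpace ℂ (Fin n))) :
    imageSubspace M V = LinearMap.range (Matrix.toEuclideanLin (M * hermProj V)) := by
  rw [toEuclideanLin_mul, LinearMap.range_comp, range_toEuclideanLin_hermProj, imageSubspace]

/-- A Hermitian idempotent `R` with `R = (M π) C` and `R M π = M π` is the projection onto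
`M(V)`. -/
theorem hermProj_imageSubspace_eq {R M C : CMat n} {V : Submodule ℂ (EuclideanSpace ℂ (Fin n))}
    (hs : R.conjTranspose = R) (hi : R * R = R) (hC : R = M * hermProj V * C)
    (hR : R * (M * hermProj V) = M * hermProj V) : hermProj (imageSubspace M V) = R := by
  refine hermProj_eq_of_range hs hi ?_
  rw [imageSubspace_eq_range]
  apply le_antisymm
  · rw [hC, toEuclideanLin_mul _ C]
    exact LinearMap.range_comp_le_range _ _
  · conv_lhs => rw [← hR, toEuclideanLin_mul R]
    exact LinearMap.range_comp_le_range _ _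

/-- The Gram matrix of `M* π`, completed by the identity on the kernel of `π`. -/
noncomputable def gramMatrix (π M : CMat n) : CMat n :=
  π * M * M.conjTranspose * π + (1 - π)

-- The matrix is `(πM)(πM)* + (1 - π)(1 - π)*`, a sum of two positive semidefinite terms. A null
-- vector `v` is null for both, so `v = πv` and `M*v = M*πv = 0`, which forces `v = 0`.
open ComplexOrder in
theorem det_gramMatrix_ne_zero {π M : CMat n} (hs : π.conjTranspose = π) (hi : π * π = π)
    (hM : M.det ≠ 0) : (gramMatrix π M).det ≠ 0 := by
  intro h
  obtain ⟨v, hv, hv0⟩ := Matrix.exists_mulVec_eq_zero_iff.mpr h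
  have h1 : gramMatrix π M = (π * M) * (π * M).conjTranspose + (1 - π) * (1 - π).conjTranspose := by
    simp only [gramMatrix, Matrix.conjTranspose_mul, Matrix.conjTranspose_sub, hs,
      Matrix.conjTranspose_one]
    have : (1 - π) * (1 - π) = 1 - π := by
      simp [mul_sub, sub_mul, hi]
    rw [this]
    simp [mul_assoc]
  have h2 : star v ⬝ᵥ (gramMatrix π M).mulVec v = 0 := by simp [hv0]
  have key : ∀ B : CMat n, star v ⬝ᵥ (B * B.conjTranspose).mulVec v =
      star (B.conjTranspose.mulVec v) ⬝ᵥ (B.conjTranspose.mulVec v) := by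
    intro B
    rw [Matrix.star_mulVec, Matrix.conjTranspose_conjTranspose, ← Matrix.mulVec_mulVec,
      Matrix.dotProduct_mulVec]
  rw [h1, Matrix.add_mulVec, dotProduct_add, key, key] at h2
  have h3 := (add_eq_zero_iff_of_nonneg (dotProduct_star_self_nonneg _)
    (dotProduct_star_self_nonneg _)).mp h2
  have h4 := dotProduct_star_self_eq_zero.mp h3.1
  have h5 := dotProduct_star_self_eq_zero.mp h3.2
  simp only [Matrix.conjTranspose_mul, Matrix.conjTranspose_sub, hs, Matrix.conjTranspose_one,
    Matrix.sub_mulVec, Matrix.one_mulVec, sub_eq_zero, ← Matrix.mulVec_mulVec] at h4 h5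
  rw [← h5] at h4
  refine hv (Matrix.eq_zero_of_mulVec_eq_zero ?_ h4)
  rwa [Matrix.det_conjTranspose, star_ne_zero]

/-- The Hermitian projection onto `M*(V)`, `M` invertible, in terms of the Gram matrix. -/
theorem hermProj_imageSubspace_conjTranspose {M : CMat n} (hM : M.det ≠ 0)
    (V : Submodule ℂ (EuclideanSpace ℂ (Fin n))) :
    hermProj (imageSubspace M.conjTranspose V) =
      M.conjTranspose * hermProj V * ((gramMatrix (hermProj V) M)⁻¹ * (hermProj V * M)) := by
  set π := hermProj V with hπ
  have hs : π.conjTranspose = π := hermProj_conjTranspose V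
  have hi : π * π = π := hermProj_mul_self V
  set G := gramMatrix π M with hG
  have hGd : IsUnit G.det := isUnit_iff_ne_zero.mpr (det_gramMatrix_ne_zero hs hi hM)
  have hGs : G.conjTranspose = G := by
    simp [hG, gramMatrix, hs, mul_assoc]
  have hGis : G⁻¹.conjTranspose = G⁻¹ := by rw [Matrix.conjTranspose_nonsing_inv, hGs]
  have hGπ : G * π = π * M * M.conjTranspose * π := by
    simp [hG, gramMatrix, add_mul, sub_mul, mul_assoc, hi]
  have hGG : G⁻¹ * (π * M * M.conjTranspose * π) = π := by
    rw [← hGπ, ← mul_assoc, Matrix.nonsing_inv_mul _ hGd, one_mul]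
  have hR : M.conjTranspose * π * (G⁻¹ * (π * M)) * (M.conjTranspose * π) =
      M.conjTranspose * π := by
    calc _ = M.conjTranspose * π * (G⁻¹ * (π * M * M.conjTranspose * π)) := by
          simp only [mul_assoc]
      _ = _ := by rw [hGG, mul_assoc, hi]
  refine hermProj_imageSubspace_eq ?_ ?_ rfl hR
  · simp only [Matrix.conjTranspose_mul, Matrix.conjTranspose_conjTranspose, hs, hGis, mul_assoc]
  · rw [← mul_assoc, hR]

/-- With `Y = M*π` this reads `RY = Y`; the derivative of this relation gives the motion of `R`. -/
theorem hermProj_imageSubspace_mul (M : CMat n)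
    (V : Submodule ℂ (EuclideanSpace ℂ (Fin n))) :
    hermProj (imageSubspace M.conjTranspose V) * (M.conjTranspose * hermProj V) =
      M.conjTranspose * hermProj V := by
  set R := hermProj (imageSubspace M.conjTranspose V) with hR
  have h1 : LinearMap.range (Matrix.toEuclideanLin (M.conjTranspose * hermProj V)) =
      LinearMap.range (Matrix.toEuclideanLin R) := by
    rw [← imageSubspace_eq_range, hR, range_toEuclideanLin_hermProj]
  apply Matrix.toEuclideanLin.injective
  refine LinearMap.ext fun v => ?_
  obtain ⟨w, hw⟩ : Matrix.toEuclideanLin (M.conjTranspose * hermProj V) v ∈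
    LinearMap.range (Matrix.toEuclideanLin R) := h1 ▸ LinearMap.mem_range_self _ v
  rw [toEuclideanLin_mul, LinearMap.comp_apply, ← hw, ← LinearMap.comp_apply,
    ← toEuclideanLin_mul, hermProj_mul_self]

/-- The Gram formula builds the projection from products, adjoints and the inverse of a matrix that
never degenerates. -/
theorem MatSmooth.hermProj_imageSubspace {M : ℝ → ℝ → CMat n} (hM : MatSmooth M)
    (hd : ∀ x t, (M x t).det ≠ 0) (V : Submodule ℂ (EuclideanSpace ℂ (Fin n))) :
    MatSmooth fun x t => hermProj (imageSubspace (M x t).conjTranspose V) := by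
  have hG : MatSmooth fun x t => gramMatrix (hermProj V) (M x t) :=
    ((((const _).mul hM).mul hM.conjTranspose).mul (const _)).add (const _)
  have h := (hM.conjTranspose.mul (const (hermProj V))).mul ((hG.inv fun x t =>
    det_gramMatrix_ne_zero (hermProj_conjTranspose V) (hermProj_mul_self V) (hd x t)).mul
    ((const (hermProj V)).mul hM))
  convert h using 3 with x t
  exact hermProj_imageSubspace_conjTranspose (hd x t) V

/-- The derivative of the projection onto `M(s)*(V)` when `M' = M B`. -/
theorem hermProj_imageSubspace_deriv {M : ℝ → CMat n} {B R' : CMat n} {s : ℝ}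
    (hd : ∀ s, (M s).det ≠ 0) (V : Submodule ℂ (EuclideanSpace ℂ (Fin n)))
    (hM : HasMatDerivAt M (M s * B) s)
    (hR' : HasMatDerivAt (fun s => hermProj (imageSubspace (M s).conjTranspose V)) R' s) :
    R' = (1 - hermProj (imageSubspace (M s).conjTranspose V)) * B.conjTranspose *
        hermProj (imageSubspace (M s).conjTranspose V) +
      hermProj (imageSubspace (M s).conjTranspose V) * B *
        (1 - hermProj (imageSubspace (M s).conjTranspose V)) := by
  -- The three relations `RY = Y`, `R² = R` and `R* = R` are differentiated.
  have hY := hM.conjTranspose.mul_const (hermProj V)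
  have h1 := (hR'.mul hY).unique
    ((by simpa only [hermProj_imageSubspace_mul] using hY))
  have h2 := (hR'.mul hR').unique (by simpa only [hermProj_mul_self] using hR')
  have h3 := hR'.conjTranspose.unique (by simpa only [hermProj_conjTranspose] using hR')
  set R := hermProj (imageSubspace (M s).conjTranspose V) with hRdef
  set Y := (M s).conjTranspose * hermProj V with hYdef
  have hRs : R.conjTranspose = R := hermProj_conjTranspose _
  -- Since `R = YC`, multiplication by `C` turns the formula for `R'Y` into one for `R'R`. Its
  -- adjoint gives `RR'`, and `R' = R'R + RR'`.
  obtain ⟨C, hC⟩ : ∃ C, R = Y * C := ⟨_, hermProj_imageSubspace_conjTranspose (hd s) V⟩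
  have h4 : R' * Y = (1 - R) * B.conjTranspose * Y := by
    have : R' * Y = (M s * B).conjTranspose * hermProj V -
        R * ((M s * B).conjTranspose * hermProj V) := by rw [eq_sub_iff_add_eq, h1]
    rw [this, Matrix.conjTranspose_mul, hYdef]
    noncomm_ring
  have h5 : R' * R = (1 - R) * B.conjTranspose * R := by
    rw [hC, ← mul_assoc, h4, ← hC, mul_assoc _ Y C, ← hC]
  have h6 : R * R' = R * B * (1 - R) := by
    have := congrArg Matrix.conjTranspose h5
    simpa [h3, hRs, mul_assoc] using this
  rw [← h2, h5, h6]

end Projection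

/-! ### Schwartz functions and functions with Schwartz derivative. -/

section SchwartzClass

open Filter Topology MeasureTheory

/-- `f` is (the underlying function of) a Schwartz function. -/
def IsSchwartz (f : ℝ → ℂ) : Prop := ∃ F : 𝓢(ℝ, ℂ), ∀ x, F x = f x

namespace IsSchwartz

variable {f g : ℝ → ℂ}

theorem zero : IsSchwartz fun _ => 0 := ⟨0, fun _ => rfl⟩

theorem add (hf : IsSchwartz f) (hg : IsSchwartz g) : IsSchwartz fun x => f x + g x := by
  obtain ⟨F, hF⟩ := hf
  obtain ⟨G, hG⟩ := hg
  exact ⟨F + G, fun x => by simp [hF, hG]⟩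

theorem const_mul (c : ℂ) (hf : IsSchwartz f) : IsSchwartz fun x => c * f x := by
  obtain ⟨F, hF⟩ := hf
  exact ⟨c • F, fun x => by simp [hF]⟩

theorem neg (hf : IsSchwartz f) : IsSchwartz fun x => -f x := by
  simpa using hf.const_mul (-1)

theorem sub (hf : IsSchwartz f) (hg : IsSchwartz g) : IsSchwartz fun x => f x - g x := by
  simpa [sub_eq_add_neg] using hf.add hg.neg

theorem sum {ι : Type*} {s : Finset ι} {f : ι → ℝ → ℂ} (h : ∀ i ∈ s, IsSchwartz (f i)) :
    IsSchwartz fun x => ∑ i ∈ s, f i x := by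
  classical
  induction s using Finset.induction_on with
  | empty => simpa using zero
  | insert i s hi ih =>
    simp only [Finset.sum_insert hi]
    exact (h i (by simp)).add (ih fun j hj => h j (by simp [hj]))

theorem mul_temperate (hf : IsSchwartz f) (hg : g.HasTemperateGrowth) :
    IsSchwartz fun x => f x * g x := by
  obtain ⟨F, hF⟩ := hf
  refine ⟨SchwartzMap.smulLeftCLM ℂ g F, fun x => ?_⟩
  rw [SchwartzMap.smulLeftCLM_apply_apply hg, hF, smul_eq_mul, mul_comm]

theorem hasTemperateGrowth (hf : IsSchwartz f) : f.HasTemperateGrowth := by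
  obtain ⟨F, hF⟩ := hf
  rw [← funext hF]
  exact F.hasTemperateGrowth

theorem continuous (hf : IsSchwartz f) : Continuous f := hf.hasTemperateGrowth.1.continuous

theorem integrable (hf : IsSchwartz f) : Integrable f := by
  obtain ⟨F, hF⟩ := hf
  rw [← funext hF]
  exact F.integrable

theorem tendsto_atBot (hf : IsSchwartz f) : Tendsto f atBot (𝓝 0) := by
  obtain ⟨F, hF⟩ := hf
  rw [← funext hF]
  exact F.tendsto_cocompact.mono_left atBot_le_cocompact

theorem deriv (hf : IsSchwartz f) : IsSchwartz fun x => deriv f x := by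
  obtain ⟨F, hF⟩ := hf
  rw [← funext hF]
  exact ⟨SchwartzMap.derivCLM ℂ ℂ F, fun x => rfl⟩

theorem hasDerivAt (hf : IsSchwartz f) (x : ℝ) : HasDerivAt f (_root_.deriv f x) x :=
  (hf.hasTemperateGrowth.1.differentiable (by simp) x).hasDerivAt

theorem exists_pow_mul_norm_le (hf : IsSchwartz f) (k : ℕ) :
    ∃ C, ∀ x, |x| ^ k * ‖f x‖ ≤ C := by
  obtain ⟨F, hF⟩ := hf
  obtain ⟨C, hC⟩ := F.decay k 0
  exact ⟨C, fun x => by simpa [hF] using hC.2 x⟩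

end IsSchwartz

/-- A function with Schwartz derivative has temperate growth. -/
theorem hasTemperateGrowth_of_hasDerivAt {f g : ℝ → ℂ} (h : ∀ x, HasDerivAt f (g x) x)
    (hg : IsSchwartz g) : f.HasTemperateGrowth := by
  have hd : deriv f = g := funext fun x => (h x).deriv
  have hgt := hg.hasTemperateGrowth
  refine ⟨contDiff_infty_iff_deriv.2 ⟨fun x => (h x).differentiableAt, hd ▸ hgt.1⟩, fun m => ?_⟩
  rcases m with _ | m
  · obtain ⟨C, hC⟩ := hg.exists_pow_mul_norm_le 0
    have hC0 : 0 ≤ C := le_trans (by positivity) (hC 0)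
    -- A bounded derivative gives at most linear growth, hence the exponent `1`.
    refine ⟨1, ‖f 0‖ + C, fun x => ?_⟩
    have := convex_univ.norm_image_sub_le_of_norm_hasDerivWithin_le (f := f) (f' := g) (C := C)
      (x := 0) (y := x) (fun x _ => (h x).hasDerivWithinAt) (fun x _ => by simpa using hC x)
      (Set.mem_univ _) (Set.mem_univ _)
    have h2 : ‖f x‖ ≤ ‖f x - f 0‖ + ‖f 0‖ := by
      simpa using norm_add_le (f x - f 0) (f 0)
    simp only [norm_iteratedFDeriv_zero, pow_one]
    simp only [sub_zero] at this
    have h3 := norm_nonneg (f 0)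
    have h4 := norm_nonneg x
    nlinarith
  · obtain ⟨k, C, hC⟩ := hgt.2 m
    refine ⟨k, C, fun x => ?_⟩
    rw [norm_iteratedFDeriv_eq_norm_iteratedDeriv, iteratedDeriv_succ', hd,
      ← norm_iteratedFDeriv_eq_norm_iteratedDeriv]
    exact hC x

theorem hasDerivAt_integral_Iic {f : ℝ → ℂ} (hc : Continuous f) (hi : Integrable f) (x : ℝ) :
    HasDerivAt (fun x => ∫ y in Set.Iic x, f y) (f x) x := by
  have h : (fun x => ∫ y in Set.Iic x, f y) =
      fun x => (∫ y in (0 : ℝ)..x, f y) + ∫ y in Set.Iic (0 : ℝ), f y := by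
    ext x
    rw [← intervalIntegral.integral_Iic_sub_Iic hi.integrableOn hi.integrableOn, sub_add_cancel]
  rw [h]
  exact (intervalIntegral.integral_hasDerivAt_right (hc.intervalIntegrable _ _)
    (hc.stronglyMeasurableAtFilter _ _) hc.continuousAt).add_const _

end SchwartzClass

/-! ### Existence, uniqueness and skewness of the fluxes `Q_{b,k}`. -/

section Flux

open Filter Topology MeasureTheory

variable {n : ℕ}

theorem lie_diagonal_apply (α : Fin n → ℂ) (Y : CMat n) (i l : Fin n) :
    ⁅Y, Matrix.diagonal α⁆ i l = Y i l * (α l - α i) := by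
  rw [Ring.lie_def, Matrix.sub_apply, Matrix.mul_diagonal, Matrix.diagonal_mul]
  ring

theorem diagonal_lie_apply (α : Fin n → ℂ) (Y : CMat n) (i l : Fin n) :
    ⁅(Matrix.diagonal α : CMat n), Y⁆ i l = (α i - α l) * Y i l := by
  rw [Ring.lie_def, Matrix.sub_apply, Matrix.mul_diagonal, Matrix.diagonal_mul]
  ring

theorem lie_apply (X Y : CMat n) (i l : Fin n) :
    ⁅X, Y⁆ i l = ∑ m, (X i m * Y m l - Y i m * X m l) := by
  rw [Ring.lie_def, Matrix.sub_apply, Matrix.mul_apply, Matrix.mul_apply, Finset.sum_sub_distrib]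

theorem lie_sub_right (X Y Z : CMat n) : ⁅X, Y - Z⁆ = ⁅X, Y⁆ - ⁅X, Z⁆ := by
  simp only [Ring.lie_def]
  noncomm_ring

/-- `Y` vanishes on the diagonal blocks given by the eigenspaces of `a = diag(α)`. -/
def IsOffBlock (α : Fin n → ℂ) (Y : CMat n) : Prop := ∀ i l, α i = α l → Y i l = 0

/-- The bracket of an off-block and a block matrix vanishes on the diagonal blocks. -/
theorem IsOffBlock.lie_apply_eq_zero {α : Fin n → ℂ} {X Y : CMat n} (hX : IsOffBlock α X)
    (hY : ∀ i l, α i ≠ α l → Y i l = 0) {i l : Fin n} (h : α i = α l) : ⁅X, Y⁆ i l = 0 := by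
  rw [lie_apply]
  refine Finset.sum_eq_zero fun m _ => ?_
  by_cases hm : α i = α m
  · rw [hX i m hm, hX m l (hm.symm.trans h)]
    ring
  · rw [hY i m hm, hY m l fun h' => hm (h.trans h'.symm)]
    ring

/-- The sequences characterized by `Q_0 = b`, `(Q_k)_x + [v, Q_k] = [Q_{k+1}, a]`, `Q_k → 0` at
`-∞` for `k ≥ 1`. -/
structure IsFluxSequence (α : Fin n → ℂ) (b : CMat n) (v : ℝ → CMat n) (Q : ℕ → ℝ → CMat n) :
    Prop where
  zero : ∀ x, Q 0 x = b
  deriv : ∀ k x, HasMatDerivAt (Q k) (⁅Q (k + 1) x, Matrix.diagonal α⁆ - ⁅v x, Q k x⁆) x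
  tendsto : ∀ k i l, Tendsto (fun x => Q (k + 1) x i l) atBot (𝓝 0)

/-- The off-block part of `fluxQ α b v (k + 1)`. -/
noncomputable def fluxOff (α : Fin n → ℂ) (v : ℝ → CMat n) (Q : ℝ → CMat n) (y : ℝ) : CMat n :=
  -adInv α (matDeriv Q y + ⁅v y, Q y⁆)

/-- The block part of `fluxQ α b v (k + 1)`. -/
noncomputable def fluxBlock (α : Fin n → ℂ) (v : ℝ → CMat n) (P : ℝ → CMat n) (x : ℝ) : CMat n :=
  Matrix.of fun i l => ∫ y in Set.Iic x, centralizerPart α ⁅v y, P y⁆ i l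

theorem fluxQ_succ (α : Fin n → ℂ) (b : CMat n) (v : ℝ → CMat n) (k : ℕ) (x : ℝ) :
    fluxQ α b v (k + 1) x = fluxOff α v (fluxQ α b v k) x -
      fluxBlock α v (fluxOff α v (fluxQ α b v k)) x := rfl

theorem fluxOff_apply_of_eq {α : Fin n → ℂ} {i l : Fin n} (h : α i = α l) (v Q : ℝ → CMat n)
    (x : ℝ) : fluxOff α v Q x i l = 0 := by
  simp [fluxOff, adInv, h]

theorem fluxOff_apply_of_ne {α : Fin n → ℂ} {i l : Fin n} (h : α i ≠ α l) (v Q : ℝ → CMat n)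
    (x : ℝ) : fluxOff α v Q x i l = -((α i - α l)⁻¹ * (matDeriv Q x + ⁅v x, Q x⁆) i l) := by
  simp [fluxOff, adInv, h]

theorem fluxBlock_apply_of_eq {α : Fin n → ℂ} {i l : Fin n} (h : α i = α l) (v P : ℝ → CMat n)
    (x : ℝ) : fluxBlock α v P x i l = ∫ y in Set.Iic x, ⁅v y, P y⁆ i l := by
  simp [fluxBlock, centralizerPart, h]

theorem fluxBlock_apply_of_ne {α : Fin n → ℂ} {i l : Fin n} (h : α i ≠ α l) (v P : ℝ → CMat n)
    (x : ℝ) : fluxBlock α v P x i l = 0 := by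
  simp [fluxBlock, centralizerPart, h]

/-- `b = diag(β)` where `β` factors through `α`. -/
def IsBlockScalar (α : Fin n → ℂ) (b : CMat n) : Prop :=
  ∃ β : Fin n → ℂ, b = Matrix.diagonal β ∧ ∀ i l, α i = α l → β i = β l

/-- The hypothesis `b = p(a)` enters only through this property. It makes `[v, b]` vanish on the
diagonal blocks, without which the recursion could not start. -/
theorem isBlockScalar_aeval (α : Fin n → ℂ) (p : Polynomial ℂ) :
    IsBlockScalar α (Polynomial.aeval (Matrix.diagonal α : CMat n) p) := by
  refine ⟨fun i => p.eval (α i), ?_, fun i l h => by simp [h]⟩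
  have h := Polynomial.aeval_algHom_apply (Matrix.diagonalAlgHom (n := Fin n) ℂ (α := ℂ)) α p
  rw [Matrix.diagonalAlgHom_apply] at h
  rw [h, Matrix.diagonalAlgHom_apply]
  congr 1
  ext i
  simp

theorem IsBlockScalar.lie_diagonal {α : Fin n → ℂ} {b : CMat n} (hb : IsBlockScalar α b) :
    ⁅b, (Matrix.diagonal α : CMat n)⁆ = 0 := by
  obtain ⟨β, rfl, -⟩ := hb
  ext i l
  rw [lie_diagonal_apply]
  by_cases h : i = l
  · simp [h]
  · simp [h]

/-- Temperate growth is all that is available for a flux: only its derivative is known to be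
Schwartz, and it need not tend to `0` at `+∞`. -/
theorem isSchwartz_lie_apply {X Y : ℝ → CMat n} (hX : ∀ i l, IsSchwartz fun x => X x i l)
    (hY : ∀ i l, (fun x => Y x i l).HasTemperateGrowth) (i l : Fin n) :
    IsSchwartz fun x => ⁅X x, Y x⁆ i l := by
  simp only [lie_apply]
  refine IsSchwartz.sum fun m _ => ((hX i m).mul_temperate (hY m l)).sub ?_
  simpa only [mul_comm] using (hX m l).mul_temperate (hY i m)

variable {α : Fin n → ℂ} {b : CMat n} {v : ℝ → CMat n}

theorem isSchwartz_fluxOff (hv : ∀ i l, IsSchwartz fun x => v x i l) {Q Q' : ℝ → CMat n}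
    (hQ : ∀ x, HasMatDerivAt Q (Q' x) x) (hQ' : ∀ i l, IsSchwartz fun x => Q' x i l)
    (i l : Fin n) : IsSchwartz fun x => fluxOff α v Q x i l := by
  by_cases h : α i = α l
  · simpa only [fluxOff_apply_of_eq h] using IsSchwartz.zero
  · simp only [fluxOff_apply_of_ne h, Matrix.add_apply, (hQ _).matDeriv_eq]
    exact (((hQ' i l).add (isSchwartz_lie_apply hv (fun i l =>
      hasTemperateGrowth_of_hasDerivAt (fun x => hQ x i l) (hQ' i l)) i l)).const_mul _).neg

/-- The analytic properties of `fluxQ`: its derivative is Schwartz, and the equation for the next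
term is solvable. -/
theorem fluxQ_regular (hb : IsBlockScalar α b) (hv : ∀ i l, IsSchwartz fun x => v x i l)
    (hoff : ∀ x, IsOffBlock α (v x)) (k : ℕ) :
    ∃ Q' : ℝ → CMat n, (∀ x, HasMatDerivAt (fluxQ α b v k) (Q' x) x) ∧
      (∀ i l, IsSchwartz fun x => Q' x i l) ∧
      ∀ x, IsOffBlock α (Q' x + ⁅v x, fluxQ α b v k x⁆) := by
  induction k with
  | zero =>
    refine ⟨fun _ => 0, fun x => HasMatDerivAt.const b x, fun i l => IsSchwartz.zero,
      fun x i l h => ?_⟩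
    obtain ⟨β, rfl, hβ⟩ := hb
    change (0 + ⁅v x, Matrix.diagonal β⁆) i l = 0
    rw [zero_add, lie_diagonal_apply, hβ i l h]
    ring
  | succ k ih =>
    obtain ⟨Q', hQ, hQ', -⟩ := ih
    set P := fluxOff α v (fluxQ α b v k) with hP
    have hPs : ∀ i l, IsSchwartz fun x => P x i l := isSchwartz_fluxOff hv hQ hQ'
    have hL : ∀ i l, IsSchwartz fun x => ⁅v x, P x⁆ i l :=
      isSchwartz_lie_apply hv fun i l => (hPs i l).hasTemperateGrowth
    refine ⟨fun x => Matrix.of fun i l => deriv (fun x => P x i l) x -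
      centralizerPart α ⁅v x, P x⁆ i l, ?_, ?_, ?_⟩
    · intro x i l
      have h1 := (hPs i l).hasDerivAt x
      refine h1.sub ?_
      by_cases h : α i = α l
      · simp only [centralizerPart, h, Matrix.of_apply, if_true]
        exact hasDerivAt_integral_Iic (hL i l).continuous (hL i l).integrable x
      · simpa [fluxBlock, centralizerPart, h] using hasDerivAt_const x (0 : ℂ)
    · intro i l
      refine (hPs i l).deriv.sub ?_
      by_cases h : α i = α l
      · simpa [centralizerPart, h] using hL i l
      · simpa [centralizerPart, h] using IsSchwartz.zero
    · intro x i l h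
      -- On a diagonal block `P` vanishes and so does the bracket of `v` with the block part. The
      -- derivative of the block part contributes `-[v, P]`, which cancels the remaining `[v, P]`.
      have h0 : (fun x => P x i l) = fun _ => 0 := funext fun x => fluxOff_apply_of_eq h _ _ x
      have h1 : ⁅v x, fluxBlock α v P x⁆ i l = 0 :=
        (hoff x).lie_apply_eq_zero (fun i l h => fluxBlock_apply_of_ne h _ _ x) h
      rw [fluxQ_succ, lie_sub_right, Matrix.add_apply, Matrix.sub_apply, h1]
      simp [h0, centralizerPart, h, ← hP]

/-- `fluxQ` solves the recursion which defines it informally. -/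
theorem isFluxSequence_fluxQ (hb : IsBlockScalar α b) (hv : ∀ i l, IsSchwartz fun x => v x i l)
    (hoff : ∀ x, IsOffBlock α (v x)) : IsFluxSequence α b v (fluxQ α b v) where
  zero _ := rfl
  deriv k x := by
    obtain ⟨Q', hQ, -, hc⟩ := fluxQ_regular hb hv hoff k
    refine (hQ x).congr_deriv ?_
    rw [eq_sub_iff_add_eq]
    ext i l
    rw [lie_diagonal_apply]
    by_cases h : α i = α l
    · rw [hc x i l h, h, sub_self, mul_zero]
    · have h' : α i - α l ≠ 0 := sub_ne_zero.mpr h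
      rw [fluxQ_succ, Matrix.sub_apply, fluxBlock_apply_of_ne h, fluxOff_apply_of_ne h,
        (hQ x).matDeriv_eq]
      field_simp
      ring
  tendsto k i l := by
    obtain ⟨Q', hQ, hQ', -⟩ := fluxQ_regular hb hv hoff k
    have hPs : ∀ i l, IsSchwartz fun x => fluxOff α v (fluxQ α b v k) x i l :=
      isSchwartz_fluxOff hv hQ hQ'
    simp only [fluxQ_succ, Matrix.sub_apply]
    rw [← sub_zero (0 : ℂ)]
    refine (hPs i l).tendsto_atBot.sub ?_
    by_cases h : α i = α l
    · simp only [fluxBlock_apply_of_eq h]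
      exact tendsto_integral_Iic_zero tendsto_id
    · simp only [fluxBlock_apply_of_ne h]
      exact tendsto_const_nhds

/-- Uniqueness: every solution of the recursion is `fluxQ`. -/
theorem IsFluxSequence.eq_fluxQ {Q : ℕ → ℝ → CMat n} (hQ : IsFluxSequence α b v Q)
    (hv : ∀ i l, IsSchwartz fun x => v x i l) (hoff : ∀ x, IsOffBlock α (v x)) (k : ℕ) (x : ℝ) :
    Q k x = fluxQ α b v k x := by
  suffices h : Q k = fluxQ α b v k by rw [h]
  clear x
  induction k with
  | zero => exact funext hQ.zero
  | succ k ih =>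
    set P := fluxOff α v (fluxQ α b v k) with hP
    have hPQ : ∀ x i l, α i ≠ α l → P x i l = Q (k + 1) x i l := by
      intro x i l h
      have h' : α i - α l ≠ 0 := sub_ne_zero.mpr h
      rw [hP, fluxOff_apply_of_ne h, ← ih, (hQ.deriv k x).matDeriv_eq, sub_add_cancel,
        lie_diagonal_apply]
      field_simp
      ring
    ext x i l
    rw [fluxQ_succ, ← hP, Matrix.sub_apply]
    by_cases h : α i = α l
    -- On diagonal blocks `[Q_{k+2}, a]` vanishes and `[v, Q_{k+1}]` involves only the part `P`
    -- which is already determined. The entry is recovered by integration from `-∞`.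
    · have hd : ∀ y, HasDerivAt (fun y => Q (k + 1) y i l) (-⁅v y, P y⁆ i l) y := by
        intro y
        convert hQ.deriv (k + 1) y i l using 1
        have h0 : ⁅v y, Q (k + 1) y - P y⁆ i l = 0 :=
          (hoff y).lie_apply_eq_zero (fun i l h => by simp [hPQ y i l h]) h
        rw [lie_sub_right, Matrix.sub_apply, sub_eq_zero] at h0
        rw [Matrix.sub_apply, lie_diagonal_apply, h, h0]
        ring
      -- Of `Q_{k+1}` only continuity and the limit at `-∞` are used: they bound it on the
      -- half-line, and `v` is integrable.
      have hint : IntegrableOn (fun y => -⁅v y, P y⁆ i l) (Set.Iic x) := by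
        have hc : ∀ i l, Continuous fun y => Q (k + 1) y i l := fun i l =>
          continuous_iff_continuousAt.mpr fun y => (hQ.deriv (k + 1) y i l).continuousAt
        have hbd : ∀ i l, ∃ C, ∀ y ∈ Set.Iic x, ‖Q (k + 1) y i l‖ ≤ C := by
          intro i l
          obtain ⟨y₀, hy₀⟩ := eventually_atBot.mp
            ((hQ.tendsto k i l).norm.eventually (gt_mem_nhds (by simp : ‖(0 : ℂ)‖ < 1)))
          obtain ⟨C, hC⟩ := (isCompact_Icc (a := y₀) (b := x)).exists_bound_of_continuousOn
            (hc i l).continuousOn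
          refine ⟨max 1 C, fun y hy => ?_⟩
          rcases le_total y y₀ with h | h
          · exact (hy₀ y h).le.trans (le_max_left _ _)
          · exact (hC y ⟨h, hy⟩).trans (le_max_right _ _)
        have hPi : ∀ w, IsSchwartz w → ∀ i l, IntegrableOn (fun y => w y * P y i l)
            (Set.Iic x) := by
          intro w hw i l
          by_cases h : α i = α l
          · simp [hP, fluxOff_apply_of_eq h]
          · simp only [hPQ _ i l h]
            obtain ⟨C, hC⟩ := hbd i l
            exact hw.integrable.integrableOn.mul_bdd (c := C) (hc i l).aestronglyMeasurable
              ((ae_restrict_iff' measurableSet_Iic).mpr (ae_of_all _ hC))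
        simp only [lie_apply]
        refine (integrable_finsetSum _ fun m _ => (hPi _ (hv i m) m l).sub ?_).neg
        simpa only [mul_comm] using hPi _ (hv m l) i m
      have := integral_Iic_of_hasDerivAt_of_tendsto' (fun y _ => hd y) hint (hQ.tendsto k i l)
      rw [fluxBlock_apply_of_eq h, hP, fluxOff_apply_of_eq h, ← hP, zero_sub, ← integral_neg,
        this, sub_zero]
    · rw [fluxBlock_apply_of_ne h, sub_zero, hPQ x i l h]

/-- The sequence `-Q_k*` solves the same recursion with the same limits, so uniqueness applies. -/
theorem fluxQ_conjTranspose (ha : (Matrix.diagonal α : CMat n).conjTranspose = -Matrix.diagonal α)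
    (hbs : b.conjTranspose = -b) (hb : IsBlockScalar α b)
    (hv : ∀ i l, IsSchwartz fun x => v x i l) (hoff : ∀ x, IsOffBlock α (v x))
    (hvs : ∀ x, (v x).conjTranspose = -v x) (k : ℕ) (x : ℝ) :
    (fluxQ α b v k x).conjTranspose = -fluxQ α b v k x := by
  have hQ := isFluxSequence_fluxQ hb hv hoff
  have h : IsFluxSequence α b v fun k x => -(fluxQ α b v k x).conjTranspose := by
    refine ⟨fun x => by simp [hQ.zero, hbs], fun k x => ?_, fun k i l => ?_⟩
    · refine (hQ.deriv k x).conjTranspose.neg.congr_deriv ?_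
      simp only [Ring.lie_def, Matrix.conjTranspose_sub, Matrix.conjTranspose_mul, ha, hvs]
      noncomm_ring
    · simpa using (hQ.tendsto k l i).star.neg
  exact neg_eq_iff_eq_neg.mp (h.eq_fluxQ hv hoff k x)

end Flux

/-! ### Decay of scalar quantities under a Łojasiewicz-type inequality. -/

section ScalarDecay

open Filter Topology Set

theorem monotoneOn_Ici_of_hasDerivAt {p p' : ℝ → ℝ} {a : ℝ}
    (hd : ∀ x, a ≤ x → HasDerivAt p (p' x) x) (h0 : ∀ x, a ≤ x → 0 ≤ p' x) :
    MonotoneOn p (Ici a) := by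
  refine monotoneOn_of_hasDerivWithinAt_nonneg (f' := p') (convex_Ici a)
    (fun x hx => (hd x hx).continuousAt.continuousWithinAt) (fun x hx => ?_) (fun x hx => ?_)
  · rw [interior_Ici] at hx
    exact (hd x (le_of_lt hx)).hasDerivWithinAt
  · rw [interior_Ici] at hx
    exact h0 x (le_of_lt hx)

theorem exists_tendsto_of_deriv_nonneg {p p' : ℝ → ℝ} {a B : ℝ}
    (hd : ∀ x, a ≤ x → HasDerivAt p (p' x) x) (h0 : ∀ x, a ≤ x → 0 ≤ p' x)
    (hB : ∀ x, a ≤ x → p x ≤ B) : ∃ L, Tendsto p atTop (𝓝 L) := by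
  have hm : Monotone fun x => p (max x a) := fun x y hxy =>
    monotoneOn_Ici_of_hasDerivAt hd h0 (mem_Ici.mpr (le_max_right _ _))
      (mem_Ici.mpr (le_max_right _ _)) (max_le_max hxy le_rfl)
  refine ⟨_, (tendsto_atTop_ciSup hm ⟨B, ?_⟩).congr' ?_⟩
  · rintro _ ⟨x, rfl⟩
    exact hB _ (le_max_right _ _)
  · filter_upwards [eventually_ge_atTop a] with x hx
    rw [max_eq_left hx]

/-- A nonnegative function with `|N'| ≤ C (N + w)` cannot drop quickly. -/
theorem le_exp_mul_of_deriv_bound {N N' w : ℝ → ℝ} {C x y W₀ : ℝ} (hC : 0 ≤ C) (hW₀ : 0 ≤ W₀)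
    (hN : ∀ x, 0 ≤ x → 0 ≤ N x) (hd : ∀ x, 0 ≤ x → HasDerivAt N (N' x) x)
    (hb : ∀ x, 0 ≤ x → |N' x| ≤ C * (N x + w x)) (hx : 0 ≤ x) (hxy : x ≤ y) (hy : y ≤ x + 1)
    (hw : ∀ s, x ≤ s → w s ≤ W₀) : N x ≤ Real.exp C * (N y + W₀) := by
  -- Grönwall's integrating factor: `N' ≥ -C(N + W₀)`.
  have hm : MonotoneOn (fun s => Real.exp (C * (s - x)) * (N s + W₀)) (Ici x) := by
    refine monotoneOn_Ici_of_hasDerivAt (p' := fun s => Real.exp (C * (s - x)) * C * (N s + W₀) +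
      Real.exp (C * (s - x)) * N' s) (fun s hs => ?_) (fun s hs => ?_)
    · have h1 : HasDerivAt (fun s => Real.exp (C * (s - x))) (Real.exp (C * (s - x)) * C) s := by
        simpa using (((hasDerivAt_id s).sub_const x).const_mul C).exp
      exact h1.mul ((hd s (hx.trans hs)).add_const W₀)
    · have h1 := (abs_le.mp (hb s (hx.trans hs))).1
      have h2 := hw s hs
      have h3 : 0 ≤ C * (N s + W₀) + N' s := by nlinarith
      have h4 := mul_nonneg (Real.exp_pos (C * (s - x))).le h3
      linarith
  have h := hm (mem_Ici.mpr le_rfl) (mem_Ici.mpr hxy) hxy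
  simp only [sub_self, mul_zero, Real.exp_zero, one_mul] at h
  have h2 : Real.exp (C * (y - x)) ≤ Real.exp C := by
    apply Real.exp_le_exp.mpr
    nlinarith
  have h3 : 0 ≤ N y + W₀ := add_nonneg (hN y (hx.trans hxy)) hW₀
  nlinarith [mul_le_mul_of_nonneg_right h2 h3]

/-- A function which is close to integers and converges, is close to its limit. -/
theorem eventually_abs_sub_le_of_near_int {t N : ℝ → ℝ} {τ K : ℝ} (ht : Tendsto t atTop (𝓝 τ))
    (hN : Tendsto N atTop (𝓝 0)) (h : ∀ x, 0 ≤ x → ∃ m : ℤ, |t x - m| ≤ K * N x) :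
    ∀ᶠ x in atTop, |t x - τ| ≤ K * N x := by
  have hKN : Tendsto (fun x => K * N x) atTop (𝓝 0) := by simpa using hN.const_mul K
  choose! m hm using h
  have hmτ : Tendsto (fun x => (m x : ℝ)) atTop (𝓝 τ) := by
    have : Tendsto (fun x => t x - m x) atTop (𝓝 0) := by
      refine squeeze_zero_norm' ?_ hKN
      filter_upwards [eventually_ge_atTop 0] with x hx using hm x hx
    simpa using ht.sub this
  -- The nearby integers also converge to `τ`. Since `ℤ` is closed and discrete, `τ` is an integer
  -- and they are eventually equal to it.
  obtain ⟨m₀, rfl⟩ : τ ∈ range ((↑) : ℤ → ℝ) :=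
    Int.isClosedEmbedding_coe_real.isClosed_range.mem_of_tendsto hmτ
      (Eventually.of_forall fun x => mem_range_self _)
  have h1 : Tendsto m atTop (𝓝 m₀) := Int.isClosedEmbedding_coe_real.tendsto_nhds_iff.mpr hmτ
  rw [nhds_discrete, tendsto_pure] at h1
  filter_upwards [h1, eventually_ge_atTop 0] with x hx hx0
  rw [← hx]
  exact hm x hx0

/-- Decay of `G` with `G' ≤ -N` when `G` is controlled by `N`. -/
theorem exists_pow_mul_le_of_deriv_le {G G' N W : ℝ → ℝ} {K c x₀ : ℝ} {k : ℕ} (hK : 0 < K)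
    (hc : 0 ≤ c) (hx₀ : 0 ≤ x₀) (hd : ∀ x, 0 ≤ x → HasDerivAt G (G' x) x)
    (hG0 : ∀ x, 0 ≤ x → 0 ≤ G x) (hG' : ∀ x, 0 ≤ x → G' x ≤ -N x)
    (hGN : ∀ x, x₀ ≤ x → G x ≤ K * N x + W x) (hW : ∀ x, 0 ≤ x → (1 + x) ^ k * W x ≤ c) :
    ∃ x₁, x₀ ≤ x₁ ∧ ∃ C, ∀ x, x₁ ≤ x → (1 + x) ^ k * G x ≤ C := by
  -- Beyond `2kK` the factor `(1 + x)^k` has logarithmic derivative at most `1/(2K)`, half of the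
  -- decay rate `1/K` of `G`.
  set x₁ := max x₀ (2 * k * K) with hx₁
  have hx₁0 : 0 ≤ x₁ := hx₀.trans (le_max_left _ _)
  refine ⟨x₁, le_max_left _ _, (1 + x₁) ^ k * G x₁ + 2 * c, fun x hx => ?_⟩
  -- With `Y = (1 + s)^k G` the hypotheses give `Y' ≤ Y/(2K) - (Y - c)/K = -(Y - 2c)/(2K)`, so
  -- `exp((s - x₁)/(2K))(Y - 2c)` does not increase.
  have hm : MonotoneOn
      (fun s => -(Real.exp ((2 * K)⁻¹ * (s - x₁)) * ((1 + s) ^ k * G s - 2 * c))) (Ici x₁) := by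
    refine monotoneOn_Ici_of_hasDerivAt (p' := fun s =>
      -(Real.exp ((2 * K)⁻¹ * (s - x₁)) * (2 * K)⁻¹ * ((1 + s) ^ k * G s - 2 * c) +
      Real.exp ((2 * K)⁻¹ * (s - x₁)) * ((k * (1 + s) ^ (k - 1)) * G s + (1 + s) ^ k * G' s)))
      (fun s hs => ?_) (fun s hs => ?_)
    · have h1 : HasDerivAt (fun s => Real.exp ((2 * K)⁻¹ * (s - x₁)))
          (Real.exp ((2 * K)⁻¹ * (s - x₁)) * (2 * K)⁻¹) s := by
        simpa using (((hasDerivAt_id s).sub_const x₁).const_mul (2 * K)⁻¹).exp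
      have h2 : HasDerivAt (fun s : ℝ => (1 + s) ^ k) (k * (1 + s) ^ (k - 1)) s := by
        simpa using ((hasDerivAt_id s).const_add 1).fun_pow k
      exact (h1.mul ((h2.mul (hd s (hx₁0.trans hs))).sub_const _)).neg
    · have hs0 : 0 ≤ s := hx₁0.trans hs
      have hsk : 2 * k * K ≤ s := (le_max_right _ _).trans hs
      have hp : 0 < (1 + s) ^ k := by positivity
      have h1 : (k : ℝ) * (1 + s) ^ (k - 1) * (2 * K) ≤ (1 + s) ^ k := by
        rcases k with _ | k
        · simp
        · have h2 : ((k + 1 : ℕ) : ℝ) * (2 * K) ≤ 1 + s := by linarith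
          have h3 := mul_le_mul_of_nonneg_left h2 (by positivity : 0 ≤ (1 + s) ^ k)
          rw [Nat.add_sub_cancel, pow_succ]
          linarith
      have hG := hG0 s hs0
      have h4 : (k : ℝ) * (1 + s) ^ (k - 1) * G s * (2 * K) ≤ (1 + s) ^ k * G s := by
        nlinarith
      have h5 : (1 + s) ^ k * G' s ≤ -((1 + s) ^ k * N s) := by
        nlinarith [hG' s hs0]
      have h6 : (1 + s) ^ k * G s ≤ K * ((1 + s) ^ k * N s) + c := by
        nlinarith [hGN s ((le_max_left _ _).trans hs), hW s hs0]
      have h7 : ((1 + s) ^ k * G s - 2 * c) +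
          (2 * K) * ((k * (1 + s) ^ (k - 1)) * G s + (1 + s) ^ k * G' s) ≤ 0 := by
        nlinarith
      have h8 : (2 * K)⁻¹ * ((1 + s) ^ k * G s - 2 * c) +
          ((k * (1 + s) ^ (k - 1)) * G s + (1 + s) ^ k * G' s) ≤ 0 := by
        have h9 := mul_nonpos_of_nonneg_of_nonpos (by positivity : 0 ≤ (2 * K)⁻¹) h7
        rw [mul_add, inv_mul_cancel_left₀ (by positivity)] at h9
        exact h9
      have h10 := mul_nonpos_of_nonneg_of_nonpos (Real.exp_pos ((2 * K)⁻¹ * (s - x₁))).le h8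
      linarith
  have h := hm (mem_Ici.mpr le_rfl) (mem_Ici.mpr hx) hx
  simp only [sub_self, mul_zero, Real.exp_zero, one_mul, neg_le_neg_iff] at h
  by_contra! hcon
  have h1 : 1 ≤ Real.exp ((2 * K)⁻¹ * (x - x₁)) :=
    Real.one_le_exp (mul_nonneg (by positivity) (sub_nonneg.mpr hx))
  have h2 : 0 ≤ (1 + x₁) ^ k * G x₁ := mul_nonneg (by positivity) (hG0 x₁ hx₁0)
  nlinarith

theorem hasDerivAt_const_div_one_add_pow (c : ℝ) (k : ℕ) {x : ℝ} (hx : 0 ≤ x) :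
    HasDerivAt (fun x : ℝ => c / (1 + x) ^ (k + 1)) (-(c * (k + 1)) / (1 + x) ^ (k + 2)) x := by
  have h2 : HasDerivAt (fun s : ℝ => (1 + s) ^ (k + 1)) ((k + 1 : ℕ) * (1 + x) ^ k) x := by
    simpa using ((hasDerivAt_id x).const_add 1).fun_pow (k + 1)
  have hx1 : 1 + x ≠ 0 := by positivity
  refine ((hasDerivAt_const x c).fun_div h2 (pow_ne_zero _ hx1)).congr_deriv ?_
  push_cast
  field_simp
  ring

theorem tendsto_const_div_one_add_pow (c : ℝ) (k : ℕ) :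
    Tendsto (fun x : ℝ => c / (1 + x) ^ (k + 1)) atTop (𝓝 0) :=
  tendsto_const_nhds.div_atTop ((tendsto_pow_atTop (by simp)).comp
    (tendsto_atTop_add_const_left _ _ tendsto_id))

/-- A Łojasiewicz-type argument: if the increasing quantity `∑ c_i t_i` has derivative at least
`N - w`, and each `t_i` is within `O(N)` of an integer, then `N` decays rapidly along with `w`. -/
theorem rapid_decay_of_near_int {ι : Type*} [Fintype ι] {t t' : ι → ℝ → ℝ} {coef : ι → ℝ}
    {N N' w : ℝ → ℝ} {C K : ℝ} (hC : 0 ≤ C)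
    (hN : ∀ x, 0 ≤ x → 0 ≤ N x)
    (ht : ∀ i x, 0 ≤ x → HasDerivAt (t i) (t' i x) x)
    (hNd : ∀ x, 0 ≤ x → HasDerivAt N (N' x) x)
    (ht' : ∀ i x, 0 ≤ x → |t' i x| ≤ C * (N x + w x))
    (hN' : ∀ x, 0 ≤ x → |N' x| ≤ C * (N x + w x))
    (hf : ∀ x, 0 ≤ x → N x - w x ≤ ∑ i, coef i * t' i x)
    (htb : ∀ i x, 0 ≤ x → |t i x| ≤ C)
    (hint : ∀ i x, 0 ≤ x → ∃ m : ℤ, |t i x - m| ≤ K * N x)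
    (hw : ∀ k : ℕ, ∃ c, ∀ x, 0 ≤ x → (1 + x) ^ k * w x ≤ c) (k : ℕ) :
    ∃ c, ∀ x, 0 ≤ x → (1 + x) ^ k * N x ≤ c := by
  set f : ℝ → ℝ := fun x => ∑ i, coef i * t i x with hfdef
  have hfd : ∀ x, 0 ≤ x → HasDerivAt f (∑ i, coef i * t' i x) x := fun x hx =>
    HasDerivAt.fun_sum fun i _ => (ht i x hx).const_mul _
  have hfb : ∀ x, 0 ≤ x → |f x| ≤ ∑ i, |coef i| * C := fun x hx =>
    (Finset.abs_sum_le_sum_abs _ _).trans (Finset.sum_le_sum fun i _ => by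
      rw [abs_mul]
      exact mul_le_mul_of_nonneg_left (htb i x hx) (abs_nonneg _))
  set F := ∑ i, |coef i| * C with hF
  -- The factor `k + 1` makes the bound the exact negative derivative of `c / (1 + x)^(k + 1)`,
  -- which can then be added to `f` as a correction.
  have hw' : ∀ k : ℕ, ∃ c, 0 ≤ c ∧ ∀ x, 0 ≤ x → w x ≤ c * (k + 1) / (1 + x) ^ (k + 2) := by
    intro k
    obtain ⟨c, hc⟩ := hw (k + 2)
    refine ⟨|c|, abs_nonneg c, fun x hx => ?_⟩
    rw [le_div_iff₀ (by positivity), mul_comm]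
    have : |c| * 1 ≤ |c| * (k + 1) := mul_le_mul_of_nonneg_left (by simp) (abs_nonneg c)
    linarith [hc x hx, le_abs_self c]
  have hWanti : ∀ (c : ℝ) (k : ℕ) (x s : ℝ), 0 ≤ c → 0 ≤ x → x ≤ s →
      c / (1 + s) ^ k ≤ c / (1 + x) ^ k := by
    intro c k x s hc hx hs
    gcongr
  -- convergence
  obtain ⟨c₀, hc₀, hw₀⟩ := hw' 0
  -- The correction makes `f - W` bounded above and increasing, with derivative at least `N`.
  set W : ℝ → ℝ := fun x => c₀ / (1 + x) ^ (0 + 1) with hW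
  have hWd : ∀ x, 0 ≤ x → HasDerivAt W (-(c₀ * ((0 : ℕ) + 1)) / (1 + x) ^ (0 + 2)) x :=
    fun x hx => hasDerivAt_const_div_one_add_pow c₀ 0 hx
  have hWb : ∀ x, 0 ≤ x → 0 ≤ W x := fun x hx => by positivity
  have hWlim : Tendsto W atTop (𝓝 0) := tendsto_const_div_one_add_pow c₀ 0
  have hfW : ∀ x, 0 ≤ x →
      N x ≤ ∑ i, coef i * t' i x - -(c₀ * ((0 : ℕ) + 1)) / (1 + x) ^ (0 + 2) := by
    intro x hx
    have h1 := hf x hx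
    have h2 := hw₀ x hx
    rw [neg_div]
    linarith
  obtain ⟨L, hL⟩ := exists_tendsto_of_deriv_nonneg (a := 0) (B := F)
    (fun x hx => (hfd x hx).sub (hWd x hx)) (fun x hx => (hN x hx).trans (hfW x hx))
    (fun x hx => by
      have := (abs_le.mp (hfb x hx)).2
      have := hWb x hx
      simp only [Pi.sub_apply]
      linarith)
  -- By the mean value theorem the increment of `f - W` over `[x, x + 1]` bounds `N` at some point
  -- of the interval; since `N` cannot drop quickly, it bounds `N x` as well, up to `exp C` and a
  -- term that vanishes at infinity.
  have hNlim : Tendsto N atTop (𝓝 0) := by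
    have hL1 : Tendsto (fun x => (f - W) (x + 1)) atTop (𝓝 L) :=
      hL.comp (tendsto_atTop_add_const_right _ _ tendsto_id)
    have hz : Tendsto (fun x => Real.exp C * (((f - W) (x + 1) - (f - W) x) +
        c₀ * ((0 : ℕ) + 1) / (1 + x) ^ (0 + 2))) atTop (𝓝 0) := by
      have := ((hL1.sub hL).add
        (tendsto_const_div_one_add_pow (c₀ * ((0 : ℕ) + 1)) 1)).const_mul (Real.exp C)
      simpa using this
    refine squeeze_zero' ?_ ?_ hz
    · filter_upwards [eventually_ge_atTop 0] with x hx using hN x hx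
    · filter_upwards [eventually_ge_atTop 0] with x hx
      have hder : ∀ s, 0 ≤ s → HasDerivAt (f - W) _ s := fun s hs => (hfd s hs).sub (hWd s hs)
      obtain ⟨y, hy, hy'⟩ := exists_hasDerivAt_eq_slope (f - W) _ (lt_add_one x)
        (fun s hs => (hder s (hx.trans hs.1)).continuousAt.continuousWithinAt)
        (fun s hs => hder s (hx.trans hs.1.le))
      have h1 : N y ≤ (f - W) (x + 1) - (f - W) x := by
        refine (hfW y (hx.trans hy.1.le)).trans (hy'.trans ?_).le
        simp
      have h2 := le_exp_mul_of_deriv_bound hC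
        (by positivity : (0 : ℝ) ≤ c₀ * ((0 : ℕ) + 1) / (1 + x) ^ (0 + 2)) hN hNd hN' hx
        hy.1.le hy.2.le (fun s hs => (hw₀ s (hx.trans hs)).trans
          (hWanti _ _ _ _ (by positivity) hx hs))
      refine h2.trans (mul_le_mul_of_nonneg_left ?_ (Real.exp_pos _).le)
      linarith
  -- From `|t_i'| ≤ C(N + w) ≤ C(f' + 2w)`, the function `t_i + C(f - 2W)` is increasing and bounded
  -- above.
  have htlim : ∀ i, ∃ τ, Tendsto (t i) atTop (𝓝 τ) := by
    intro i
    have hder : ∀ x, 0 ≤ x → HasDerivAt (fun x => t i x + C * (f x - 2 * W x)) (t' i x + C *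
        (∑ i, coef i * t' i x - 2 * (-(c₀ * ((0 : ℕ) + 1)) / (1 + x) ^ (0 + 2)))) x := fun x hx =>
      (ht i x hx).add (((hfd x hx).sub ((hWd x hx).const_mul 2)).const_mul C)
    obtain ⟨M, hM⟩ := exists_tendsto_of_deriv_nonneg (a := 0) (B := C + C * F) hder
      (fun x hx => by
        have h1 := (abs_le.mp (ht' i x hx)).1
        have h2 := hf x hx
        have h3 := hw₀ x hx
        have h4 : N x + w x ≤ ∑ i, coef i * t' i x -
            2 * (-(c₀ * ((0 : ℕ) + 1)) / (1 + x) ^ (0 + 2)) := by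
          rw [neg_div]
          linarith
        have h5 := mul_le_mul_of_nonneg_left h4 hC
        linarith)
      (fun x hx => by
        have h1 := (abs_le.mp (htb i x hx)).2
        have h2 : f x - 2 * W x ≤ F := by
          have := (abs_le.mp (hfb x hx)).2
          have := hWb x hx
          linarith
        have h3 := mul_le_mul_of_nonneg_left h2 hC
        linarith)
    refine ⟨M - C * (L - 0), ?_⟩
    have h1 := hM.sub ((hL.sub hWlim).const_mul C)
    refine h1.congr fun x => ?_
    simp only [Pi.sub_apply]
    ring
  choose τ hτ using htlim
  -- the gradient inequality
  set f₀ := ∑ i, coef i * τ i with hf₀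
  have hflim : Tendsto f atTop (𝓝 f₀) := tendsto_finsetSum _ fun i _ => (hτ i).const_mul _
  have hev : ∀ᶠ x in atTop, ∀ i, |t i x - τ i| ≤ K * N x :=
    eventually_all.mpr fun i => eventually_abs_sub_le_of_near_int (hτ i) hNlim (hint i)
  obtain ⟨x₀, hx₀⟩ := eventually_atTop.mp hev
  -- The summand `1` only ensures positivity.
  set K' := (∑ i, |coef i|) * |K| + 1 with hK'
  have hK'pos : 0 < K' := by positivity
  have hloj : ∀ x, max x₀ 0 ≤ x → f₀ - f x ≤ K' * N x := by
    intro x hx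
    have hNx := hN x ((le_max_right _ _).trans hx)
    have h1 : f₀ - f x = ∑ i, coef i * (τ i - t i x) := by
      simp [hf₀, hfdef, mul_sub, Finset.sum_sub_distrib]
    have h2 : ∑ i, coef i * (τ i - t i x) ≤ ∑ i, |coef i| * (|K| * N x) :=
      Finset.sum_le_sum fun i _ => by
        refine (le_abs_self _).trans ?_
        rw [abs_mul, abs_sub_comm]
        refine mul_le_mul_of_nonneg_left ?_ (abs_nonneg _)
        exact (hx₀ x ((le_max_left _ _).trans hx) i).trans
          (mul_le_mul_of_nonneg_right (le_abs_self K) hNx)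
    rw [h1]
    refine h2.trans ?_
    rw [← Finset.sum_mul, hK']
    linarith
  -- decay of order `k`
  obtain ⟨c, hc, hwk⟩ := hw' k
  set V : ℝ → ℝ := fun x => c / (1 + x) ^ (k + 1) with hV
  have hVd : ∀ x, 0 ≤ x → HasDerivAt V (-(c * (k + 1)) / (1 + x) ^ (k + 2)) x :=
    fun x hx => hasDerivAt_const_div_one_add_pow c k hx
  -- The gap to the limit, corrected by `V` so that `G' ≤ -N`. It decreases to `0`, so it is
  -- nonnegative.
  set G : ℝ → ℝ := fun x => f₀ - f x + V x with hG
  have hGd : ∀ x, 0 ≤ x → HasDerivAt G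
      (-(∑ i, coef i * t' i x) + -(c * (k + 1)) / (1 + x) ^ (k + 2)) x :=
    fun x hx => ((hfd x hx).const_sub _).add (hVd x hx)
  have hGN : ∀ x, 0 ≤ x →
      -(∑ i, coef i * t' i x) + -(c * (k + 1)) / (1 + x) ^ (k + 2) ≤ -N x := by
    intro x hx
    have h1 := hf x hx
    have h2 := hwk x hx
    rw [neg_div]
    linarith
  have hGlim : Tendsto G atTop (𝓝 0) := by
    simpa using (tendsto_const_nhds (x := f₀) |>.sub hflim).add (tendsto_const_div_one_add_pow c k)
  have hGmono : MonotoneOn (fun x => -G x) (Ici 0) :=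
    monotoneOn_Ici_of_hasDerivAt (fun x hx => (hGd x hx).neg) fun x hx => by
      linarith [hGN x hx, hN x hx]
  have hG0 : ∀ x, 0 ≤ x → 0 ≤ G x := by
    intro x hx
    refine le_of_tendsto hGlim ?_
    filter_upwards [eventually_ge_atTop x] with y hy
    have := hGmono (mem_Ici.mpr hx) (mem_Ici.mpr (hx.trans hy)) hy
    simpa using this
  have hVk : ∀ x, 0 ≤ x → (1 + x) ^ k * V x ≤ c := by
    intro x hx
    simp only [hV, pow_succ]
    have h1 : (1 + x) ^ k * (c / ((1 + x) ^ k * (1 + x))) = c / (1 + x) := by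
      have : 1 + x ≠ 0 := by positivity
      field_simp
    rw [h1]
    exact div_le_self hc (by linarith)
  obtain ⟨x₁, hx₁, B, hB⟩ := exists_pow_mul_le_of_deriv_le (N := N) (W := V) hK'pos hc
    (le_max_right x₀ 0) hGd hG0 hGN (fun x hx => by
      have := hloj x hx
      simp only [hG]
      linarith) hVk
  have hx₁0 : 0 ≤ x₁ := (le_max_right _ _).trans hx₁
  obtain ⟨D, hD⟩ := (isCompact_Icc (a := (0 : ℝ)) (b := x₁)).exists_bound_of_continuousOn
    (f := fun x => (1 + x) ^ k * N x) (ContinuousOn.mul (by fun_prop)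
      (fun x hx => (hNd x hx.1).continuousAt.continuousWithinAt))
  refine ⟨max D (Real.exp C * (B + c * (k + 1))), fun x hx => ?_⟩
  rcases le_total x x₁ with h | h
  · exact ((le_abs_self _).trans (hD x ⟨hx, h⟩)).trans (le_max_left _ _)
  · refine le_trans ?_ (le_max_right _ _)
    -- Decay passes from `G` to `N` through a mean value point: `N y ≤ G x - G (x + 1) ≤ G x`.
    obtain ⟨y, hy, hy'⟩ := exists_hasDerivAt_eq_slope G _ (lt_add_one x)
      (fun s hs => (hGd s (hx.trans hs.1)).continuousAt.continuousWithinAt)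
      (fun s hs => hGd s (hx.trans hs.1.le))
    have h1 : N y ≤ G x := by
      have h2 := hGN y (hx.trans hy.1.le)
      rw [hy'] at h2
      have h3 := hG0 (x + 1) (by linarith)
      simp only [add_sub_cancel_left, div_one] at h2
      linarith
    have h2 := le_exp_mul_of_deriv_bound hC
      (by positivity : (0 : ℝ) ≤ c * (k + 1) / (1 + x) ^ (k + 2)) hN hNd hN' hx
      hy.1.le hy.2.le (fun s hs => (hwk s (hx.trans hs)).trans
        (hWanti _ _ _ _ (by positivity) hx hs))
    have hp : 0 < (1 + x) ^ k := by positivity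
    have h3 : (1 + x) ^ k * (c * (k + 1) / (1 + x) ^ (k + 2)) ≤ c * (k + 1) := by
      have h4 : (1 + x) ^ k * (c * (k + 1) / (1 + x) ^ (k + 2)) = c * (k + 1) / (1 + x) ^ 2 := by
        have : 1 + x ≠ 0 := by positivity
        field_simp
        ring
      rw [h4]
      exact div_le_self (by positivity) (one_le_pow₀ (by linarith))
    calc (1 + x) ^ k * N x ≤ (1 + x) ^ k * (Real.exp C * (G x +
          c * (k + 1) / (1 + x) ^ (k + 2))) := by
          refine mul_le_mul_of_nonneg_left (h2.trans ?_) hp.le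
          exact mul_le_mul_of_nonneg_left (by linarith) (Real.exp_pos _).le
      _ = Real.exp C * ((1 + x) ^ k * G x + (1 + x) ^ k * (c * (k + 1) / (1 + x) ^ (k + 2))) := by
          ring
      _ ≤ _ := mul_le_mul_of_nonneg_left (add_le_add (hB x h) h3) (Real.exp_pos _).le

end ScalarDecay

/-! ### Almost idempotent matrices have almost integral trace. -/

section NearIntegers

variable {n : ℕ}

/-- The hypothesis places `a` in `[0, 1]`, where the distance to the nearer endpoint is at most
`2a(1 - a)`. -/
theorem exists_int_near_of_sub_sq_nonneg {a : ℝ} (h : 0 ≤ a - a ^ 2) :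
    ∃ m : ℤ, |a - m| ≤ 2 * (a - a ^ 2) := by
  have h0 : 0 ≤ a := by nlinarith
  have h1 : a ≤ 1 := by nlinarith
  rcases le_total a (1 / 2) with h | h
  · exact ⟨0, by rw [abs_le]; constructor <;> push_cast <;> nlinarith⟩
  · exact ⟨1, by rw [abs_le]; constructor <;> push_cast <;> nlinarith⟩

theorem mul_conjTranspose_apply_self_re (B : CMat n) (i : Fin n) :
    ((B * B.conjTranspose) i i).re = ∑ m, ‖B i m‖ ^ 2 := by
  rw [Matrix.mul_apply, Complex.re_sum]
  refine Finset.sum_congr rfl fun m _ => ?_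
  rw [Matrix.conjTranspose_apply, Complex.star_def, Complex.mul_conj, Complex.ofReal_re,
    Complex.normSq_eq_norm_sq]

/-- A Hermitian matrix which is almost idempotent has almost integral trace. -/
theorem exists_int_near_trace {A B : CMat n} (hA : A.IsHermitian)
    (hB : A - A * A = B * B.conjTranspose) :
    ∃ m : ℤ, |A.trace.re - m| ≤ 2 * (B * B.conjTranspose).trace.re := by
  have hsp := hA.spectral_theorem
  rw [Unitary.conjStarAlgAut_apply] at hsp
  set U : CMat n := (hA.eigenvectorUnitary : CMat n) with hU
  have hUU : star U * U = 1 := Unitary.coe_star_mul_self _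
  have hUU' : U * star U = 1 := Unitary.coe_mul_star_self _
  set D : CMat n := Matrix.diagonal (RCLike.ofReal ∘ hA.eigenvalues) with hD
  have h1 : star U * A * U = D := by
    rw [hsp]
    calc _ = (star U * U) * D * (star U * U) := by simp only [mul_assoc]
      _ = D := by rw [hUU]; simp
  have htr : ∀ X : CMat n, (star U * X * U).trace = X.trace := fun X => by
    rw [Matrix.trace_mul_comm, ← mul_assoc, hUU', one_mul]
  -- In an eigenbasis each `λ - λ²` is the squared norm of a row, hence nonnegative, and these
  -- numbers add up to the trace of `BB*`.
  have h2 : D - D * D = (star U * B) * (star U * B).conjTranspose := by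
    rw [Matrix.conjTranspose_mul, ← h1, Matrix.star_eq_conjTranspose,
      Matrix.conjTranspose_conjTranspose, ← Matrix.star_eq_conjTranspose]
    calc _ = star U * (A - A * (U * star U) * A) * U := by noncomm_ring
      _ = star U * (B * B.conjTranspose) * U := by rw [hUU', mul_one, hB]
      _ = _ := by noncomm_ring
  have h3 : ∀ i, ((D - D * D) i i).re = hA.eigenvalues i - hA.eigenvalues i ^ 2 := by
    intro i
    rw [hD, Matrix.diagonal_mul_diagonal, Matrix.sub_apply, Matrix.diagonal_apply_eq,
      Matrix.diagonal_apply_eq]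
    simp [sq]
  have h4 : ∀ i, 0 ≤ hA.eigenvalues i - hA.eigenvalues i ^ 2 := by
    intro i
    rw [← h3, h2, mul_conjTranspose_apply_self_re]
    positivity
  choose m hm using fun i => exists_int_near_of_sub_sq_nonneg (h4 i)
  refine ⟨∑ i, m i, ?_⟩
  have h5 : A.trace.re = ∑ i, hA.eigenvalues i := by
    rw [← htr, h1, hD, Matrix.trace_diagonal, Complex.re_sum]
    simp
  have h6 : (B * B.conjTranspose).trace.re = ∑ i, (hA.eigenvalues i - hA.eigenvalues i ^ 2) := by
    rw [← hB, ← htr]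
    have : star U * (A - A * A) * U = D - D * D := by
      rw [← h1]
      calc _ = star U * (A - A * 1 * A) * U := by rw [mul_one]
        _ = _ := by rw [← hUU']; noncomm_ring
    rw [this, Matrix.trace, Complex.re_sum]
    exact Finset.sum_congr rfl fun i _ => h3 i
  rw [h5, h6, Finset.mul_sum]
  push_cast
  rw [← Finset.sum_sub_distrib]
  exact (Finset.abs_sum_le_sum_abs _ _).trans (Finset.sum_le_sum fun i _ => hm i)

/-- The trace of a diagonal block of a Hermitian projection is close to an integer if the
corresponding off-diagonal block is small. -/
theorem exists_int_near_block_trace {ρ : CMat n} (hs : ρ.conjTranspose = ρ) (hi : ρ * ρ = ρ)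
    (S : Fin n → Prop) [DecidablePred S] :
    ∃ m : ℤ, |(∑ i, if S i then (ρ i i).re else 0) - m| ≤
      2 * ∑ i, ∑ k, if S i ∧ ¬ S k then ‖ρ i k‖ ^ 2 else 0 := by
  set e : CMat n := Matrix.diagonal fun i => if S i then 1 else 0 with he
  have hee : e * e = e := by
    rw [he, Matrix.diagonal_mul_diagonal]
    congr 1
    ext i
    simp
  have hes : e.conjTranspose = e := by
    rw [he, Matrix.diagonal_conjTranspose]
    congr 1
    ext i
    by_cases h : S i <;> simp [h]
  have hA : (e * ρ * e).IsHermitian := by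
    rw [Matrix.IsHermitian, Matrix.conjTranspose_mul, Matrix.conjTranspose_mul, hes, hs, mul_assoc]
  -- Because `ρ² = ρ`, the defect of idempotency of the compression is `eρ(1 - e)ρe`, which sees
  -- only the off-diagonal block.
  have hB : e * ρ * e - e * ρ * e * (e * ρ * e) =
      (e * ρ * (1 - e)) * (e * ρ * (1 - e)).conjTranspose := by
    rw [Matrix.conjTranspose_mul, Matrix.conjTranspose_mul, Matrix.conjTranspose_sub, hes, hs,
      Matrix.conjTranspose_one]
    calc _ = e * (ρ * ρ) * e - e * ρ * (e * e) * ρ * e := by rw [hi]; simp only [mul_assoc]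
      _ = e * (ρ * ρ) * e - e * ρ * e * ρ * e - e * ρ * e * ρ * e + e * ρ * (e * e) * ρ * e := by
        rw [hee]; noncomm_ring
      _ = _ := by noncomm_ring
  obtain ⟨m, hm⟩ := exists_int_near_trace hA hB
  refine ⟨m, ?_⟩
  have h1 : (e * ρ * e).trace.re = ∑ i, if S i then (ρ i i).re else 0 := by
    rw [Matrix.trace, Complex.re_sum]
    refine Finset.sum_congr rfl fun i _ => ?_
    rw [Matrix.diag_apply, he, Matrix.mul_diagonal, Matrix.diagonal_mul]
    by_cases h : S i <;> simp [h]
  have h2 : ((e * ρ * (1 - e)) * (e * ρ * (1 - e)).conjTranspose).trace.re =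
      ∑ i, ∑ k, if S i ∧ ¬ S k then ‖ρ i k‖ ^ 2 else 0 := by
    rw [Matrix.trace, Complex.re_sum]
    refine Finset.sum_congr rfl fun i _ => ?_
    rw [Matrix.diag_apply, mul_conjTranspose_apply_self_re]
    refine Finset.sum_congr rfl fun k _ => ?_
    rw [mul_sub, mul_one, Matrix.sub_apply, he, Matrix.mul_diagonal, Matrix.diagonal_mul]
    by_cases h : S i <;> by_cases h' : S k <;> simp [h, h']
  rwa [h1, h2] at hm

/-- From `ρρ* = ρ`, the entry `ρ_ii` is the sum of the squared norms of its row. It therefore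
dominates its own square, so it is at most `1`, and it dominates the squares of the other entries of
the row. -/
theorem norm_apply_le_one_of_projection {ρ : CMat n} (hs : ρ.conjTranspose = ρ) (hi : ρ * ρ = ρ)
    (i k : Fin n) : ‖ρ i k‖ ≤ 1 := by
  have h1 : (ρ i i).re = ∑ m, ‖ρ i m‖ ^ 2 := by
    rw [← mul_conjTranspose_apply_self_re, hs, hi]
  have h2 : ∀ m, ‖ρ i m‖ ^ 2 ≤ (ρ i i).re := fun m => by
    rw [h1]
    exact Finset.single_le_sum (f := fun m => ‖ρ i m‖ ^ 2) (fun _ _ => by positivity)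
      (Finset.mem_univ m)
  have h3 : (ρ i i).re ≤ ‖ρ i i‖ := Complex.re_le_norm _
  have h4 := h2 i
  have h5 : ‖ρ i i‖ ≤ 1 := by
    by_contra! h
    nlinarith
  nlinarith [h2 k, norm_nonneg (ρ i k)]

end NearIntegers

/-! ### Decay at `+∞` of the off-block entries of the moving projection. -/

section HalfLineDecay

variable {n : ℕ}

/-- The square of the norm of the off-block part of a matrix. -/
noncomputable def offBlockSq (α : Fin n → ℂ) (Y : CMat n) : ℝ :=
  ∑ i, ∑ k, if α i ≠ α k then ‖Y i k‖ ^ 2 else 0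

/-- The sum of the absolute values of the entries of a matrix. -/
noncomputable def entrySum (Y : CMat n) : ℝ := ∑ i, ∑ k, ‖Y i k‖

theorem offBlockSq_nonneg (α : Fin n → ℂ) (Y : CMat n) : 0 ≤ offBlockSq α Y :=
  Finset.sum_nonneg fun i _ => Finset.sum_nonneg fun k _ => by split_ifs <;> positivity

theorem entrySum_nonneg (Y : CMat n) : 0 ≤ entrySum Y :=
  Finset.sum_nonneg fun _ _ => Finset.sum_nonneg fun _ _ => norm_nonneg _

theorem sq_norm_apply_le_offBlockSq {α : Fin n → ℂ} (Y : CMat n) {i k : Fin n} (h : α i ≠ α k) :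
    ‖Y i k‖ ^ 2 ≤ offBlockSq α Y := by
  have h0 : ∀ i k, 0 ≤ if α i ≠ α k then ‖Y i k‖ ^ 2 else 0 := fun i k => by
    split_ifs <;> positivity
  calc ‖Y i k‖ ^ 2 = if α i ≠ α k then ‖Y i k‖ ^ 2 else 0 := by simp [h]
    _ ≤ ∑ k, if α i ≠ α k then ‖Y i k‖ ^ 2 else 0 :=
      Finset.single_le_sum (f := fun k => if α i ≠ α k then ‖Y i k‖ ^ 2 else 0)
        (fun k _ => h0 i k) (Finset.mem_univ k)
    _ ≤ _ := Finset.single_le_sum (f := fun i => ∑ k, if α i ≠ α k then ‖Y i k‖ ^ 2 else 0)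
        (fun i _ => Finset.sum_nonneg fun k _ => h0 i k) (Finset.mem_univ i)

theorem norm_apply_le_sqrt_offBlockSq {α : Fin n → ℂ} (Y : CMat n) {i k : Fin n}
    (h : α i ≠ α k) : ‖Y i k‖ ≤ √(offBlockSq α Y) :=
  Real.le_sqrt_of_sq_le (sq_norm_apply_le_offBlockSq Y h)

/-- The right hand side of the equation for the projection in the variable `x`. -/
noncomputable def projectionField (α : Fin n → ℂ) (z : ℂ) (v ρ : CMat n) : CMat n :=
  ⁅ρ, v⁆ + ⁅ρ, (Matrix.diagonal α : CMat n)⁆ * (z • (1 : CMat n) + (conj z - z) • ρ)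

/-- The derivative of a weighted trace of the projection. -/
theorem sum_mul_projectionField_diag (α : Fin n → ℂ) (z : ℂ) (v ρ : CMat n) (e : Fin n → ℂ) :
    ∑ i, e i * projectionField α z v ρ i i =
      (∑ i, ∑ m, (e i - e m) * (ρ i m * v m i)) +
        (conj z - z) * ∑ i, ∑ m, e i * (α m - α i) * (ρ i m * ρ m i) := by
  have h1 : ∀ i, projectionField α z v ρ i i = ∑ m, (ρ i m * v m i - v i m * ρ m i) +
      (conj z - z) * ∑ m, (α m - α i) * (ρ i m * ρ m i) := by
    intro i
    rw [projectionField, Matrix.add_apply, lie_apply, mul_add, mul_smul_comm, mul_smul_comm,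
      mul_one, Matrix.add_apply, Matrix.smul_apply, Matrix.smul_apply, lie_diagonal_apply,
      sub_self, mul_zero, smul_zero, zero_add, smul_eq_mul, Matrix.mul_apply]
    simp only [lie_diagonal_apply]
    congr 2
    exact Finset.sum_congr rfl fun m _ => by ring
  have h2 : ∑ i, ∑ m, e i * (v i m * ρ m i) = ∑ i, ∑ m, e m * (ρ i m * v m i) := by
    rw [Finset.sum_comm]
    exact Finset.sum_congr rfl fun m _ => Finset.sum_congr rfl fun i _ => by ring
  calc ∑ i, e i * projectionField α z v ρ i i
      = ∑ i, ∑ m, e i * (ρ i m * v m i) - ∑ i, ∑ m, e i * (v i m * ρ m i) +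
        (conj z - z) * ∑ i, ∑ m, e i * (α m - α i) * (ρ i m * ρ m i) := by
        simp only [h1, mul_add, Finset.sum_add_distrib, Finset.mul_sum, mul_sub,
          Finset.sum_sub_distrib]
        congr 1
        exact Finset.sum_congr rfl fun i _ => Finset.sum_congr rfl fun m _ => by ring
    _ = _ := by
        rw [h2]
        simp only [← Finset.sum_sub_distrib, ← sub_mul]

theorem apply_mul_apply_swap {ρ : CMat n} (hs : ρ.conjTranspose = ρ) (i m : Fin n) :
    ρ i m * ρ m i = ((‖ρ i m‖ ^ 2 : ℝ) : ℂ) := by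
  have h : ρ m i = conj (ρ i m) := by
    conv_lhs => rw [← hs]
    rfl
  rw [h, Complex.mul_conj, Complex.normSq_eq_norm_sq]

/-- Bounds the terms linear in `v`. The smallness `s` is asked only where the weight is nonzero, and
for weights depending only on the block these are off-block positions. -/
theorem norm_sum_sum_mul_le {e : Fin n → Fin n → ℂ} {c s : ℝ} (hc : 0 ≤ c) (hs0 : 0 ≤ s)
    {ρ v : CMat n} (he : ∀ i m, ‖e i m‖ ≤ c)
    (h : ∀ i m, e i m ≠ 0 → ‖ρ i m‖ ≤ s) :
    ‖∑ i, ∑ m, e i m * (ρ i m * v m i)‖ ≤ c * s * entrySum v := by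
  rw [entrySum, Finset.sum_comm (f := fun i k => ‖v i k‖), Finset.mul_sum]
  refine norm_sum_le_of_le _ fun i _ => ?_
  rw [Finset.mul_sum]
  refine norm_sum_le_of_le _ fun m _ => ?_
  rw [norm_mul, norm_mul, ← mul_assoc]
  refine mul_le_mul_of_nonneg_right ?_ (norm_nonneg _)
  by_cases h0 : e i m = 0
  · simp only [h0, norm_zero, zero_mul]
    positivity
  · exact mul_le_mul (he i m) (h i m h0) (norm_nonneg _) hc

theorem norm_sum_sum_mul_sq_le {α : Fin n → ℂ} {e : Fin n → Fin n → ℂ} {c : ℝ} {ρ : CMat n}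
    (hs : ρ.conjTranspose = ρ) (he : ∀ i m, ‖e i m‖ ≤ c) (h : ∀ i m, α i = α m → e i m = 0) :
    ‖∑ i, ∑ m, e i m * (ρ i m * ρ m i)‖ ≤ c * offBlockSq α ρ := by
  rw [offBlockSq, Finset.mul_sum]
  refine norm_sum_le_of_le _ fun i _ => ?_
  rw [Finset.mul_sum]
  refine norm_sum_le_of_le _ fun m _ => ?_
  rw [apply_mul_apply_swap hs, norm_mul, Complex.norm_real, Real.norm_of_nonneg (by positivity)]
  by_cases h0 : α i = α m
  · simp [h0, h i m h0]
  · simp only [ne_eq, h0, not_false_eq_true, if_true]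
    exact mul_le_mul_of_nonneg_right (he i m) (by positivity)

/-- The weighted trace with weights `im α` is strictly monotone up to the perturbation `v`. -/
theorem re_sum_im_mul_projectionField {α : Fin n → ℂ} (hα : ∀ i, (α i).re = 0) (z : ℂ)
    {ρ : CMat n} (v : CMat n) (hs : ρ.conjTranspose = ρ) :
    ∑ i, (α i).im * (projectionField α z v ρ i i).re =
      (∑ i, ∑ m, (((α i).im : ℂ) - (α m).im) * (ρ i m * v m i)).re -
        z.im * ∑ i, ∑ m, ((α i).im - (α m).im) ^ 2 * ‖ρ i m‖ ^ 2 := by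
  have h := congrArg Complex.re (sum_mul_projectionField_diag α z v ρ fun i => ((α i).im : ℂ))
  rw [Complex.re_sum, Complex.add_re] at h
  simp only [Complex.re_ofReal_mul] at h
  rw [h, sub_eq_add_neg (Complex.re _)]
  congr 1
  have hα' : ∀ i, α i = (α i).im * Complex.I := fun i => by
    apply Complex.ext <;> simp [hα i]
  have h1 : ∑ i, ∑ m, ((α i).im : ℂ) * (α m - α i) * (ρ i m * ρ m i) =
      Complex.I * ((∑ i, ∑ m, (α i).im * ((α m).im - (α i).im) * ‖ρ i m‖ ^ 2 : ℝ) : ℂ) := by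
    rw [Complex.ofReal_sum, Finset.mul_sum]
    refine Finset.sum_congr rfl fun i _ => ?_
    rw [Complex.ofReal_sum, Finset.mul_sum]
    refine Finset.sum_congr rfl fun m _ => ?_
    rw [apply_mul_apply_swap hs]
    conv_lhs => rw [hα' m, hα' i]
    push_cast
    simp only [Complex.mul_im, Complex.ofReal_re, Complex.I_im, Complex.ofReal_im, Complex.I_re,
      mul_one, mul_zero, add_zero]
    ring
  have h2 : conj z - z = ((-2 * z.im : ℝ) : ℂ) * Complex.I := by
    apply Complex.ext <;> simp
    ring
  -- Since `‖ρ i m‖ = ‖ρ m i‖`, exchanging the two indices turns the sum into one with square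
  -- weights, which has a definite sign.
  have h3 : ∑ i, ∑ m, ((α i).im - (α m).im) ^ 2 * ‖ρ i m‖ ^ 2 =
      -2 * ∑ i, ∑ m, (α i).im * ((α m).im - (α i).im) * ‖ρ i m‖ ^ 2 := by
    have hsym : ∀ i m, ‖ρ i m‖ = ‖ρ m i‖ := fun i m => by
      conv_lhs => rw [← hs]
      rw [Matrix.conjTranspose_apply, norm_star]
    have h4 : ∑ i, ∑ m, (α i).im * ((α m).im - (α i).im) * ‖ρ i m‖ ^ 2 =
        ∑ i, ∑ m, (α m).im * ((α i).im - (α m).im) * ‖ρ i m‖ ^ 2 := by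
      rw [Finset.sum_comm]
      exact Finset.sum_congr rfl fun i _ => Finset.sum_congr rfl fun m _ => by rw [hsym i m]
    have h5 : ∑ i, ∑ m, ((α i).im - (α m).im) ^ 2 * ‖ρ i m‖ ^ 2 =
        -(∑ i, ∑ m, (α i).im * ((α m).im - (α i).im) * ‖ρ i m‖ ^ 2) -
          ∑ i, ∑ m, (α m).im * ((α i).im - (α m).im) * ‖ρ i m‖ ^ 2 := by
      simp only [← Finset.sum_neg_distrib, ← Finset.sum_sub_distrib]
      exact Finset.sum_congr rfl fun i _ => Finset.sum_congr rfl fun m _ => by ring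
    rw [h5, ← h4]
    ring
  rw [h1, h2, h3]
  set R := ∑ i, ∑ m, (α i).im * ((α m).im - (α i).im) * ‖ρ i m‖ ^ 2
  have h6 : ((-2 * z.im : ℝ) : ℂ) * Complex.I * (Complex.I * (R : ℂ)) =
      ((2 * z.im * R : ℝ) : ℂ) := by
    push_cast
    linear_combination (-2 * (z.im : ℂ) * R) * Complex.I_mul_I
  rw [h6, Complex.ofReal_re]
  ring

/-- The unperturbed field contains the factor `[ρ, a]`, which involves only off-block entries of
`ρ`. It is therefore of the order of the square root of `offBlockSq`. -/
theorem norm_projectionField_apply_le {α : Fin n → ℂ} {M : ℝ} (hM : ∀ i k, ‖α i - α k‖ ≤ M)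
    (z : ℂ) {ρ : CMat n} (v : CMat n) (hρ : ∀ i k, ‖ρ i k‖ ≤ 1) (i k : Fin n) :
    ‖projectionField α z v ρ i k‖ ≤
      2 * entrySum v + n * (M * (‖z‖ + ‖conj z - z‖)) * √(offBlockSq α ρ) := by
  have hM0 : 0 ≤ M := (norm_nonneg _).trans (hM i i)
  rw [projectionField, Matrix.add_apply]
  refine (norm_add_le _ _).trans (add_le_add ?_ ?_)
  · rw [Ring.lie_def, Matrix.sub_apply, two_mul]
    refine (norm_sub_le _ _).trans (add_le_add ?_ ?_)
    · rw [Matrix.mul_apply]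
      calc ‖∑ m, ρ i m * v m k‖ ≤ ∑ m, ‖v m k‖ := norm_sum_le_of_le _ fun m _ => by
            rw [norm_mul]
            exact mul_le_of_le_one_left (norm_nonneg _) (hρ i m)
        _ ≤ entrySum v := Finset.sum_le_sum fun m _ =>
            Finset.single_le_sum (f := fun k => ‖v m k‖) (fun _ _ => norm_nonneg _)
              (Finset.mem_univ k)
    · rw [Matrix.mul_apply]
      calc ‖∑ m, v i m * ρ m k‖ ≤ ∑ m, ‖v i m‖ := norm_sum_le_of_le _ fun m _ => by
            rw [norm_mul]
            exact mul_le_of_le_one_right (norm_nonneg _) (hρ m k)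
        _ ≤ entrySum v := Finset.single_le_sum (f := fun i => ∑ k, ‖v i k‖)
            (fun _ _ => by positivity) (Finset.mem_univ i)
  · rw [Matrix.mul_apply]
    have h : ∀ m ∈ Finset.univ, ‖⁅ρ, (Matrix.diagonal α : CMat n)⁆ i m *
        (z • (1 : CMat n) + (conj z - z) • ρ) m k‖ ≤
        M * (‖z‖ + ‖conj z - z‖) * √(offBlockSq α ρ) := by
      intro m _
      rw [lie_diagonal_apply, norm_mul, norm_mul]
      have h1 : ‖(z • (1 : CMat n) + (conj z - z) • ρ) m k‖ ≤ ‖z‖ + ‖conj z - z‖ := by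
        rw [Matrix.add_apply, Matrix.smul_apply, Matrix.smul_apply, smul_eq_mul, smul_eq_mul]
        refine (norm_add_le _ _).trans (add_le_add ?_ ?_)
        · rw [norm_mul]
          refine mul_le_of_le_one_right (norm_nonneg _) ?_
          rw [Matrix.one_apply]
          split_ifs <;> simp
        · rw [norm_mul]
          exact mul_le_of_le_one_right (norm_nonneg _) (hρ m k)
      have h2 : ‖ρ i m‖ * ‖α m - α i‖ ≤ √(offBlockSq α ρ) * M := by
        by_cases h : α i = α m
        · rw [h, sub_self, norm_zero, mul_zero]
          positivity
        · exact mul_le_mul (norm_apply_le_sqrt_offBlockSq ρ h) (hM m i) (norm_nonneg _)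
            (Real.sqrt_nonneg _)
      calc _ ≤ √(offBlockSq α ρ) * M * (‖z‖ + ‖conj z - z‖) :=
            mul_le_mul h2 h1 (norm_nonneg _) (by positivity)
        _ = _ := by ring
    refine (norm_sum_le_of_le _ h).trans (le_of_eq ?_)
    rw [Finset.sum_const, Finset.card_univ, Fintype.card_fin, nsmul_eq_mul]
    ring

theorem hasDerivAt_offBlockSq (α : Fin n → ℂ) {ρ : ℝ → CMat n} {R : CMat n} {x : ℝ}
    (h : HasMatDerivAt ρ R x) : HasDerivAt (fun y => offBlockSq α (ρ y))
      (∑ i, ∑ k, if α i ≠ α k then 2 * inner ℝ (ρ x i k) (R i k) else 0) x := by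
  refine HasDerivAt.fun_sum fun i _ => HasDerivAt.fun_sum fun k _ => ?_
  split_ifs with hik
  · exact (h i k).norm_sq
  · exact hasDerivAt_const _ _

/-- Each term carries an off-block entry of `ρ`. Together with a bound `c` of order `√N + |v|`, this
extra `√N` yields the estimate `|N'| ≤ C(N + w)`. -/
theorem abs_offBlockSq_deriv_le (α : Fin n → ℂ) {ρ R : CMat n} {c : ℝ}
    (hR : ∀ i k, ‖R i k‖ ≤ c) :
    |∑ i, ∑ k, if α i ≠ α k then 2 * inner ℝ (ρ i k) (R i k) else 0| ≤
      n * (n * (2 * √(offBlockSq α ρ) * c)) := by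
  have h : ∀ i k, |if α i ≠ α k then 2 * inner ℝ (ρ i k) (R i k) else 0| ≤
      2 * √(offBlockSq α ρ) * c := by
    intro i k
    have hc : 0 ≤ c := (norm_nonneg _).trans (hR i k)
    split_ifs with hik
    · rw [abs_mul, abs_two, mul_assoc]
      refine mul_le_mul_of_nonneg_left ?_ zero_le_two
      exact (abs_real_inner_le_norm _ _).trans
        (mul_le_mul (norm_apply_le_sqrt_offBlockSq ρ hik) (hR i k) (norm_nonneg _)
          (Real.sqrt_nonneg _))
    · rw [abs_zero]
      positivity
  refine (Finset.abs_sum_le_sum_abs _ _).trans ?_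
  refine (Finset.sum_le_sum fun i _ => (Finset.abs_sum_le_sum_abs _ _).trans
    (Finset.sum_le_sum fun k _ => h i k)).trans (le_of_eq ?_)
  simp

theorem exists_gap {ι : Type*} [Finite ι] (p : ι → Prop) {g : ι → ℝ} (hg : ∀ i, p i → 0 < g i) :
    ∃ γ, 0 < γ ∧ ∀ i, p i → γ ≤ g i := by
  have h : ∀ᶠ γ in nhdsWithin (0 : ℝ) (Set.Ioi 0), ∀ i, p i → γ ≤ g i := by
    refine Filter.eventually_all.mpr fun i => ?_
    by_cases hp : p i
    · filter_upwards [Ioo_mem_nhdsGT (hg i hp)] with γ hγ _ using hγ.2.le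
    · exact Filter.Eventually.of_forall fun γ h => absurd h hp
  obtain ⟨γ, hγ, hγ0⟩ := (h.and self_mem_nhdsWithin).exists
  exact ⟨γ, hγ0, hγ⟩

/-- The off-block entries of a Hermitian projection which moves according to
`ρ' = [ρ, v] + [ρ, a](z + (z̄ - z)ρ)` decay rapidly at `+∞` if `v` does. -/
theorem offBlock_rapid_decay {α : Fin n → ℂ} (hα : ∀ i, (α i).re = 0) {z : ℂ} (hz : z.im ≠ 0)
    {v ρ : ℝ → CMat n} (hs : ∀ x, (ρ x).conjTranspose = ρ x) (hi : ∀ x, ρ x * ρ x = ρ x)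
    (hd : ∀ x, HasMatDerivAt ρ (projectionField α z (v x) (ρ x)) x)
    (hv : ∀ k : ℕ, ∃ c, ∀ x, 0 ≤ x → (1 + x) ^ k * entrySum (v x) ≤ c) (k : ℕ) :
    ∃ c, ∀ x, 0 ≤ x → (1 + x) ^ k * offBlockSq α (ρ x) ≤ c := by
  have hρ1 : ∀ x i k, ‖ρ x i k‖ ≤ 1 := fun x => norm_apply_le_one_of_projection (hs x) (hi x)
  have himne : ∀ i m, α i ≠ α m → (α i).im ≠ (α m).im := fun i m h h' =>
    h (Complex.ext (by rw [hα, hα]) h')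
  obtain ⟨γ, hγ, hγ'⟩ := exists_gap (ι := Fin n × Fin n) (fun p => α p.1 ≠ α p.2)
    (g := fun p => ((α p.1).im - (α p.2).im) ^ 2)
    (fun p hp => by have := sub_ne_zero.mpr (himne _ _ hp); positivity)
  obtain ⟨M, hM⟩ : ∃ M, ∀ i k, ‖α i - α k‖ ≤ M := by
    obtain ⟨M, hM⟩ := (Set.finite_range fun p : Fin n × Fin n => ‖α p.1 - α p.2‖).bddAbove
    exact ⟨M, fun i k => hM ⟨(i, k), rfl⟩⟩
  have hM' : ∀ i m, ‖((α i).im : ℂ) - (α m).im‖ ≤ |M| := fun i m => by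
    rw [← Complex.ofReal_sub, Complex.norm_real, ← Complex.sub_im]
    exact (Complex.abs_im_le_norm _).trans ((hM i m).trans (le_abs_self M))
  set cA := ‖z‖ + ‖conj z - z‖ with hcA
  -- The sign compensates that of `z.im`, and the size makes the unperturbed derivative of the
  -- weighted trace at least `2N`. One of the two `N` absorbs the cross term with `v`.
  set κ := -2 / (z.im * γ) with hκ
  -- The square comes from completing the square in the cross term; the `1` gives `entrySum² ≤ w`
  -- for the other estimates.
  set cw := (|κ| * |M|) ^ 2 + 1 with hcw
  have hcw1 : 1 ≤ cw := by
    rw [hcw]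
    nlinarith [sq_nonneg (|κ| * |M|)]
  set S : Finset ℂ := Finset.univ.image α with hS
  set C₁ := n * (|M| * cA) with hC₁
  have hC₁0 : 0 ≤ C₁ := by positivity
  have hcA0 : 0 ≤ cA := by positivity
  set C := 1 + ‖conj z - z‖ * |M| + n * (n * (4 + 2 * C₁)) + n with hC
  have hCp : ∀ x, 0 ≤ √(offBlockSq α (ρ x)) ∧ √(offBlockSq α (ρ x)) ^ 2 = offBlockSq α (ρ x) ∧
      0 ≤ entrySum (v x) ∧ entrySum (v x) ^ 2 ≤ cw * entrySum (v x) ^ 2 := fun x =>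
    ⟨Real.sqrt_nonneg _, Real.sq_sqrt (offBlockSq_nonneg _ _), entrySum_nonneg _,
      le_mul_of_one_le_left (by positivity) hcw1⟩
  -- The sum runs over the distinct eigenvalues of `a`: the trace of a whole block is near an
  -- integer, whereas a single diagonal entry need not be.
  refine rapid_decay_of_near_int (ι := S) (C := C) (K := 2)
    (t := fun μ x => ∑ i, if α i = μ then (ρ x i i).re else 0)
    (t' := fun μ x => ∑ i, if α i = μ then (projectionField α z (v x) (ρ x) i i).re else 0)
    (coef := fun μ => κ * (μ : ℂ).im)
    (N := fun x => offBlockSq α (ρ x)) (w := fun x => cw * entrySum (v x) ^ 2)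
    (by positivity) (fun x _ => offBlockSq_nonneg _ _) ?_
    (fun x _ => hasDerivAt_offBlockSq α (hd x)) ?_ ?_ ?_ ?_ ?_ ?_ k
  · intro μ x _
    refine HasDerivAt.fun_sum fun i _ => ?_
    split_ifs
    · exact Complex.reCLM.hasFDerivAt.comp_hasDerivAt x (hd x i i)
    · exact hasDerivAt_const _ _
  · intro μ x _
    obtain ⟨hs0, hs2, hh0, hh2⟩ := hCp x
    have h1 := sum_mul_projectionField_diag α z (v x) (ρ x)
      fun i => if α i = μ then (1 : ℂ) else 0
    have h2 : (∑ i, if α i = μ then (projectionField α z (v x) (ρ x) i i).re else 0) =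
        (∑ i, (if α i = μ then (1 : ℂ) else 0) * projectionField α z (v x) (ρ x) i i).re := by
      rw [Complex.re_sum]
      exact Finset.sum_congr rfl fun i _ => by split_ifs <;> simp
    rw [h2, h1]
    refine (Complex.abs_re_le_norm _).trans ((norm_add_le _ _).trans ?_)
    have h3 := norm_sum_sum_mul_le (c := 1) (s := √(offBlockSq α (ρ x))) zero_le_one hs0
      (ρ := ρ x) (v := v x)
      (e := fun i m => (if α i = μ then (1 : ℂ) else 0) - (if α m = μ then (1 : ℂ) else 0))
      (fun i m => by split_ifs <;> simp) (fun i m hne => norm_apply_le_sqrt_offBlockSq _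
        fun h => hne (by simp [h]))
    have h4 := norm_sum_sum_mul_sq_le (α := α) (c := |M|) (hs x)
      (e := fun i m => (if α i = μ then (1 : ℂ) else 0) * (α m - α i))
      (fun i m => by
        have := (hM m i).trans (le_abs_self M)
        split_ifs
        · simpa using this
        · simp)
      (fun i m h => by simp [h])
    rw [norm_mul]
    have h5 := mul_le_mul_of_nonneg_left h4 (norm_nonneg (conj z - z))
    have hN := offBlockSq_nonneg α (ρ x)
    have hw0 : 0 ≤ cw * entrySum (v x) ^ 2 := by positivity
    have h6 : 1 + ‖conj z - z‖ * |M| ≤ C := by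
      have : 0 ≤ n * (n * (4 + 2 * C₁)) + n := by positivity
      linarith
    have h7 := mul_le_mul_of_nonneg_right h6 (add_nonneg hN hw0)
    have h8 : 0 ≤ ‖conj z - z‖ * |M| * (cw * entrySum (v x) ^ 2) := by positivity
    nlinarith [sq_nonneg (√(offBlockSq α (ρ x)) - entrySum (v x))]
  · intro x _
    obtain ⟨hs0, hs2, hh0, hh2⟩ := hCp x
    have h1 := abs_offBlockSq_deriv_le α (ρ := ρ x)
      (norm_projectionField_apply_le (fun i k => (hM i k).trans (le_abs_self M)) z (v x) (hρ1 x))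
    refine h1.trans ?_
    have hN := offBlockSq_nonneg α (ρ x)
    have hw0 : 0 ≤ cw * entrySum (v x) ^ 2 := by positivity
    have h2 : 2 * √(offBlockSq α (ρ x)) * (2 * entrySum (v x) + C₁ * √(offBlockSq α (ρ x))) ≤
        (4 + 2 * C₁) * (offBlockSq α (ρ x) + cw * entrySum (v x) ^ 2) := by
      have h8 : 0 ≤ C₁ * (cw * entrySum (v x) ^ 2) := by positivity
      nlinarith [sq_nonneg (√(offBlockSq α (ρ x)) - entrySum (v x))]
    have h3 : n * (n * (4 + 2 * C₁)) ≤ C := by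
      have : 0 ≤ 1 + ‖conj z - z‖ * |M| + n := by positivity
      linarith
    calc _ ≤ n * (n * ((4 + 2 * C₁) * (offBlockSq α (ρ x) + cw * entrySum (v x) ^ 2))) := by
          gcongr
      _ = n * (n * (4 + 2 * C₁)) * (offBlockSq α (ρ x) + cw * entrySum (v x) ^ 2) := by ring
      _ ≤ _ := mul_le_mul_of_nonneg_right h3 (add_nonneg hN hw0)
  · intro x _
    obtain ⟨hs0, hs2, hh0, hh2⟩ := hCp x
    have h1 : ∑ μ : S, κ * (μ : ℂ).im *
        (∑ i, if α i = μ then (projectionField α z (v x) (ρ x) i i).re else 0) =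
        κ * ∑ i, (α i).im * (projectionField α z (v x) (ρ x) i i).re := by
      rw [Finset.sum_coe_sort S fun μ : ℂ => κ * μ.im *
        (∑ i, if α i = μ then (projectionField α z (v x) (ρ x) i i).re else 0)]
      simp only [Finset.mul_sum]
      rw [Finset.sum_comm]
      refine Finset.sum_congr rfl fun i _ => ?_
      simp only [mul_ite, mul_zero]
      rw [Finset.sum_ite_eq, if_pos (by simp [hS])]
      ring
    rw [h1, re_sum_im_mul_projectionField hα z (v x) (hs x)]
    have h2 := norm_sum_sum_mul_le (c := |M|) (s := √(offBlockSq α (ρ x))) (abs_nonneg M) hs0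
      (ρ := ρ x) (v := v x) (e := fun i m => ((α i).im : ℂ) - (α m).im) hM'
      (fun i m hne => norm_apply_le_sqrt_offBlockSq _ fun h => hne (by simp [h]))
    have h3 := (Complex.abs_re_le_norm _).trans h2
    set e := (∑ i, ∑ m, (((α i).im : ℂ) - (α m).im) * (ρ x i m * v x m i)).re
    have h4 : γ * offBlockSq α (ρ x) ≤
        ∑ i, ∑ m, ((α i).im - (α m).im) ^ 2 * ‖ρ x i m‖ ^ 2 := by
      rw [offBlockSq, Finset.mul_sum]
      refine Finset.sum_le_sum fun i _ => ?_
      rw [Finset.mul_sum]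
      refine Finset.sum_le_sum fun m _ => ?_
      split_ifs with h
      · exact mul_le_mul_of_nonneg_right (hγ' (i, m) h) (by positivity)
      · rw [mul_zero]
        positivity
    set Nw := ∑ i, ∑ m, ((α i).im - (α m).im) ^ 2 * ‖ρ x i m‖ ^ 2
    have h5 : κ * (e - z.im * Nw) = κ * e + 2 / γ * Nw := by
      rw [hκ]
      field_simp
      ring
    have h6 : 2 * offBlockSq α (ρ x) ≤ 2 / γ * Nw := by
      rw [div_mul_eq_mul_div, le_div_iff₀ hγ]
      linarith
    have h7 : -(|κ| * (|M| * √(offBlockSq α (ρ x)) * entrySum (v x))) ≤ κ * e := by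
      have h8 : |κ * e| ≤ |κ| * (|M| * √(offBlockSq α (ρ x)) * entrySum (v x)) := by
        rw [abs_mul]
        exact mul_le_mul_of_nonneg_left h3 (abs_nonneg κ)
      exact (abs_le.mp h8).1
    rw [h5, hcw]
    nlinarith [sq_nonneg (√(offBlockSq α (ρ x)) - |κ| * |M| * entrySum (v x)),
      sq_nonneg (entrySum (v x)), sq_nonneg (|κ| * |M| * entrySum (v x))]
  · intro μ x _
    have h1 : |∑ i, if α i = μ then (ρ x i i).re else 0| ≤ ∑ _i : Fin n, (1 : ℝ) :=
      (Finset.abs_sum_le_sum_abs _ _).trans (Finset.sum_le_sum fun i _ => by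
        split_ifs
        · exact (Complex.abs_re_le_norm _).trans (hρ1 x i i)
        · simp)
    refine h1.trans ?_
    simp only [Finset.sum_const, Finset.card_univ, Fintype.card_fin, nsmul_eq_mul, mul_one]
    have : 0 ≤ 1 + ‖conj z - z‖ * |M| + n * (n * (4 + 2 * C₁)) := by positivity
    linarith
  · intro μ x _
    obtain ⟨m, hm⟩ := exists_int_near_block_trace (hs x) (hi x) fun i => α i = μ
    refine ⟨m, hm.trans (mul_le_mul_of_nonneg_left ?_ zero_le_two)⟩
    refine Finset.sum_le_sum fun i _ => Finset.sum_le_sum fun m _ => ?_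
    by_cases h : α i = α m
    · simp [h]
    · simp only [ne_eq, h, not_false_eq_true, if_true]
      split_ifs
      · exact le_rfl
      · positivity
  · intro k
    obtain ⟨c, hc⟩ := hv k
    refine ⟨cw * c ^ 2, fun x hx => ?_⟩
    have h1 := hc x hx
    have h2 : (1 : ℝ) ≤ (1 + x) ^ k := one_le_pow₀ (by linarith)
    have h3 : 0 ≤ (1 + x) ^ k * entrySum (v x) := mul_nonneg (by linarith) (entrySum_nonneg _)
    have h4 : ((1 + x) ^ k * entrySum (v x)) ^ 2 ≤ c ^ 2 := pow_le_pow_left₀ h3 h1 2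
    have h5 : (1 + x) ^ k * entrySum (v x) ^ 2 ≤ ((1 + x) ^ k * entrySum (v x)) ^ 2 := by
      rw [mul_pow]
      refine mul_le_mul_of_nonneg_right ?_ (by positivity)
      nlinarith
    nlinarith

end HalfLineDecay

/-! ### From rapid decay to the Schwartz class. -/

section SchwartzBootstrap

/-- Rapid decay at `±∞`. -/
def RapidDecay (f : ℝ → ℂ) : Prop := ∀ k : ℕ, ∃ c, ∀ x, |x| ^ k * ‖f x‖ ≤ c

/-- Boundedness. -/
def BoundedFun (f : ℝ → ℂ) : Prop := ∃ c, ∀ x, ‖f x‖ ≤ c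

/-- The derivatives of `f` up to order `m` exist and have property `P`. -/
def DerivsUpTo (P : (ℝ → ℂ) → Prop) : ℕ → (ℝ → ℂ) → Prop
  | 0, f => P f
  | m + 1, f => P f ∧ ∃ g, (∀ x, HasDerivAt f (g x) x) ∧ DerivsUpTo P m g

theorem RapidDecay.boundedFun {f : ℝ → ℂ} (h : RapidDecay f) : BoundedFun f := by
  obtain ⟨c, hc⟩ := h 0
  exact ⟨c, fun x => by simpa using hc x⟩

theorem RapidDecay.zero : RapidDecay fun _ => 0 := fun k => ⟨0, fun x => by simp⟩

theorem RapidDecay.add {f g : ℝ → ℂ} (hf : RapidDecay f) (hg : RapidDecay g) :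
    RapidDecay fun x => f x + g x := by
  intro k
  obtain ⟨c, hc⟩ := hf k
  obtain ⟨d, hd⟩ := hg k
  refine ⟨c + d, fun x => ?_⟩
  calc |x| ^ k * ‖f x + g x‖ ≤ |x| ^ k * (‖f x‖ + ‖g x‖) := by gcongr; exact norm_add_le _ _
    _ ≤ _ := by rw [mul_add]; exact add_le_add (hc x) (hd x)

theorem RapidDecay.mul {f g : ℝ → ℂ} (hf : RapidDecay f) (hg : BoundedFun g) :
    RapidDecay fun x => f x * g x := by
  intro k
  obtain ⟨c, hc⟩ := hf k
  obtain ⟨d, hd⟩ := hg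
  refine ⟨c * d, fun x => ?_⟩
  rw [norm_mul, ← mul_assoc]
  exact mul_le_mul (hc x) (hd x) (norm_nonneg _) ((by positivity : 0 ≤ |x| ^ k * ‖f x‖).trans (hc x))

theorem BoundedFun.add {f g : ℝ → ℂ} (hf : BoundedFun f) (hg : BoundedFun g) :
    BoundedFun fun x => f x + g x := by
  obtain ⟨c, hc⟩ := hf
  obtain ⟨d, hd⟩ := hg
  exact ⟨c + d, fun x => (norm_add_le _ _).trans (add_le_add (hc x) (hd x))⟩

theorem BoundedFun.mul {f g : ℝ → ℂ} (hf : BoundedFun f) (hg : BoundedFun g) :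
    BoundedFun fun x => f x * g x := by
  obtain ⟨c, hc⟩ := hf
  obtain ⟨d, hd⟩ := hg
  refine ⟨c * d, fun x => ?_⟩
  rw [norm_mul]
  exact mul_le_mul (hc x) (hd x) (norm_nonneg _) ((norm_nonneg _).trans (hc x))

namespace DerivsUpTo

variable {P R : (ℝ → ℂ) → Prop} {f g : ℝ → ℂ} {m : ℕ}

theorem self (h : DerivsUpTo P m f) : P f := by
  cases m with
  | zero => exact h
  | succ m => exact h.1

theorem pred (h : DerivsUpTo P (m + 1) f) : DerivsUpTo P m f := by
  induction m generalizing f with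
  | zero => exact h.1
  | succ m ih =>
    obtain ⟨h0, g, hg, hg'⟩ := h
    exact ⟨h0, g, hg, ih hg'⟩

theorem mono (hPR : ∀ f, P f → R f) (h : DerivsUpTo P m f) : DerivsUpTo R m f := by
  induction m generalizing f with
  | zero => exact hPR _ h
  | succ m ih =>
    obtain ⟨h0, g, hg, hg'⟩ := h
    exact ⟨hPR _ h0, g, hg, ih hg'⟩

theorem add (hP : ∀ f g, P f → P g → P fun x => f x + g x) (hf : DerivsUpTo P m f)
    (hg : DerivsUpTo P m g) : DerivsUpTo P m fun x => f x + g x := by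
  induction m generalizing f g with
  | zero => exact hP _ _ hf hg
  | succ m ih =>
    obtain ⟨hf0, f', hf', hfm⟩ := hf
    obtain ⟨hg0, g', hg', hgm⟩ := hg
    exact ⟨hP _ _ hf0 hg0, _, fun x => (hf' x).add (hg' x), ih hfm hgm⟩

/-- The Leibniz rule for a class `P` that is closed under sums and under products with `R`; both
pairs (rapid decay, bounded) and (bounded, bounded) are used. -/
theorem mul (hP : ∀ f g, P f → P g → P fun x => f x + g x)
    (hPR : ∀ f g, P f → R g → P fun x => f x * g x) (hf : DerivsUpTo P m f)
    (hg : DerivsUpTo R m g) : DerivsUpTo P m fun x => f x * g x := by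
  induction m generalizing f g with
  | zero => exact hPR _ _ hf hg
  | succ m ih =>
    obtain ⟨hf0, f', hf', hfm⟩ := id hf
    obtain ⟨hg0, g', hg', hgm⟩ := id hg
    exact ⟨hPR _ _ hf0 hg0, _, fun x => (hf' x).mul (hg' x),
      (ih hfm hg.pred).add hP (ih hf.pred hgm)⟩

theorem const (hP : ∀ c : ℂ, P fun _ => c) (c : ℂ) (m : ℕ) : DerivsUpTo P m fun _ => c := by
  induction m generalizing c with
  | zero => exact hP c
  | succ m ih => exact ⟨hP c, fun _ => 0, fun x => hasDerivAt_const x c, ih 0⟩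

theorem zero (hP : P fun _ => 0) (m : ℕ) : DerivsUpTo P m fun _ => 0 := by
  induction m with
  | zero => exact hP
  | succ m ih => exact ⟨hP, fun _ => 0, fun x => hasDerivAt_const x 0, ih⟩

theorem sum (hP0 : P fun _ => 0) (hP : ∀ f g, P f → P g → P fun x => f x + g x) {ι : Type*}
    {s : Finset ι} {F : ι → ℝ → ℂ} (h : ∀ i ∈ s, DerivsUpTo P m (F i)) :
    DerivsUpTo P m fun x => ∑ i ∈ s, F i x := by
  classical
  induction s using Finset.induction_on with
  | empty => simpa using zero hP0 m
  | insert i s hi ih =>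
    simp only [Finset.sum_insert hi]
    exact (h i (by simp)).add hP (ih fun j hj => h j (by simp [hj]))

theorem iteratedDeriv (h : DerivsUpTo P m f) : P (iteratedDeriv m f) := by
  induction m generalizing f with
  | zero =>
    rw [iteratedDeriv_zero]
    exact h
  | succ m ih =>
    obtain ⟨-, g, hg, hg'⟩ := h
    rw [iteratedDeriv_succ', show deriv f = g from funext fun x => (hg x).deriv]
    exact ih hg'

end DerivsUpTo

theorem boundedFun_const (c : ℂ) : BoundedFun fun _ => c := ⟨‖c‖, fun _ => le_rfl⟩

theorem IsSchwartz.derivsUpTo {f : ℝ → ℂ} (hf : IsSchwartz f) (m : ℕ) :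
    DerivsUpTo RapidDecay m f := by
  induction m generalizing f with
  | zero => exact hf.exists_pow_mul_norm_le
  | succ m ih => exact ⟨hf.exists_pow_mul_norm_le, _, hf.hasDerivAt, ih hf.deriv⟩

theorem isSchwartz_of_derivsUpTo {f : ℝ → ℂ} (hf : ContDiff ℝ ∞ f)
    (h : ∀ m, DerivsUpTo RapidDecay m f) : IsSchwartz f :=
  ⟨⟨f, hf, fun k m => by
    obtain ⟨c, hc⟩ := (h m).iteratedDeriv k
    refine ⟨c, fun x => ?_⟩
    rw [norm_iteratedFDeriv_eq_norm_iteratedDeriv]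
    exact hc x⟩, fun _ => rfl⟩

variable {n : ℕ}

theorem exists_pow_mul_entrySum_le {v : ℝ → CMat n} (hv : ∀ i l, RapidDecay fun x => v x i l)
    (k : ℕ) : ∃ c, ∀ x, (1 + |x|) ^ k * entrySum (v x) ≤ c := by
  choose c hc using fun i l => hv i l 0
  choose d hd using fun i l => hv i l k
  refine ⟨∑ i, ∑ l, 2 ^ (k - 1) * (c i l + d i l), fun x => ?_⟩
  rw [entrySum, Finset.mul_sum]
  refine Finset.sum_le_sum fun i _ => ?_
  rw [Finset.mul_sum]
  refine Finset.sum_le_sum fun l _ => ?_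
  have h1 := add_pow_le zero_le_one (abs_nonneg x) k
  rw [one_pow] at h1
  have h2 := hc i l x
  rw [pow_zero, one_mul] at h2
  calc (1 + |x|) ^ k * ‖v x i l‖ ≤ 2 ^ (k - 1) * (1 + |x| ^ k) * ‖v x i l‖ := by gcongr
    _ = 2 ^ (k - 1) * (‖v x i l‖ + |x| ^ k * ‖v x i l‖) := by ring
    _ ≤ _ := by gcongr; exact hd i l x

/-- Reflecting `x` negates the field, which amounts to changing the signs of `a` and `v`. Decay at
`-∞` thus reduces to decay at `+∞`. -/
theorem projectionField_neg (α : Fin n → ℂ) (z : ℂ) (v ρ : CMat n) :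
    projectionField (fun i => -α i) z (-v) ρ = -projectionField α z v ρ := by
  have h : (Matrix.diagonal fun i => -α i : CMat n) = -Matrix.diagonal α := by
    ext i k
    by_cases h : i = k <;> simp [h]
  rw [projectionField, projectionField, h]
  generalize z • (1 : CMat n) + (conj z - z) • ρ = A
  simp only [Ring.lie_def]
  noncomm_ring

section

variable {α : Fin n → ℂ} {z : ℂ} {v ρ : ℝ → CMat n}

/-- The half-line estimate is applied to `ρ(x)` and to `ρ(-x)`. It controls squares of entries,
hence the exponent `2k` for decay of order `k`. -/
theorem rapidDecay_offBlock (hα : ∀ i, (α i).re = 0) (hz : z.im ≠ 0)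
    (hs : ∀ x, (ρ x).conjTranspose = ρ x) (hi : ∀ x, ρ x * ρ x = ρ x)
    (hd : ∀ x, HasMatDerivAt ρ (projectionField α z (v x) (ρ x)) x)
    (hv : ∀ i l, RapidDecay fun x => v x i l) {i l : Fin n} (hil : α i ≠ α l) :
    RapidDecay fun x => ρ x i l := by
  intro k
  obtain ⟨c₁, hc₁⟩ := offBlock_rapid_decay hα hz hs hi hd (fun k => by
    obtain ⟨c, hc⟩ := exists_pow_mul_entrySum_le hv k
    exact ⟨c, fun x hx => by simpa [abs_of_nonneg hx] using hc x⟩) (2 * k)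
  obtain ⟨c₂, hc₂⟩ := offBlock_rapid_decay (α := fun i => -α i) (v := fun x => -v (-x))
    (ρ := fun x => ρ (-x)) (by simp [hα]) hz (fun x => hs (-x)) (fun x => hi (-x))
    (fun x => by
      rw [projectionField_neg]
      exact (hd (-x)).comp_neg)
    (fun k => by
      obtain ⟨c, hc⟩ := exists_pow_mul_entrySum_le hv k
      refine ⟨c, fun x hx => ?_⟩
      have := hc (-x)
      rw [abs_neg, abs_of_nonneg hx] at this
      simpa [entrySum] using this) (2 * k)
  have hN : ∀ Y : CMat n, offBlockSq (fun i => -α i) Y = offBlockSq α Y := fun Y => by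
    simp [offBlockSq]
  have key : ∀ x, ((1 + |x|) ^ k * ‖ρ x i l‖) ^ 2 ≤ max c₁ c₂ := by
    intro x
    have h1 : ((1 + |x|) ^ k * ‖ρ x i l‖) ^ 2 ≤ (1 + |x|) ^ (2 * k) * offBlockSq α (ρ x) := by
      rw [mul_pow, ← pow_mul, mul_comm k 2]
      gcongr
      exact sq_norm_apply_le_offBlockSq _ hil
    refine h1.trans ?_
    rcases le_total 0 x with h | h
    · rw [abs_of_nonneg h]
      exact (hc₁ x h).trans (le_max_left _ _)
    · rw [abs_of_nonpos h]
      have := hc₂ (-x) (by linarith)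
      rw [hN, neg_neg] at this
      exact this.trans (le_max_right _ _)
  refine ⟨√(max c₁ c₂), fun x => ?_⟩
  refine le_trans ?_ (Real.le_sqrt_of_sq_le (key x))
  gcongr
  linarith

/-- The off-block entries of the projection are Schwartz functions. -/
theorem isSchwartz_offBlock (hα : ∀ i, (α i).re = 0) (hz : z.im ≠ 0)
    (hs : ∀ x, (ρ x).conjTranspose = ρ x) (hi : ∀ x, ρ x * ρ x = ρ x)
    (hd : ∀ x, HasMatDerivAt ρ (projectionField α z (v x) (ρ x)) x)
    (hsm : ∀ i l, ContDiff ℝ ∞ fun x => ρ x i l)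
    (hv : ∀ i l, IsSchwartz fun x => v x i l) {i l : Fin n} (hil : α i ≠ α l) :
    IsSchwartz fun x => ρ x i l := by
  refine isSchwartz_of_derivsUpTo (hsm i l) fun m => ?_
  have hR : ∀ {m f g}, DerivsUpTo RapidDecay m f → DerivsUpTo RapidDecay m g →
      DerivsUpTo RapidDecay m fun x => f x + g x := fun hf hg =>
    hf.add (fun _ _ => RapidDecay.add) hg
  have hRB : ∀ {m f g}, DerivsUpTo RapidDecay m f → DerivsUpTo BoundedFun m g →
      DerivsUpTo RapidDecay m fun x => f x * g x := fun hf hg =>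
    hf.mul (fun _ _ => RapidDecay.add) (fun _ _ => RapidDecay.mul) hg
  have hBc : ∀ m (c : ℂ), DerivsUpTo BoundedFun m fun _ => c := fun m c =>
    DerivsUpTo.const boundedFun_const c m
  have hsum : ∀ {m} {F : Fin n → ℝ → ℂ}, (∀ i, DerivsUpTo RapidDecay m (F i)) →
      DerivsUpTo RapidDecay m fun x => ∑ i, F i x := fun h =>
    DerivsUpTo.sum RapidDecay.zero (fun _ _ => RapidDecay.add) fun i _ => h i
  -- The two claims need each other: every term of the field contains either an entry of `v` or an
  -- off-block entry of `ρ`, which decays, times entries that are merely bounded.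
  have key : ∀ m, (∀ i l, DerivsUpTo BoundedFun m fun x => ρ x i l) ∧
      ∀ i l, α i ≠ α l → DerivsUpTo RapidDecay m fun x => ρ x i l := by
    have h0 : ∀ i l, BoundedFun fun x => ρ x i l := fun i l =>
      ⟨1, fun x => norm_apply_le_one_of_projection (hs x) (hi x) i l⟩
    have h1 : ∀ i l, α i ≠ α l → RapidDecay fun x => ρ x i l := fun i l h =>
      rapidDecay_offBlock hα hz hs hi hd (fun i l => ((hv i l).derivsUpTo 0).self) h
    intro m
    induction m with
    | zero => exact ⟨h0, h1⟩
    | succ m ih =>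
      obtain ⟨ihB, ihR⟩ := ih
      have hF : ∀ i l, DerivsUpTo RapidDecay m
          fun x => projectionField α z (v x) (ρ x) i l := by
        intro i l
        simp only [projectionField, Matrix.add_apply, lie_apply]
        refine hR (hsum fun k => ?_) ?_
        · simp only [sub_eq_add_neg]
          refine hR ?_ ?_
          · simpa only [mul_comm] using hRB ((hv k l).derivsUpTo m) (ihB i k)
          · have := hRB (hRB ((hv i k).derivsUpTo m) (ihB k l)) (hBc m (-1))
            simpa only [mul_neg, mul_one] using this
        · simp only [Matrix.mul_apply, lie_diagonal_apply]
          refine hsum fun k => hRB ?_ ?_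
          · by_cases h : α i = α k
            · simp only [h, sub_self, mul_zero]
              exact DerivsUpTo.zero RapidDecay.zero m
            · exact hRB (ihR i k h) (hBc m _)
          · simp only [Matrix.add_apply, Matrix.smul_apply, smul_eq_mul]
            exact (hBc m _).add (fun _ _ => BoundedFun.add)
              ((hBc m _).mul (fun _ _ => BoundedFun.add) (fun _ _ => BoundedFun.mul) (ihB k l))
      exact ⟨fun i l => ⟨h0 i l, _, fun x => hd x i l,
          (hF i l).mono fun _ => RapidDecay.boundedFun⟩,
        fun i l h => ⟨h1 i l h, _, fun x => hd x i l, hF i l⟩⟩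
  exact (key m).2 i l hil

end

end SchwartzBootstrap

/-! ### The gauge transformation of the fluxes by `ξ - A`. -/

section Gauge

open Filter Topology

variable {n : ℕ}

/-- The coefficients `Q̃_k` of `(ξ - A) (∑ Q_k ξ^{-k}) (ξ - A)⁻¹`. -/
def gaugeFlux (A : CMat n) (Q : ℕ → CMat n) : ℕ → CMat n
  | 0 => Q 0
  | k + 1 => Q (k + 1) + gaugeFlux A Q k * A - A * Q k

/-- The matrix `A = z + (z̄ - z)ρ`, for which `g_{z,ρ}(ξ) = (ξ - A)/(ξ - z̄)`. -/
noncomputable def dressMatrix (z : ℂ) (ρ : CMat n) : CMat n :=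
  z • (1 : CMat n) + (conj z - z) • ρ

/-- Reconciles two forms of the same derivative of `A`: the gauge form `A Q_k - Q̃_k A`, and the sum
of brackets that arises from differentiating the projection. -/
theorem mul_gaugeFlux_sub (A : CMat n) (Q : ℕ → CMat n) (k : ℕ) :
    A * Q k - gaugeFlux A Q k * A =
      ∑ l ∈ Finset.range (k + 1), ⁅A, Q (k - l)⁆ * A ^ l := by
  induction k with
  | zero => simp [gaugeFlux, Ring.lie_def]
  | succ k ih =>
    rw [Finset.sum_range_succ', gaugeFlux]
    have h : ∑ l ∈ Finset.range (k + 1), ⁅A, Q (k + 1 - (l + 1))⁆ * A ^ (l + 1) =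
        (∑ l ∈ Finset.range (k + 1), ⁅A, Q (k - l)⁆ * A ^ l) * A := by
      rw [Finset.sum_mul]
      refine Finset.sum_congr rfl fun l _ => ?_
      rw [Nat.add_sub_add_right, pow_succ, mul_assoc]
    rw [h, ← ih]
    simp only [Nat.sub_zero, pow_zero, mul_one, Ring.lie_def]
    noncomm_ring

/-- The conditions on `v'` and on the derivative of `A` say that `ξ - A` intertwines `aξ + v` with
`aξ + v'`, so conjugation by it carries one recursion to the other. Read coefficient by coefficient
this is an induction, in which `[Q_0, a] = 0` is needed only at the start. -/
theorem HasMatDerivAt.gaugeFlux_x {a A v v' : CMat n} {A' : ℝ → CMat n}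
    {Q : ℕ → ℝ → CMat n} {x : ℝ} (hA0 : A' x = A)
    (hQ : ∀ k, HasMatDerivAt (Q k) (⁅Q (k + 1) x, a⁆ - ⁅v, Q k x⁆) x)
    (hQa : ⁅Q 0 x, a⁆ = 0)
    (hv' : v' = v + ⁅a, A⁆) (hA : HasMatDerivAt A' (A * v - v' * A) x) (k : ℕ) :
    HasMatDerivAt (fun y => gaugeFlux (A' y) (fun k => Q k y) k)
      (⁅gaugeFlux A (fun k => Q k x) (k + 1), a⁆ - ⁅v', gaugeFlux A (fun k => Q k x) k⁆) x := by
  induction k with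
  | zero =>
    refine (hQ 0).congr_deriv ?_
    simp only [gaugeFlux, hv', Ring.lie_def] at hQa ⊢
    rw [← sub_eq_zero]
    have h : ∀ b Q1 : CMat n, (Q1 * a - a * Q1 - (v * b - b * v)) -
        ((Q1 + b * A - A * b) * a - a * (Q1 + b * A - A * b) -
          ((v + (a * A - A * a)) * b - b * (v + (a * A - A * a)))) =
        A * (b * a - a * b) - (b * a - a * b) * A := by
      intro b Q1
      noncomm_ring
    rw [h, hQa]
    simp
  | succ k ih =>
    refine (((hQ (k + 1)).add (ih.mul hA)).sub (hA.mul (hQ k))).congr_deriv ?_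
    simp only [gaugeFlux, hv', Ring.lie_def, hA0]
    noncomm_ring

variable {α : Fin n → ℂ} {b : CMat n} {z : ℂ} {v ρ : ℝ → CMat n}

/-- The dressed potential is Schwartz. -/
theorem isSchwartz_dressed (hα : ∀ i, (α i).re = 0) (hz : z.im ≠ 0)
    (hs : ∀ x, (ρ x).conjTranspose = ρ x) (hi : ∀ x, ρ x * ρ x = ρ x)
    (hd : ∀ x, HasMatDerivAt ρ (projectionField α z (v x) (ρ x)) x)
    (hsm : ∀ i l, ContDiff ℝ ∞ fun x => ρ x i l)
    (hv : ∀ i l, IsSchwartz fun x => v x i l) (i l : Fin n) :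
    IsSchwartz fun x => (v x + (z - conj z) • ⁅ρ x, (Matrix.diagonal α : CMat n)⁆) i l := by
  simp only [Matrix.add_apply, Matrix.smul_apply, smul_eq_mul, lie_diagonal_apply]
  refine (hv i l).add ?_
  by_cases h : α i = α l
  · simpa [h] using IsSchwartz.zero
  · have := ((isSchwartz_offBlock hα hz hs hi hd hsm hv h).const_mul (α l - α i)).const_mul
      (z - conj z)
    simpa only [mul_comm (α l - α i)] using this

theorem tendsto_mul_apply_zero {X Y : ℝ → CMat n} {l : Filter ℝ} {c : ℝ}
    (hX : ∀ i k, Tendsto (fun x => X x i k) l (𝓝 0)) (hY : ∀ x i k, ‖Y x i k‖ ≤ c)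
    (i k : Fin n) : Tendsto (fun x => (X x * Y x) i k) l (𝓝 0) ∧
      Tendsto (fun x => (Y x * X x) i k) l (𝓝 0) := by
  have hb : ∀ i k, IsBoundedUnder (· ≤ ·) l (norm ∘ fun x => Y x i k) := fun i k =>
    isBoundedUnder_of ⟨c, fun x => hY x i k⟩
  simp only [Matrix.mul_apply]
  constructor
  · rw [← Finset.sum_const_zero (s := (Finset.univ : Finset (Fin n)))]
    exact tendsto_finsetSum _ fun m _ => (hX i m).zero_mul_isBoundedUnder_le (hb m k)
  · rw [← Finset.sum_const_zero (s := (Finset.univ : Finset (Fin n)))]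
    refine tendsto_finsetSum _ fun m _ => ?_
    simpa only [mul_comm] using (hX m k).zero_mul_isBoundedUnder_le (hb i m)

/-- The fluxes of the dressed potential are the gauge transforms of the fluxes. -/
theorem fluxQ_dressed (hα : ∀ i, (α i).re = 0) (hb : IsBlockScalar α b) (hz : z.im ≠ 0)
    (hs : ∀ x, (ρ x).conjTranspose = ρ x) (hi : ∀ x, ρ x * ρ x = ρ x)
    (hd : ∀ x, HasMatDerivAt ρ (projectionField α z (v x) (ρ x)) x)
    (hsm : ∀ i l, ContDiff ℝ ∞ fun x => ρ x i l)
    (hv : ∀ i l, IsSchwartz fun x => v x i l) (hoff : ∀ x, IsOffBlock α (v x)) :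
    IsFluxSequence α b (fun x => v x + (z - conj z) • ⁅ρ x, (Matrix.diagonal α : CMat n)⁆)
      (fun k x => gaugeFlux (dressMatrix z (ρ x)) (fun k => fluxQ α b v k x) k) := by
  have hQ := isFluxSequence_fluxQ hb hv hoff
  have hA : ∀ x i k, ‖dressMatrix z (ρ x) i k‖ ≤ ‖z‖ + ‖conj z - z‖ := by
    intro x i k
    have hρ := norm_apply_le_one_of_projection (hs x) (hi x) i k
    rw [dressMatrix, Matrix.add_apply, Matrix.smul_apply, Matrix.smul_apply, smul_eq_mul,
      smul_eq_mul]
    refine (norm_add_le _ _).trans (add_le_add ?_ ?_)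
    · rw [norm_mul]
      refine mul_le_of_le_one_right (norm_nonneg _) ?_
      rw [Matrix.one_apply]
      split_ifs <;> simp
    · rw [norm_mul]
      exact mul_le_of_le_one_right (norm_nonneg _) hρ
  refine ⟨fun x => rfl, fun k x => ?_, fun k => ?_⟩
  · refine HasMatDerivAt.gaugeFlux_x (v := v x) rfl (fun k => hQ.deriv k x)
      hb.lie_diagonal ?_ ?_ k
    · simp only [dressMatrix, Ring.lie_def, mul_add, add_mul, smul_mul_assoc, mul_smul_comm,
        one_mul, mul_one]
      module
    · refine ((HasMatDerivAt.const (z • (1 : CMat n)) x).add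
        ((hd x).smul (conj z - z))).congr_deriv ?_
      simp only [projectionField, dressMatrix, Ring.lie_def, mul_add, add_mul, sub_mul,
        smul_mul_assoc, mul_smul_comm, one_mul, mul_one, smul_add, smul_sub]
      module
  -- The first correction is a multiple of `[b, ρ]`. Since `b` is block scalar, it contains only
  -- off-block entries of `ρ`, which decay although `ρ` need not. Each later term is a product of a
  -- factor tending to `0` and the bounded `A`.
  · induction k with
    | zero =>
      intro i l
      have h : ∀ x, gaugeFlux (dressMatrix z (ρ x)) (fun k => fluxQ α b v k x) (0 + 1) i l =
          fluxQ α b v (0 + 1) x i l + (conj z - z) * ⁅b, ρ x⁆ i l := by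
        intro x
        rw [← smul_eq_mul, ← Matrix.smul_apply, ← Matrix.add_apply]
        refine congrFun (congrFun ?_ i) l
        change fluxQ α b v (0 + 1) x + b * dressMatrix z (ρ x) - dressMatrix z (ρ x) * b = _
        simp only [dressMatrix, Ring.lie_def, mul_add, add_mul, smul_mul_assoc,
          mul_smul_comm, one_mul, mul_one]
        module
      simp only [h]
      rw [show (0 : ℂ) = 0 + (conj z - z) * 0 by ring]
      refine (hQ.tendsto 0 i l).add (Tendsto.const_mul _ ?_)
      obtain ⟨β, rfl, hβ⟩ := hb
      simp only [diagonal_lie_apply]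
      by_cases h : α i = α l
      · simp [hβ i l h]
      · simpa using (isSchwartz_offBlock hα hz hs hi hd hsm hv h).tendsto_atBot.const_mul
          (β i - β l)
    | succ k ih =>
      intro i l
      have h := ((hQ.tendsto (k + 1) i l).add (tendsto_mul_apply_zero ih hA i l).1).sub
        (tendsto_mul_apply_zero (hQ.tendsto k) hA i l).2
      simp only [add_zero, sub_zero] at h
      exact h

end Gauge

/-! ### Linear systems polynomial in `ξ`: bounds, reality and entire dependence. -/

section LinearSystem

open Filter Topology

variable {n : ℕ}

/-- A bound for the solution of a linear equation. -/
theorem norm_apply_le_exp_of_linear {Y B : ℝ → CMat n} {C : ℝ}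
    (hd : ∀ s, HasMatDerivAt Y (Y s * B s) s) (h0 : Y 0 = 1)
    (hB : ∀ s ∈ Set.Icc (0 : ℝ) 1, ∀ i k, ‖B s i k‖ ≤ C) {s : ℝ} (hs : s ∈ Set.Icc (0 : ℝ) 1)
    (i k : Fin n) : ‖Y s i k‖ ≤ Real.exp (n * C) := by
  have hC : 0 ≤ C := (norm_nonneg _).trans (hB s hs i k)
  set f : ℝ → Fin n → Fin n → ℂ := fun s i k => Y s i k with hf
  have hfd : ∀ s, HasDerivAt f (fun i k => (Y s * B s) i k) s := fun s =>
    hasDerivAt_pi.mpr fun i => hasDerivAt_pi.mpr fun k => hd s i k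
  have hfn : ∀ s i k, ‖Y s i k‖ ≤ ‖f s‖ := fun s i k =>
    (norm_le_pi_norm (f s i) k).trans (norm_le_pi_norm (f s) i)
  have h := norm_le_gronwallBound_of_norm_deriv_right_le (f := f) (δ := 1) (K := n * C) (ε := 0)
    (a := 0) (b := 1) (fun s _ => (hfd s).continuousAt.continuousWithinAt)
    (fun s _ => (hfd s).hasDerivWithinAt) ?_ ?_ s hs
  · rw [gronwallBound_ε0, one_mul, sub_zero] at h
    refine (hfn s i k).trans (h.trans (Real.exp_le_exp.mpr ?_))
    exact mul_le_of_le_one_right (by positivity) hs.2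
  · refine (pi_norm_le_iff_of_nonneg zero_le_one).mpr fun i =>
      (pi_norm_le_iff_of_nonneg zero_le_one).mpr fun k => ?_
    simp only [hf, h0, Matrix.one_apply]
    split_ifs <;> simp
  · intro s hs
    have hs' : s ∈ Set.Icc (0 : ℝ) 1 := ⟨hs.1, hs.2.le⟩
    rw [add_zero]
    have h0 : 0 ≤ n * C * ‖f s‖ := by positivity
    refine (pi_norm_le_iff_of_nonneg h0).mpr fun i => (pi_norm_le_iff_of_nonneg h0).mpr fun k => ?_
    rw [Matrix.mul_apply]
    have h1 : ∀ m ∈ Finset.univ, ‖Y s i m * B s m k‖ ≤ ‖f s‖ * C := fun m _ => by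
      rw [norm_mul]
      exact mul_le_mul (hfn s i m) (hB s hs' m k) (norm_nonneg _) (norm_nonneg _)
    refine (norm_sum_le_of_le _ h1).trans (le_of_eq ?_)
    rw [Finset.sum_const, Finset.card_univ, Fintype.card_fin, nsmul_eq_mul]
    ring

/-- A smooth matrix function of `(x, t)` is bounded on compact sets. -/
theorem MatSmooth.exists_bound {f : ℝ → ℝ → CMat n} (hf : MatSmooth f) (M : ℝ) :
    ∃ C, ∀ x t, |x| ≤ M → |t| ≤ M → ∀ i k, ‖f x t i k‖ ≤ C := by
  have h : ∀ i k, ∃ C, ∀ x t, |x| ≤ M → |t| ≤ M → ‖f x t i k‖ ≤ C := by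
    intro i k
    obtain ⟨C, hC⟩ := ((isCompact_Icc (a := -M) (b := M)).prod
      (isCompact_Icc (a := -M) (b := M))).exists_bound_of_continuousOn (hf i k).continuous.continuousOn
    exact ⟨C, fun x t hx ht => hC (x, t) ⟨abs_le.mp hx, abs_le.mp ht⟩⟩
  choose C hC using h
  obtain ⟨D, hD⟩ := (Set.finite_range fun p : Fin n × Fin n => C p.1 p.2).bddAbove
  exact ⟨D, fun x t hx ht i k => (hC i k x t hx ht).trans (hD ⟨(i, k), rfl⟩)⟩

theorem MatSmooth.continuous_ray {f : ℝ → ℝ → CMat n} (hf : MatSmooth f) (x t : ℝ)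
    (i k : Fin n) : Continuous fun r : ℝ => f (r * x) (r * t) i k := by
  have h : Continuous fun r : ℝ => (r * x, r * t) := by fun_prop
  exact Continuous.comp (g := fun p : ℝ × ℝ => f p.1 p.2 i k) (hf.continuous i k) h

/-- `F` solves `F_x = F ∑ ξ^k X_k`, `F_t = F ∑ ξ^k T_k`, `F(0,0) = 1`. -/
structure IsSolutionAt (m : ℕ) (X T : ℕ → ℝ → ℝ → CMat n) (ξ : ℂ) (F : ℝ → ℝ → CMat n) :
    Prop where
  smooth : MatSmooth F
  deriv_x : ∀ x t, HasMatDerivAt (fun y => F y t)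
    (F x t * ∑ k ∈ Finset.range m, ξ ^ k • X k x t) x
  deriv_t : ∀ x t, HasMatDerivAt (fun s => F x s)
    (F x t * ∑ k ∈ Finset.range m, ξ ^ k • T k x t) t
  init : F 0 0 = 1

/-- Smooth skew-Hermitian coefficients. -/
structure IsPolyCoeff (X : ℕ → ℝ → ℝ → CMat n) : Prop where
  smooth : ∀ k, MatSmooth (X k)
  skew : ∀ k x t, (X k x t).conjTranspose = -X k x t

/-- `E(·, ξ)` solves the linear system with coefficients `∑ ξ^k X_k`, `∑ ξ^k T_k` for every
`ξ`. -/
structure IsPolySystem (m : ℕ) (X T : ℕ → ℝ → ℝ → CMat n) (E : ℝ → ℝ → ℂ → CMat n) : Prop where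
  coeff_X : IsPolyCoeff X
  coeff_T : IsPolyCoeff T
  sol : ∀ ξ, IsSolutionAt m X T ξ fun x t => E x t ξ

theorem conjTranspose_sum_pow_smul {m : ℕ} {X : ℕ → CMat n}
    (hX : ∀ k, (X k).conjTranspose = -X k) (ξ : ℂ) :
    (∑ k ∈ Finset.range m, (conj ξ) ^ k • X k).conjTranspose =
      -∑ k ∈ Finset.range m, ξ ^ k • X k := by
  rw [Matrix.conjTranspose_sum, ← Finset.sum_neg_distrib]
  refine Finset.sum_congr rfl fun k _ => ?_
  rw [Matrix.conjTranspose_smul, hX, smul_neg]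
  simp

/-- The reality condition for solutions of equations with skew-Hermitian coefficients. -/
theorem mul_conjTranspose_eq_one_of_skew {E : ℝ → ℝ → ℂ → CMat n} {X T : ℝ → ℝ → ℂ → CMat n}
    (hx : ∀ x t ξ, HasMatDerivAt (fun y => E y t ξ) (E x t ξ * X x t ξ) x)
    (ht : ∀ x t ξ, HasMatDerivAt (fun s => E x s ξ) (E x t ξ * T x t ξ) t)
    (hX : ∀ x t ξ, (X x t (conj ξ)).conjTranspose = -X x t ξ)
    (hT : ∀ x t ξ, (T x t (conj ξ)).conjTranspose = -T x t ξ) (h0 : ∀ ξ, E 0 0 ξ = 1)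
    (x t : ℝ) (ξ : ℂ) : E x t ξ * (E x t (conj ξ)).conjTranspose = 1 := by
  have hx : ∀ x t, HasMatDerivAt (fun y => E y t ξ * (E y t (conj ξ)).conjTranspose) 0 x :=
    fun x t => ((hx x t ξ).mul (hx x t (conj ξ)).conjTranspose).congr_deriv (by
      rw [Matrix.conjTranspose_mul, hX]
      noncomm_ring)
  have ht : ∀ x t, HasMatDerivAt (fun s => E x s ξ * (E x s (conj ξ)).conjTranspose) 0 t :=
    fun x t => ((ht x t ξ).mul (ht x t (conj ξ)).conjTranspose).congr_deriv (by
      rw [Matrix.conjTranspose_mul, hT]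
      noncomm_ring)
  have h1 := eq_of_hasMatDerivAt_zero (fun y => hx y t) x 0
  have h2 := eq_of_hasMatDerivAt_zero (fun s => ht 0 s) t 0
  rw [h1, h2, h0, h0]
  simp

section

variable {m : ℕ} {X T : ℕ → ℝ → ℝ → CMat n} {E : ℝ → ℝ → ℂ → CMat n}

/-- The equation along the ray through `(x, t)`. -/
theorem IsSolutionAt.hasMatDerivAt_ray {ξ : ℂ} {F : ℝ → ℝ → CMat n} (h : IsSolutionAt m X T ξ F)
    (x t : ℝ) (s : ℝ) :
    HasMatDerivAt (fun s => F (s * x) (s * t)) (F (s * x) (s * t) *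
      ∑ k ∈ Finset.range m, ξ ^ k • ((x : ℂ) • X k (s * x) (s * t) +
        (t : ℂ) • T k (s * x) (s * t))) s := by
  intro i k
  have h1 := h.smooth.hasFDerivAt (s * x) (s * t) i k
  rw [(h.deriv_x _ _).matDeriv_eq, (h.deriv_t _ _).matDeriv_eq] at h1
  have h2 := HasFDerivAt.comp_hasDerivAt s (f := fun s : ℝ => (s * x, s * t)) h1
    (((hasDerivAt_id s).mul_const x).prodMk ((hasDerivAt_id s).mul_const t))
  refine h2.congr_deriv ?_
  simp only [smul_add, Finset.sum_add_distrib, mul_add, Matrix.add_apply]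
  have h3 : ∀ (c : ℂ) (Z : ℕ → CMat n), (F (s * x) (s * t) *
      ∑ k ∈ Finset.range m, ξ ^ k • c • Z k) = c • (F (s * x) (s * t) *
      ∑ k ∈ Finset.range m, ξ ^ k • Z k) := by
    intro c Z
    rw [← mul_smul_comm, Finset.smul_sum]
    simp only [smul_comm c]
  rw [h3, h3]
  simp

/-- Grönwall's inequality along rays from the origin. The constant precedes `ξ` and `F`, so one
bound serves all solutions with parameter in a disc. -/
theorem exists_bound_solutionAt (hX : IsPolyCoeff X) (hT : IsPolyCoeff T) (m : ℕ) (M R : ℝ) :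
    ∃ C, ∀ ξ F, IsSolutionAt m X T ξ F → ‖ξ‖ ≤ R → ∀ x t, |x| ≤ M → |t| ≤ M →
      ∀ i k, ‖F x t i k‖ ≤ C := by
  choose cX hcX using fun k => (hX.smooth k).exists_bound M
  choose cT hcT using fun k => (hT.smooth k).exists_bound M
  refine ⟨Real.exp (n * ∑ k ∈ Finset.range m, R ^ k * (M * cX k + M * cT k)),
    fun ξ F h hξ x t hx ht i k => ?_⟩
  have h1 := norm_apply_le_exp_of_linear (h.hasMatDerivAt_ray x t) (by simp [h.init])
    (C := ∑ k ∈ Finset.range m, R ^ k * (M * cX k + M * cT k)) ?_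
    (Set.right_mem_Icc.mpr zero_le_one) i k
  · simpa using h1
  · intro s hs i l
    rw [Matrix.sum_apply]
    refine norm_sum_le_of_le _ fun k _ => ?_
    have hM : 0 ≤ M := (abs_nonneg x).trans hx
    have hsx : ∀ y, |y| ≤ M → |s * y| ≤ M := fun y hy => by
      rw [abs_mul, abs_of_nonneg hs.1]
      exact (mul_le_of_le_one_left (abs_nonneg y) hs.2).trans hy
    rw [Matrix.smul_apply, smul_eq_mul, norm_mul, norm_pow]
    refine mul_le_mul (pow_le_pow_left₀ (norm_nonneg _) hξ k) ?_ (norm_nonneg _)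
      (pow_nonneg ((norm_nonneg _).trans hξ) k)
    rw [Matrix.add_apply]
    refine (norm_add_le _ _).trans (add_le_add ?_ ?_)
    · rw [Matrix.smul_apply, smul_eq_mul, norm_mul, Complex.norm_real]
      exact mul_le_mul hx (hcX k _ _ (hsx x hx) (hsx t ht) i l) (norm_nonneg _) hM
    · rw [Matrix.smul_apply, smul_eq_mul, norm_mul, Complex.norm_real]
      exact mul_le_mul ht (hcT k _ _ (hsx x hx) (hsx t ht) i l) (norm_nonneg _) hM

namespace IsPolySystem

theorem smooth (h : IsPolySystem m X T E) (ξ : ℂ) : MatSmooth fun x t => E x t ξ :=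
  (h.sol ξ).smooth

theorem init (h : IsPolySystem m X T E) (ξ : ℂ) : E 0 0 ξ = 1 := (h.sol ξ).init

theorem smooth_X (h : IsPolySystem m X T E) (k : ℕ) : MatSmooth (X k) := h.coeff_X.smooth k

theorem smooth_T (h : IsPolySystem m X T E) (k : ℕ) : MatSmooth (T k) := h.coeff_T.smooth k

theorem mul_conjTranspose (h : IsPolySystem m X T E) (x t : ℝ) (ξ : ℂ) :
    E x t ξ * (E x t (conj ξ)).conjTranspose = 1 :=
  mul_conjTranspose_eq_one_of_skew (fun x t ξ => (h.sol ξ).deriv_x x t)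
    (fun x t ξ => (h.sol ξ).deriv_t x t)
    (fun x t ξ => conjTranspose_sum_pow_smul (fun k => h.coeff_X.skew k x t) ξ)
    (fun x t ξ => conjTranspose_sum_pow_smul (fun k => h.coeff_T.skew k x t) ξ) h.init x t ξ

theorem conjTranspose_mul (h : IsPolySystem m X T E) (x t : ℝ) (ξ : ℂ) :
    (E x t (conj ξ)).conjTranspose * E x t ξ = 1 :=
  mul_eq_one_comm.mp (h.mul_conjTranspose x t ξ)

theorem det_ne_zero (h : IsPolySystem m X T E) (x t : ℝ) (ξ : ℂ) : (E x t ξ).det ≠ 0 := by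
  intro h0
  have := congrArg Matrix.det (h.mul_conjTranspose x t ξ)
  rw [Matrix.det_mul, h0, zero_mul, Matrix.det_one] at this
  exact zero_ne_one this

theorem hasMatDerivAt_ray (h : IsPolySystem m X T E) (x t : ℝ) (ξ : ℂ) (s : ℝ) :
    HasMatDerivAt (fun s => E (s * x) (s * t) ξ) (E (s * x) (s * t) ξ *
      ∑ k ∈ Finset.range m, ξ ^ k • ((x : ℂ) • X k (s * x) (s * t) +
        (t : ℂ) • T k (s * x) (s * t))) s :=
  (h.sol ξ).hasMatDerivAt_ray x t s

theorem exists_bound (h : IsPolySystem m X T E) (M R : ℝ) :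
    ∃ C, ∀ x t ξ, |x| ≤ M → |t| ≤ M → ‖ξ‖ ≤ R → ∀ i k, ‖E x t ξ i k‖ ≤ C := by
  obtain ⟨C, hC⟩ := exists_bound_solutionAt h.coeff_X h.coeff_T m M R
  exact ⟨C, fun x t ξ hx ht hξ => hC ξ _ (h.sol ξ) hξ x t hx ht⟩

/-- The integrand of `rayIntegral`. -/
noncomputable def rayIntegrand (X T : ℕ → ℝ → ℝ → CMat n) (E : ℝ → ℝ → ℂ → CMat n) (x t : ℝ)
    (ξ₀ : ℂ) (k : ℕ) (ξ : ℂ) (y s : ℝ) : CMat n :=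
  E y s ξ * ((x : ℂ) • X k y s + (t : ℂ) • T k y s) * (E y s (conj ξ₀)).conjTranspose

/-- The integral which controls the dependence of the solution on `ξ` along a ray. -/
noncomputable def rayIntegral (X T : ℕ → ℝ → ℝ → CMat n) (E : ℝ → ℝ → ℂ → CMat n) (x t : ℝ)
    (ξ₀ : ℂ) (k : ℕ) (s : ℝ) (ξ : ℂ) : CMat n :=
  Matrix.of fun i l => ∫ r in (0 : ℝ)..s, rayIntegrand X T E x t ξ₀ k ξ (r * x) (r * t) i l

theorem smooth_rayIntegrand (h : IsPolySystem m X T E) (x t : ℝ) (ξ₀ : ℂ) (k : ℕ) (ξ : ℂ) :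
    MatSmooth fun y s => rayIntegrand X T E x t ξ₀ k ξ y s := by
  unfold rayIntegrand
  have h1 := ((h.smooth_X k).smul (x : ℂ)).add ((h.smooth_T k).smul (t : ℂ))
  have h2 := (h.smooth ξ).mul h1
  have h3 := h2.mul (h.smooth (conj ξ₀)).conjTranspose
  exact h3

theorem continuous_rayIntegrand (h : IsPolySystem m X T E) (x t : ℝ) (ξ₀ : ℂ) (k : ℕ) (ξ : ℂ)
    (i l : Fin n) :
    Continuous fun r : ℝ => rayIntegrand X T E x t ξ₀ k ξ (r * x) (r * t) i l :=
  (h.smooth_rayIntegrand x t ξ₀ k ξ).continuous_ray x t i l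

/-- Variation of constants along a ray. -/
theorem sub_eq_rayIntegral (h : IsPolySystem m X T E) (x t : ℝ) (ξ₀ ξ : ℂ) (s : ℝ) :
    E (s * x) (s * t) ξ - E (s * x) (s * t) ξ₀ =
      (∑ k ∈ Finset.range m, (ξ ^ k - ξ₀ ^ k) • rayIntegral X T E x t ξ₀ k s ξ) *
        E (s * x) (s * t) ξ₀ := by
  -- By reality the second factor is `E(ξ₀)⁻¹`, so only the difference of the coefficients at `ξ`
  -- and `ξ₀` survives.
  have hd : ∀ r, HasMatDerivAt
      (fun r => E (r * x) (r * t) ξ * (E (r * x) (r * t) (conj ξ₀)).conjTranspose)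
      (∑ k ∈ Finset.range m, (ξ ^ k - ξ₀ ^ k) •
        rayIntegrand X T E x t ξ₀ k ξ (r * x) (r * t)) r := by
    intro r
    refine ((h.hasMatDerivAt_ray x t ξ r).mul
      (h.hasMatDerivAt_ray x t (conj ξ₀) r).conjTranspose).congr_deriv ?_
    have hsk : ∀ k, ((x : ℂ) • X k (r * x) (r * t) + (t : ℂ) • T k (r * x) (r * t)).conjTranspose =
        -((x : ℂ) • X k (r * x) (r * t) + (t : ℂ) • T k (r * x) (r * t)) := by
      intro k
      simp [h.coeff_X.skew, h.coeff_T.skew]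
      abel
    rw [Matrix.conjTranspose_mul, conjTranspose_sum_pow_smul hsk]
    simp only [rayIntegrand]
    have key : ∀ (Y W : CMat n) (C : ℕ → CMat n), Y * (∑ k ∈ Finset.range m, ξ ^ k • C k) * W +
        Y * (-(∑ k ∈ Finset.range m, ξ₀ ^ k • C k) * W) =
        ∑ k ∈ Finset.range m, (ξ ^ k - ξ₀ ^ k) • (Y * C k * W) := by
      intro Y W C
      rw [neg_mul, mul_neg, ← sub_eq_add_neg, ← mul_assoc]
      simp only [sub_smul, Finset.sum_sub_distrib, Finset.mul_sum, Finset.sum_mul,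
        mul_smul_comm, smul_mul_assoc]
    exact key _ _ _
  have hZ : E (s * x) (s * t) ξ * (E (s * x) (s * t) (conj ξ₀)).conjTranspose - 1 =
      ∑ k ∈ Finset.range m, (ξ ^ k - ξ₀ ^ k) • rayIntegral X T E x t ξ₀ k s ξ := by
    ext i l
    have hcont : ∀ k, Continuous (fun r : ℝ => (ξ ^ k - ξ₀ ^ k) *
        rayIntegrand X T E x t ξ₀ k ξ (r * x) (r * t) i l) := fun k =>
      continuous_const.mul (h.continuous_rayIntegrand x t ξ₀ k ξ i l)
    have h1 := intervalIntegral.integral_eq_sub_of_hasDerivAt (a := 0) (b := s)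
      (fun r _ => hd r i l) (by
        simp only [Matrix.sum_apply, Matrix.smul_apply, smul_eq_mul]
        exact (continuous_finsetSum _ fun k _ => hcont k).intervalIntegrable _ _)
    simp only [zero_mul, h.init, Matrix.conjTranspose_one, mul_one] at h1
    rw [Matrix.sub_apply, ← h1, Matrix.sum_apply]
    simp only [Matrix.sum_apply, Matrix.smul_apply, smul_eq_mul, rayIntegral, Matrix.of_apply]
    rw [intervalIntegral.integral_finsetSum fun k _ => (hcont k).intervalIntegrable _ _]
    exact Finset.sum_congr rfl fun k _ => intervalIntegral.integral_const_mul _ _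
  rw [← hZ, sub_mul, one_mul, mul_assoc, h.conjTranspose_mul, mul_one]

theorem exists_rayIntegrand_bound (h : IsPolySystem m X T E) (x t : ℝ) (ξ₀ : ℂ) (k : ℕ) :
    ∃ C, ∀ ξ ∈ Metric.ball ξ₀ 1, ∀ r ∈ Set.Icc (0 : ℝ) 1, ∀ i l,
      ‖rayIntegrand X T E x t ξ₀ k ξ (r * x) (r * t) i l‖ ≤ C := by
  obtain ⟨C₁, h₁⟩ := h.exists_bound (max |x| |t|) (‖ξ₀‖ + 1)
  obtain ⟨C₂, h₂⟩ := ((((h.smooth_X k).smul (x : ℂ)).add ((h.smooth_T k).smul (t : ℂ))).mul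
    (h.smooth (conj ξ₀)).conjTranspose).exists_bound (max |x| |t|)
  refine ⟨n * (C₁ * C₂), fun ξ hξ r hr i l => ?_⟩
  have hrx : ∀ y, |y| ≤ max |x| |t| → |r * y| ≤ max |x| |t| := fun y hy => by
    rw [abs_mul, abs_of_nonneg hr.1]
    exact (mul_le_of_le_one_left (abs_nonneg y) hr.2).trans hy
  have hξ' : ‖ξ‖ ≤ ‖ξ₀‖ + 1 := by
    have := norm_add_le ξ₀ (ξ - ξ₀)
    rw [add_sub_cancel] at this
    rw [mem_ball_iff_norm] at hξ
    linarith
  rw [rayIntegrand, mul_assoc, Matrix.mul_apply]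
  have h3 : ∀ p ∈ Finset.univ, ‖E (r * x) (r * t) ξ i p *
      (((x : ℂ) • X k (r * x) (r * t) + (t : ℂ) • T k (r * x) (r * t)) *
        (E (r * x) (r * t) (conj ξ₀)).conjTranspose) p l‖ ≤ C₁ * C₂ := by
    intro p _
    have h4 := h₁ _ _ ξ (hrx x (le_max_left _ _)) (hrx t (le_max_right _ _)) hξ' i p
    rw [norm_mul]
    exact mul_le_mul h4 (h₂ _ _ (hrx x (le_max_left _ _)) (hrx t (le_max_right _ _)) p l)
      (norm_nonneg _) ((norm_nonneg _).trans h4)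
  refine (norm_sum_le_of_le _ h3).trans (le_of_eq ?_)
  simp

/-- In the variation of constants formula the factors `ξ^k - ξ₀^k` tend to `0` and the integrals
stay bounded. All points of the ray are covered, because the next lemma needs pointwise convergence
under the integral. -/
theorem continuousAt_param (h : IsPolySystem m X T E) (x t : ℝ) (ξ₀ : ℂ) {s : ℝ}
    (hs : s ∈ Set.Icc (0 : ℝ) 1) (i l : Fin n) :
    ContinuousAt (fun ξ => E (s * x) (s * t) ξ i l) ξ₀ := by
  choose C hC using h.exists_rayIntegrand_bound x t ξ₀
  have hJ : ∀ k i l, IsBoundedUnder (· ≤ ·) (𝓝 ξ₀)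
      (norm ∘ fun ξ => rayIntegral X T E x t ξ₀ k s ξ i l) := by
    intro k i l
    refine ⟨C k * |s - 0|, ?_⟩
    rw [eventually_map]
    filter_upwards [Metric.ball_mem_nhds ξ₀ one_pos] with ξ hξ
    refine intervalIntegral.norm_integral_le_of_norm_le_const fun r hr => ?_
    rw [Set.uIoc_of_le hs.1] at hr
    exact hC k ξ hξ r ⟨hr.1.le, hr.2.trans hs.2⟩ i l
  have hpow : ∀ k, Tendsto (fun ξ : ℂ => ξ ^ k - ξ₀ ^ k) (𝓝 ξ₀) (𝓝 0) := by
    intro k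
    have : ContinuousAt (fun ξ : ℂ => ξ ^ k - ξ₀ ^ k) ξ₀ := by fun_prop
    simpa [ContinuousAt] using this
  have h1 : Tendsto (fun ξ => ∑ p, (∑ k ∈ Finset.range m, (ξ ^ k - ξ₀ ^ k) *
      rayIntegral X T E x t ξ₀ k s ξ i p) * E (s * x) (s * t) ξ₀ p l) (𝓝 ξ₀)
      (𝓝 (∑ p, (∑ k ∈ Finset.range m, 0) * E (s * x) (s * t) ξ₀ p l)) :=
    tendsto_finsetSum _ fun p _ => Tendsto.mul_const _ (tendsto_finsetSum _ fun k _ =>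
      (hpow k).zero_mul_isBoundedUnder_le (hJ k i p))
  have h2 : (fun ξ => E (s * x) (s * t) ξ i l) = fun ξ => E (s * x) (s * t) ξ₀ i l +
      ∑ p, (∑ k ∈ Finset.range m, (ξ ^ k - ξ₀ ^ k) *
      rayIntegral X T E x t ξ₀ k s ξ i p) * E (s * x) (s * t) ξ₀ p l := by
    ext ξ
    have := congrFun (congrFun (h.sub_eq_rayIntegral x t ξ₀ ξ s) i) l
    rw [Matrix.sub_apply, Matrix.mul_apply] at this
    simp only [Matrix.sum_apply, Matrix.smul_apply, smul_eq_mul] at this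
    rw [← this]
    ring
  rw [ContinuousAt, h2]
  simpa using tendsto_const_nhds.add h1

theorem continuousAt_rayIntegral (h : IsPolySystem m X T E) (x t : ℝ) (ξ₀ : ℂ) (k : ℕ)
    (i l : Fin n) : ContinuousAt (fun ξ => rayIntegral X T E x t ξ₀ k 1 ξ i l) ξ₀ := by
  obtain ⟨C, hC⟩ := h.exists_rayIntegrand_bound x t ξ₀ k
  refine intervalIntegral.tendsto_integral_filter_of_dominated_convergence (fun _ => C)
    (Eventually.of_forall fun ξ =>
      (h.continuous_rayIntegrand x t ξ₀ k ξ i l).aestronglyMeasurable) ?_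
    intervalIntegrable_const (MeasureTheory.ae_of_all _ fun r hr => ?_)
  · filter_upwards [Metric.ball_mem_nhds ξ₀ one_pos] with ξ hξ
    refine MeasureTheory.ae_of_all _ fun r hr => ?_
    rw [Set.uIoc_of_le zero_le_one] at hr
    exact hC ξ hξ r ⟨hr.1.le, hr.2⟩ i l
  · rw [Set.uIoc_of_le zero_le_one] at hr
    simp only [rayIntegrand, mul_assoc]
    simp only [Matrix.mul_apply (M := E _ _ _)]
    exact tendsto_finsetSum _ fun p _ =>
      (h.continuousAt_param x t ξ₀ ⟨hr.1.le, hr.2⟩ i p).mul_const _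

/-- The solution is an entire function of the parameter. -/
theorem differentiable_param (h : IsPolySystem m X T E) (x t : ℝ) (i l : Fin n) :
    Differentiable ℂ fun ξ => E x t ξ i l := by
  intro ξ₀
  have hJ := h.continuousAt_rayIntegral x t ξ₀
  -- A differentiable function vanishing at `ξ₀` times a function merely continuous there is
  -- differentiable at `ξ₀`.
  have hprod : ∀ k p, DifferentiableAt ℂ
      (fun ξ : ℂ => (ξ ^ k - ξ₀ ^ k) * rayIntegral X T E x t ξ₀ k 1 ξ i p) ξ₀ := by
    intro k p
    refine HasDerivAt.differentiableAt
      (f' := (k * ξ₀ ^ (k - 1)) * rayIntegral X T E x t ξ₀ k 1 ξ₀ i p) ?_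
    rw [hasDerivAt_iff_tendsto_slope]
    have h1 := (hasDerivAt_iff_tendsto_slope.mp (hasDerivAt_pow k ξ₀)).mul
      ((hJ k i p).tendsto.mono_left (nhdsWithin_le_nhds (s := {ξ₀}ᶜ)))
    refine h1.congr fun ξ => ?_
    simp only [slope_def_field, sub_self, zero_mul, sub_zero]
    ring
  have h2 : (fun ξ => E x t ξ i l) = fun ξ => E x t ξ₀ i l +
      ∑ p, (∑ k ∈ Finset.range m, (ξ ^ k - ξ₀ ^ k) *
      rayIntegral X T E x t ξ₀ k 1 ξ i p) * E x t ξ₀ p l := by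
    ext ξ
    have := congrFun (congrFun (h.sub_eq_rayIntegral x t ξ₀ ξ 1) i) l
    rw [Matrix.sub_apply, Matrix.mul_apply] at this
    simp only [Matrix.sum_apply, Matrix.smul_apply, smul_eq_mul, one_mul] at this
    rw [← this]
    ring
  rw [h2]
  exact (differentiableAt_const _).add (DifferentiableAt.fun_sum fun p _ =>
    (DifferentiableAt.fun_sum fun k _ => hprod k p).mul_const _)

end IsPolySystem

end

end LinearSystem

/-! ### The Lax pair of the flow as a polynomial linear system. -/

section LaxPair

variable {n : ℕ} {α : Fin n → ℂ}

theorem conjTranspose_of_mem_skewAdjoint {v : CMat n} (hv : v ∈ skewAdjoint (CMat n)) :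
    v.conjTranspose = -v := skewAdjoint.mem_iff.mp hv

theorem re_eq_zero_of_skewAdjoint (ha : (Matrix.diagonal α : CMat n) ∈ skewAdjoint (CMat n))
    (i : Fin n) : (α i).re = 0 := by
  have h := congrFun (congrFun (conjTranspose_of_mem_skewAdjoint ha) i) i
  rw [Matrix.conjTranspose_apply, Matrix.neg_apply, Matrix.diagonal_apply_eq] at h
  have := congrArg Complex.re h
  simp at this
  linarith

/-- The elements of `𝒰_a^⊥` vanish on the diagonal blocks. -/
theorem isOffBlock_of_mem_unitaryPerp {v : CMat n} (hv : v ∈ unitaryPerp (Matrix.diagonal α)) :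
    IsOffBlock α v := by
  obtain ⟨hs, ht⟩ := hv
  have hs' : ∀ i k, conj (v k i) = -v i k := fun i k => by
    have := congrFun (congrFun (conjTranspose_of_mem_skewAdjoint hs) i) k
    rwa [Matrix.conjTranspose_apply] at this
  -- Testing against the block part of `v` itself makes the trace equal to minus the sum of the
  -- squared norms of the block entries.
  have h := ht (centralizerPart α v) (skewAdjoint.mem_iff.mpr (by
      ext i k
      rw [Matrix.star_apply, Matrix.neg_apply]
      simp only [centralizerPart, Matrix.of_apply]
      by_cases h : α i = α k
      · rw [if_pos h, if_pos h.symm]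
        exact hs' i k
      · rw [if_neg h, if_neg (Ne.symm h)]
        simp)) (by
      rw [Commute, SemiconjBy]
      ext i k
      rw [Matrix.diagonal_mul, Matrix.mul_diagonal]
      simp only [centralizerPart, Matrix.of_apply]
      split_ifs with h
      · rw [h, mul_comm]
      · simp)
  have h2 : ∀ i k, centralizerPart α v i k * v k i =
      -((if α i = α k then ‖v i k‖ ^ 2 else 0 : ℝ) : ℂ) := by
    intro i k
    have h1 : v k i = -conj (v i k) := by rw [hs' k i, neg_neg]
    simp only [centralizerPart, Matrix.of_apply]
    split_ifs
    · rw [h1, mul_neg, Complex.mul_conj, Complex.normSq_eq_norm_sq]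
    · simp
  simp only [Matrix.trace, Matrix.diag, Matrix.mul_apply, h2, Finset.sum_neg_distrib,
    neg_eq_zero] at h
  have h3 : ∑ i, ∑ k, (if α i = α k then ‖v i k‖ ^ 2 else 0 : ℝ) = 0 := by exact_mod_cast h
  have h4 : ∀ i k, 0 ≤ (if α i = α k then ‖v i k‖ ^ 2 else 0 : ℝ) := fun i k => by
    split_ifs <;> positivity
  intro i k hik
  rw [Finset.sum_eq_zero_iff_of_nonneg fun i _ => Finset.sum_nonneg fun k _ => h4 i k] at h3
  have h5 := h3 i (Finset.mem_univ i)
  rw [Finset.sum_eq_zero_iff_of_nonneg fun k _ => h4 i k] at h5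
  simpa [hik] using h5 k (Finset.mem_univ k)

/-- The image of `ad(a)` is trace-orthogonal to the centralizer of `a`. The bracket `[ρ, a]` is
Hermitian, and the imaginary factor `z - z̄` makes it skew. -/
theorem add_lie_mem_unitaryPerp {a v ρ : CMat n} (ha : a ∈ skewAdjoint (CMat n))
    (hv : v ∈ unitaryPerp a) (hρ : ρ.conjTranspose = ρ) (z : ℂ) :
    v + (z - conj z) • ⁅ρ, a⁆ ∈ unitaryPerp a := by
  refine ⟨skewAdjoint.mem_iff.mpr ?_, fun x hx hc => ?_⟩
  · rw [Matrix.star_eq_conjTranspose, Matrix.conjTranspose_add, Matrix.conjTranspose_smul,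
      conjTranspose_of_mem_skewAdjoint hv.1, Ring.lie_def, Matrix.conjTranspose_sub,
      Matrix.conjTranspose_mul, Matrix.conjTranspose_mul, hρ, conjTranspose_of_mem_skewAdjoint ha]
    simp only [RCLike.star_def, map_sub, Complex.conj_conj, neg_mul, mul_neg]
    module
  · have h : (x * (ρ * a)).trace = (x * (a * ρ)).trace := by
      rw [← mul_assoc, Matrix.trace_mul_comm, ← mul_assoc, hc.eq, mul_assoc]
    rw [mul_add, Matrix.trace_add, hv.2 x hx hc, mul_smul_comm, Matrix.trace_smul, Ring.lie_def,
      mul_sub, Matrix.trace_sub, h]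
    simp

/-- The coefficients of the polynomial `aξ + u`. -/
def laxX (α : Fin n → ℂ) (u : ℝ → ℝ → CMat n) : ℕ → ℝ → ℝ → CMat n
  | 0 => u
  | 1 => fun _ _ => Matrix.diagonal α
  | _ + 2 => fun _ _ => 0

/-- The coefficients of the polynomial `∑ Q_{b,j-k}(u) ξ^k`. -/
noncomputable def laxT (α : Fin n → ℂ) (b : CMat n) (j : ℕ) (u : ℝ → ℝ → CMat n) (k : ℕ)
    (x t : ℝ) : CMat n :=
  if k ≤ j then fluxAt α b u (j - k) x t else 0

/-- The common range `j + 2` contains the degrees `1` and `j` for every `j`; surplus coefficients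
are zero. -/
theorem sum_laxX (α : Fin n → ℂ) (u : ℝ → ℝ → CMat n) (j : ℕ) (ξ : ℂ) (x t : ℝ) :
    ∑ k ∈ Finset.range (j + 2), ξ ^ k • laxX α u k x t = ξ • Matrix.diagonal α + u x t := by
  rw [Finset.sum_range_succ', Finset.sum_range_succ', Finset.sum_eq_zero fun k _ => by
    simp [laxX]]
  simp [laxX]

theorem sum_laxT (α : Fin n → ℂ) (b : CMat n) (u : ℝ → ℝ → CMat n) (j : ℕ) (ξ : ℂ) (x t : ℝ) :
    ∑ k ∈ Finset.range (j + 2), ξ ^ k • laxT α b j u k x t =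
      ∑ k ∈ Finset.range (j + 1), ξ ^ k • fluxAt α b u (j - k) x t := by
  rw [Finset.sum_range_succ, laxT, if_neg (by omega), smul_zero, add_zero]
  refine Finset.sum_congr rfl fun k hk => ?_
  rw [laxT, if_pos (Finset.mem_range_succ_iff.mp hk)]

/-- The coefficients of a polynomial with smooth values are smooth. -/
theorem MatSmooth.coeff {m : ℕ} {F : ℕ → ℝ → ℝ → CMat n}
    (h : ∀ ξ : ℂ, MatSmooth fun x t => ∑ k ∈ Finset.range m, ξ ^ k • F k x t) {k : ℕ}
    (hk : k < m) : MatSmooth (F k) := by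
  -- Interpolation at the points `0, …, m - 1`, whose Vandermonde matrix is invertible.
  set v : Fin m → ℂ := fun p => ((p : ℕ) : ℂ) with hv
  have hinj : Function.Injective v := fun p q hpq => by
    simpa [hv, Fin.val_inj] using hpq
  have hdet : IsUnit (Matrix.vandermonde v).det :=
    isUnit_iff_ne_zero.mpr (Matrix.det_vandermonde_ne_zero_iff.mpr hinj)
  have hF : ∀ x t, F k x t = ∑ p, (Matrix.vandermonde v)⁻¹ ⟨k, hk⟩ p •
      ∑ l ∈ Finset.range m, v p ^ l • F l x t := by
    intro x t
    have h1 : ∀ p, ∑ l ∈ Finset.range m, v p ^ l • F l x t =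
        ∑ l : Fin m, Matrix.vandermonde v p l • F l x t := fun p => by
      rw [Finset.sum_range]
      rfl
    simp only [h1, Finset.smul_sum, smul_smul]
    rw [Finset.sum_comm]
    simp only [← Finset.sum_smul, ← Matrix.mul_apply, Matrix.nonsing_inv_mul _ hdet,
      Matrix.one_apply]
    simp
  have h2 : F k = fun x t => ∑ p, (Matrix.vandermonde v)⁻¹ ⟨k, hk⟩ p •
      ∑ l ∈ Finset.range m, v p ^ l • F l x t := funext fun x => funext fun t => hF x t
  rw [h2]
  exact MatSmooth.sum _ fun p _ => (h (v p)).smul _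

variable {b : CMat n} {j : ℕ} {u : ℝ → ℝ → CMat n} {E : ℝ → ℝ → ℂ → CMat n}

theorem laxX_conjTranspose (ha : Matrix.diagonal α ∈ skewAdjoint (CMat n))
    (hu : ∀ x t, u x t ∈ unitaryPerp (Matrix.diagonal α)) (k : ℕ) (x t : ℝ) :
    (laxX α u k x t).conjTranspose = -laxX α u k x t := by
  match k with
  | 0 => exact conjTranspose_of_mem_skewAdjoint (hu x t).1
  | 1 => exact conjTranspose_of_mem_skewAdjoint ha
  | k + 2 => simp [laxX]

theorem laxT_conjTranspose (ha : Matrix.diagonal α ∈ skewAdjoint (CMat n))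
    (hb : b ∈ skewAdjoint (CMat n)) (hab : IsBlockScalar α b)
    (hu : ∀ x t, u x t ∈ unitaryPerp (Matrix.diagonal α))
    (hs : ∀ t i k, IsSchwartz fun x => u x t i k) (k : ℕ) (x t : ℝ) :
    (laxT α b j u k x t).conjTranspose = -laxT α b j u k x t := by
  rw [laxT]
  split_ifs
  · exact fluxQ_conjTranspose (conjTranspose_of_mem_skewAdjoint ha)
      (conjTranspose_of_mem_skewAdjoint hb) hab (hs t)
      (fun x => isOffBlock_of_mem_unitaryPerp (hu x t))
      (fun x => conjTranspose_of_mem_skewAdjoint (hu x t).1) _ x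
  · simp

/-- The trivialization solves a linear system with smooth skew-Hermitian coefficients. -/
theorem IsTrivialization.isPolySystem (ha : Matrix.diagonal α ∈ skewAdjoint (CMat n))
    (hb : b ∈ skewAdjoint (CMat n)) (hab : IsBlockScalar α b) (hu : IsFlowSolution α b j u)
    (hE : IsTrivialization α b j u E) :
    IsPolySystem (j + 2) (laxX α u) (laxT α b j u) E := by
  have hX := laxX_conjTranspose ha hu.mem_perp
  have hT := laxT_conjTranspose (j := j) ha hb hab hu.mem_perp hu.schwartz
  have hx : ∀ x t ξ, HasMatDerivAt (fun y => E y t ξ)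
      (E x t ξ * ∑ k ∈ Finset.range (j + 2), ξ ^ k • laxX α u k x t) x := fun x t ξ =>
    ((hE.smooth ξ).hasMatDerivAt_x x t).congr_deriv (by rw [sum_laxX, hE.deriv_x])
  have ht : ∀ x t ξ, HasMatDerivAt (fun s => E x s ξ)
      (E x t ξ * ∑ k ∈ Finset.range (j + 2), ξ ^ k • laxT α b j u k x t) t := fun x t ξ =>
    ((hE.smooth ξ).hasMatDerivAt_t x t).congr_deriv (by rw [sum_laxT, hE.deriv_t])
  have hinv : ∀ x t ξ, (E x t (conj ξ)).conjTranspose * E x t ξ = 1 := fun x t ξ =>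
    mul_eq_one_comm.mp (mul_conjTranspose_eq_one_of_skew hx ht
      (fun x t ξ => conjTranspose_sum_pow_smul (fun k => hX k x t) ξ)
      (fun x t ξ => conjTranspose_sum_pow_smul (fun k => hT k x t) ξ) hE.init x t ξ)
  -- Schwartz decay is assumed for each `t` without uniformity in `t`, so the integrals over `(-∞,
  -- x]` defining the fluxes cannot be differentiated in `t` directly. Smoothness is read off from
  -- `E⁻¹E_t`, a polynomial in `ξ` with the fluxes as coefficients.
  have hTs : ∀ k < j + 2, MatSmooth (laxT α b j u k) := fun k hk =>
    MatSmooth.coeff (m := j + 2) (fun ξ => by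
      have h := (hE.smooth (conj ξ)).conjTranspose.mul (hE.smooth ξ).matDeriv_t
      have h1 : (fun x t => ∑ k ∈ Finset.range (j + 2), ξ ^ k • laxT α b j u k x t) =
          fun x t => (E x t (conj ξ)).conjTranspose * matDeriv (fun s => E x s ξ) t := by
        funext x t
        rw [(ht x t ξ).matDeriv_eq, ← mul_assoc, hinv, one_mul]
      rw [h1]
      exact h) hk
  refine ⟨⟨fun k => ?_, hX⟩, ⟨fun k => ?_, hT⟩, fun ξ =>
    ⟨hE.smooth ξ, fun x t => hx x t ξ, fun x t => ht x t ξ, hE.init ξ⟩⟩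
  · match k with
    | 0 => exact hu.smooth
    | 1 => exact MatSmooth.const _
    | k + 2 => exact MatSmooth.const _
  · by_cases hk : k < j + 2
    · exact hTs k hk
    · have : laxT α b j u k = fun _ _ => 0 := by
        funext x t
        rw [laxT, if_neg (by omega)]
      rw [this]
      exact MatSmooth.const _

theorem IsPolySystem.isTrivialization
    (h : IsPolySystem (j + 2) (laxX α u) (laxT α b j u) E) : IsTrivialization α b j u E where
  smooth := h.smooth
  deriv_x x t ξ := by rw [((h.sol ξ).deriv_x x t).matDeriv_eq, sum_laxX]
  deriv_t x t ξ := by rw [((h.sol ξ).deriv_t x t).matDeriv_eq, sum_laxT]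
  init := h.init

theorem IsPolySystem.smooth_fluxAt (h : IsPolySystem (j + 2) (laxX α u) (laxT α b j u) E) {k : ℕ}
    (hk : k ≤ j) : MatSmooth (fluxAt α b u k) := by
  have h1 := h.smooth_T (j - k)
  have h2 : laxT α b j u (j - k) = fluxAt α b u k := by
    funext x t
    rw [laxT, if_pos (Nat.sub_le j k), Nat.sub_sub_self hk]
  rwa [h2] at h1

end LaxPair

/-! ### The differential equations of the moving projection. -/

section ProjectionFlow

variable {n : ℕ}

/-- The matrix acts as `z̄` on the image of `ρ` and as `z` on its kernel. -/
theorem dressMatrix_pow {ρ : CMat n} (hi : ρ * ρ = ρ) (z : ℂ) (k : ℕ) :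
    dressMatrix z ρ ^ k = conj z ^ k • ρ + z ^ k • (1 - ρ) := by
  induction k with
  | zero => simp
  | succ k ih =>
    rw [pow_succ, ih, dressMatrix]
    simp only [add_mul, mul_add, sub_mul, smul_mul_assoc, mul_smul_comm, smul_sub, one_mul,
      mul_one, hi, pow_succ]
    module

theorem lie_mul_dressMatrix_pow {ρ B : CMat n} (hi : ρ * ρ = ρ) (z : ℂ) (k : ℕ) :
    ⁅ρ, B⁆ * dressMatrix z ρ ^ k =
      z ^ k • (ρ * B * (1 - ρ)) - conj z ^ k • ((1 - ρ) * B * ρ) := by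
  have h : B * ρ * ρ = B * ρ := by rw [mul_assoc, hi]
  rw [dressMatrix_pow hi, Ring.lie_def]
  simp only [mul_add, sub_mul, mul_sub, mul_smul_comm, smul_sub, one_mul, mul_one, h]
  module

/-- The derivative of the projection, for a polynomial coefficient. -/
theorem projection_deriv_eq_sum {m : ℕ} {ρ : CMat n} (hi : ρ * ρ = ρ) {X : ℕ → CMat n}
    (hX : ∀ k, (X k).conjTranspose = -X k) (z : ℂ) :
    (1 - ρ) * (∑ k ∈ Finset.range m, z ^ k • X k).conjTranspose * ρ +
        ρ * (∑ k ∈ Finset.range m, z ^ k • X k) * (1 - ρ) =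
      ∑ k ∈ Finset.range m, ⁅ρ, X k⁆ * dressMatrix z ρ ^ k := by
  have h := conjTranspose_sum_pow_smul (m := m) hX (conj z)
  rw [Complex.conj_conj] at h
  rw [h]
  simp only [lie_mul_dressMatrix_pow hi, mul_neg, neg_mul, Finset.mul_sum, Finset.sum_mul,
    mul_smul_comm, smul_mul_assoc, Finset.sum_sub_distrib]
  abel

theorem IsPolySystem.hasMatDerivAt_hermProj {m : ℕ} {X T : ℕ → ℝ → ℝ → CMat n}
    {E : ℝ → ℝ → ℂ → CMat n} (h : IsPolySystem m X T E) (z : ℂ)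
    (V : Submodule ℂ (EuclideanSpace ℂ (Fin n))) {ρ : ℝ → ℝ → CMat n}
    (hρ : ∀ x t, ρ x t = hermProj (imageSubspace (E x t z).conjTranspose V)) (x t : ℝ) :
    HasMatDerivAt (fun y => ρ y t)
      (∑ k ∈ Finset.range m, ⁅ρ x t, X k x t⁆ * dressMatrix z (ρ x t) ^ k) x ∧
    HasMatDerivAt (fun s => ρ x s)
      (∑ k ∈ Finset.range m, ⁅ρ x t, T k x t⁆ * dressMatrix z (ρ x t) ^ k) t := by
  have hsm : MatSmooth ρ := by
    have := (h.smooth z).hermProj_imageSubspace (fun x t => h.det_ne_zero x t z) V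
    simpa only [← hρ] using this
  have hi : ρ x t * ρ x t = ρ x t := by rw [hρ, hermProj_mul_self]
  constructor
  · have h1 := hsm.hasMatDerivAt_x x t
    have h2 := hermProj_imageSubspace_deriv (fun y => h.det_ne_zero y t z) V
      ((h.sol z).deriv_x x t) (by simpa only [← hρ] using h1)
    simp only [← hρ] at h2
    rw [projection_deriv_eq_sum hi fun k => h.coeff_X.skew k x t] at h2
    rwa [h2] at h1
  · have h1 := hsm.hasMatDerivAt_t x t
    have h2 := hermProj_imageSubspace_deriv (fun s => h.det_ne_zero x s z) V
      ((h.sol z).deriv_t x t) (by simpa only [← hρ] using h1)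
    simp only [← hρ] at h2
    rw [projection_deriv_eq_sum hi fun k => h.coeff_T.skew k x t] at h2
    rwa [h2] at h1

end ProjectionFlow

/-! ### Extending the linear equations to an exceptional parameter. -/

section RemovableParameter

open Filter Topology

variable {n : ℕ}

theorem norm_mul_apply_le {Y Z : CMat n} {c d : ℝ} (hY : ∀ i k, ‖Y i k‖ ≤ c)
    (hZ : ∀ i k, ‖Z i k‖ ≤ d) (i k : Fin n) : ‖(Y * Z) i k‖ ≤ n * (c * d) := by
  rw [Matrix.mul_apply]
  have h : ∀ l ∈ Finset.univ, ‖Y i l * Z l k‖ ≤ c * d := fun l _ => by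
    rw [norm_mul]
    exact mul_le_mul (hY i l) (hZ l k) (norm_nonneg _) ((norm_nonneg _).trans (hY i l))
  exact (norm_sum_le_of_le _ h).trans (by simp)

/-- An entire function bounded on a punctured disc is Lipschitz at the center. -/
theorem norm_sub_le_of_bounded_punctured {f : ℂ → ℂ} (hf : Differentiable ℂ f) {ξ₀ : ℂ} {r C : ℝ}
    (hr : 0 < r) (hC : ∀ ξ ∈ Metric.ball ξ₀ r, ξ ≠ ξ₀ → ‖f ξ‖ ≤ C) {ξ : ℂ}
    (hξ : ξ ∈ Metric.ball ξ₀ r) : ‖f ξ - f ξ₀‖ ≤ 2 * C / r * ‖ξ - ξ₀‖ := by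
  have h0 : ‖f ξ₀‖ ≤ C := by
    have h1 : Tendsto (fun ξ => ‖f ξ‖) (𝓝[≠] ξ₀) (𝓝 ‖f ξ₀‖) :=
      (hf.continuous.norm.tendsto ξ₀).mono_left nhdsWithin_le_nhds
    refine le_of_tendsto h1 ?_
    filter_upwards [self_mem_nhdsWithin,
      mem_nhdsWithin_of_mem_nhds (Metric.ball_mem_nhds ξ₀ hr)] with ξ h2 h3
    exact hC ξ h3 h2
  -- Schwarz's lemma: the disc is mapped into the disc of radius `2C` about `f ξ₀`.
  have h := Complex.dist_le_div_mul_dist_of_mapsTo_ball (f := f) (c := ξ₀) (R₁ := r) (R₂ := 2 * C)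
    hf.differentiableOn (fun ζ hζ => ?_) hξ
  · simpa only [dist_eq_norm] using h
  · rw [mem_closedBall_iff_norm]
    have h2 : ‖f ζ‖ ≤ C := by
      by_cases hζ0 : ζ = ξ₀
      · rwa [hζ0]
      · exact hC ζ hζ hζ0
    linarith [norm_sub_le (f ζ) (f ξ₀)]

/-- Limits of derivatives, for a family with Lipschitz dependence on the parameter at `ξ₀`. -/
theorem hasFDerivAt_of_lipschitz_param {f : ℂ → ℝ × ℝ → ℂ} {gX gT : ℂ → ℝ → ℝ → ℂ} {ξ₀ : ℂ}
    {x t C D M : ℝ} (hx : |x| < M) (ht : |t| < M)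
    (hf : ∀ᶠ ξ in 𝓝[≠] ξ₀, ∀ p : ℝ × ℝ, HasFDerivAt (f ξ)
      ((ContinuousLinearMap.fst ℝ ℝ ℝ).smulRight (gX ξ p.1 p.2) +
        (ContinuousLinearMap.snd ℝ ℝ ℝ).smulRight (gT ξ p.1 p.2)) p)
    (hX : ∀ᶠ ξ in 𝓝[≠] ξ₀, ∀ x t, |x| < M → |t| < M →
      ‖gX ξ x t - gX ξ₀ x t‖ ≤ C * ‖ξ - ξ₀‖)
    (hT : ∀ᶠ ξ in 𝓝[≠] ξ₀, ∀ x t, |x| < M → |t| < M →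
      ‖gT ξ x t - gT ξ₀ x t‖ ≤ D * ‖ξ - ξ₀‖)
    (hlim : ∀ p, Tendsto (fun ξ => f ξ p) (𝓝[≠] ξ₀) (𝓝 (f ξ₀ p))) :
    HasFDerivAt (f ξ₀) ((ContinuousLinearMap.fst ℝ ℝ ℝ).smulRight (gX ξ₀ x t) +
      (ContinuousLinearMap.snd ℝ ℝ ℝ).smulRight (gT ξ₀ x t)) (x, t) := by
  refine hasFDerivAt_of_tendstoUniformlyOnFilter (l := 𝓝[≠] ξ₀) (f := f)
    (f' := fun ξ (p : ℝ × ℝ) => (ContinuousLinearMap.fst ℝ ℝ ℝ).smulRight (gX ξ p.1 p.2) +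
      (ContinuousLinearMap.snd ℝ ℝ ℝ).smulRight (gT ξ p.1 p.2))
    (g' := fun (p : ℝ × ℝ) => (ContinuousLinearMap.fst ℝ ℝ ℝ).smulRight (gX ξ₀ p.1 p.2) +
      (ContinuousLinearMap.snd ℝ ℝ ℝ).smulRight (gT ξ₀ p.1 p.2)) ?_
    ((hf.prod_inl (𝓝 (x, t))).mono fun q hq => hq q.2) (Eventually.of_forall hlim)
  rw [Metric.tendstoUniformlyOnFilter_iff]
  intro ε hε
  have h1 : ∀ᶠ ξ in 𝓝[≠] ξ₀, (C + D) * ‖ξ - ξ₀‖ < ε := by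
    have h2 : Continuous fun ξ : ℂ => (C + D) * ‖ξ - ξ₀‖ := by fun_prop
    have h3 : Tendsto (fun ξ : ℂ => (C + D) * ‖ξ - ξ₀‖) (𝓝[≠] ξ₀) (𝓝 0) := by
      have := (h2.tendsto ξ₀).mono_left (nhdsWithin_le_nhds (s := {ξ₀}ᶜ))
      simpa using this
    exact h3.eventually_lt_const hε
  have h2 : ∀ᶠ p : ℝ × ℝ in 𝓝 (x, t), |p.1| < M ∧ |p.2| < M :=
    (continuous_fst.abs.continuousAt.eventually_lt continuousAt_const hx).and
      (continuous_snd.abs.continuousAt.eventually_lt continuousAt_const ht)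
  filter_upwards [(h1.and (hX.and hT)).prod_mk h2] with q hq
  obtain ⟨⟨hq1, hq2, hq3⟩, hq4, hq5⟩ := hq
  refine lt_of_le_of_lt ?_ hq1
  have e : ∀ (l l' : ℝ × ℝ →L[ℝ] ℝ) (c c' d d' : ℂ), l.smulRight c + l'.smulRight d -
      (l.smulRight c' + l'.smulRight d') = l.smulRight (c - c') + l'.smulRight (d - d') := by
    intro l l' c c' d d'
    refine ContinuousLinearMap.ext fun v => ?_
    simp only [sub_apply, add_apply,
      ContinuousLinearMap.smulRight_apply]
    module
  rw [dist_comm, dist_eq_norm, e, add_mul]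
  refine (norm_add_le _ _).trans (add_le_add ?_ ?_)
  · rw [ContinuousLinearMap.norm_smulRight_apply]
    exact (mul_le_of_le_one_left (norm_nonneg _)
      (ContinuousLinearMap.norm_fst_le ℝ ℝ ℝ)).trans (hq2 _ _ hq4 hq5)
  · rw [ContinuousLinearMap.norm_smulRight_apply]
    exact (mul_le_of_le_one_left (norm_nonneg _)
      (ContinuousLinearMap.norm_snd_le ℝ ℝ ℝ)).trans (hq3 _ _ hq4 hq5)

/-- A solution of a linear system with smooth coefficients is smooth. -/
theorem MatSmooth.of_hasFDerivAt {F X T : ℝ → ℝ → CMat n} (hX : MatSmooth X) (hT : MatSmooth T)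
    (h : ∀ x t i k, HasFDerivAt (fun p : ℝ × ℝ => F p.1 p.2 i k)
      ((ContinuousLinearMap.fst ℝ ℝ ℝ).smulRight ((F x t * X x t) i k) +
        (ContinuousLinearMap.snd ℝ ℝ ℝ).smulRight ((F x t * T x t) i k)) (x, t)) :
    MatSmooth F := by
  have key : ∀ m : ℕ, ∀ i k, ContDiff ℝ m fun p : ℝ × ℝ => F p.1 p.2 i k := by
    intro m
    induction m with
    | zero =>
      intro i k
      exact contDiff_zero.mpr (continuous_iff_continuousAt.mpr fun p =>
        (h p.1 p.2 i k).continuousAt)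
    | succ m ih =>
      intro i k
      have hmul : ∀ Z : ℝ → ℝ → CMat n, MatSmooth Z →
          ContDiff ℝ m fun p : ℝ × ℝ => (F p.1 p.2 * Z p.1 p.2) i k := by
        intro Z hZ
        simp only [Matrix.mul_apply]
        exact ContDiff.sum fun l _ => (ih i l).mul ((hZ l k).of_le (by exact_mod_cast le_top))
      rw [Nat.cast_succ, contDiff_succ_iff_hasFDerivAt]
      exact ⟨fun p => (ContinuousLinearMap.fst ℝ ℝ ℝ).smulRight ((F p.1 p.2 * X p.1 p.2) i k) +
        (ContinuousLinearMap.snd ℝ ℝ ℝ).smulRight ((F p.1 p.2 * T p.1 p.2) i k),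
        (contDiff_const.smulRight (hmul X hX)).add (contDiff_const.smulRight (hmul T hT)),
        fun p => h p.1 p.2 i k⟩
  exact fun i k => contDiff_infty.mpr fun m => key m i k

variable {m : ℕ} {X T : ℕ → ℝ → ℝ → CMat n} {E : ℝ → ℝ → ℂ → CMat n}

theorem differentiable_mul_sum (hE : ∀ x t i k, Differentiable ℂ fun ξ => E x t ξ i k)
    (X : ℕ → ℝ → ℝ → CMat n) (x t : ℝ) (i k : Fin n) : Differentiable ℂ fun ξ : ℂ =>
      (E x t ξ * ∑ k ∈ Finset.range m, ξ ^ k • X k x t) i k := by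
  simp only [Matrix.mul_apply, Matrix.sum_apply, Matrix.smul_apply, smul_eq_mul]
  have h := hE x t i
  fun_prop

theorem MatSmooth.sum_pow_smul (hX : ∀ k, MatSmooth (X k)) (m : ℕ) (ξ : ℂ) :
    MatSmooth fun x t => ∑ k ∈ Finset.range m, ξ ^ k • X k x t :=
  MatSmooth.sum _ fun k _ => (hX k).smul _

/-- Grönwall bounds the family on the punctured disc, uniformly for `(x, t)` in a square, and
holomorphy in `ξ` turns the bound into a Lipschitz estimate. No equation at `ξ₀` is needed. -/
theorem exists_lipschitz_mul_sum (hX : IsPolyCoeff X) (hT : IsPolyCoeff T)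
    (hE : ∀ x t i k, Differentiable ℂ fun ξ => E x t ξ i k) {ξ₀ : ℂ} {r : ℝ} (hr : 0 < r)
    (h : ∀ ξ ∈ Metric.ball ξ₀ r, ξ ≠ ξ₀ → IsSolutionAt m X T ξ fun x t => E x t ξ)
    {Y : ℕ → ℝ → ℝ → CMat n} (hY : ∀ k, MatSmooth (Y k)) (M : ℝ) :
    ∃ C, ∀ ξ ∈ Metric.ball ξ₀ r, ∀ x t, |x| ≤ M → |t| ≤ M → ∀ i k,
      ‖(E x t ξ * ∑ k ∈ Finset.range m, ξ ^ k • Y k x t) i k -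
        (E x t ξ₀ * ∑ k ∈ Finset.range m, ξ₀ ^ k • Y k x t) i k‖ ≤ C * ‖ξ - ξ₀‖ := by
  obtain ⟨C, hC⟩ := exists_bound_solutionAt hX hT m M (‖ξ₀‖ + r)
  choose cY hcY using fun k => (hY k).exists_bound M
  refine ⟨2 * (n * (C * ∑ k ∈ Finset.range m, (‖ξ₀‖ + r) ^ k * cY k)) / r,
    fun ξ hξ x t hx ht i k => ?_⟩
  refine norm_sub_le_of_bounded_punctured (differentiable_mul_sum hE Y x t i k) hr
    (fun ζ hζ hζ0 => ?_) hξ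
  have hζ' : ‖ζ‖ ≤ ‖ξ₀‖ + r := by
    have := norm_add_le ξ₀ (ζ - ξ₀)
    rw [add_sub_cancel] at this
    rw [mem_ball_iff_norm] at hζ
    linarith
  refine norm_mul_apply_le (hC ζ _ (h ζ hζ hζ0) hζ' x t hx ht) (fun i k => ?_) i k
  rw [Matrix.sum_apply]
  refine norm_sum_le_of_le _ fun l _ => ?_
  rw [Matrix.smul_apply, smul_eq_mul, norm_mul, norm_pow]
  exact mul_le_mul (pow_le_pow_left₀ (norm_nonneg _) hζ' l) (hcY l x t hx ht i k) (norm_nonneg _)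
    (pow_nonneg ((norm_nonneg _).trans hζ') l)

/-- If the equations hold for all parameters near `ξ₀` except `ξ₀`, they hold at `ξ₀`. -/
theorem isSolutionAt_of_punctured (hX : IsPolyCoeff X) (hT : IsPolyCoeff T)
    (hE : ∀ x t i k, Differentiable ℂ fun ξ => E x t ξ i k) {ξ₀ : ℂ} {r : ℝ} (hr : 0 < r)
    (h : ∀ ξ ∈ Metric.ball ξ₀ r, ξ ≠ ξ₀ → IsSolutionAt m X T ξ fun x t => E x t ξ) :
    IsSolutionAt m X T ξ₀ fun x t => E x t ξ₀ := by
  have hball : ∀ᶠ ξ in 𝓝[≠] ξ₀, ξ ∈ Metric.ball ξ₀ r ∧ ξ ≠ ξ₀ := by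
    filter_upwards [self_mem_nhdsWithin,
      mem_nhdsWithin_of_mem_nhds (Metric.ball_mem_nhds ξ₀ hr)] with ξ h1 h2
    exact ⟨h2, h1⟩
  have hd : ∀ x t i k, HasFDerivAt (fun p : ℝ × ℝ => E p.1 p.2 ξ₀ i k)
      ((ContinuousLinearMap.fst ℝ ℝ ℝ).smulRight
          ((E x t ξ₀ * ∑ k ∈ Finset.range m, ξ₀ ^ k • X k x t) i k) +
        (ContinuousLinearMap.snd ℝ ℝ ℝ).smulRight
          ((E x t ξ₀ * ∑ k ∈ Finset.range m, ξ₀ ^ k • T k x t) i k)) (x, t) := by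
    intro x t i k
    -- The point `(x, t)` is interior to the square on which the derivatives converge uniformly.
    set M := max (|x| + 1) (|t| + 1) with hM
    obtain ⟨C, hC⟩ := exists_lipschitz_mul_sum hX hT hE hr h hX.smooth M
    obtain ⟨D, hD⟩ := exists_lipschitz_mul_sum hX hT hE hr h hT.smooth M
    refine hasFDerivAt_of_lipschitz_param (C := C) (D := D) (M := M)
      (f := fun ξ (p : ℝ × ℝ) => E p.1 p.2 ξ i k)
      (gX := fun ξ x t => (E x t ξ * ∑ k ∈ Finset.range m, ξ ^ k • X k x t) i k)
      (gT := fun ξ x t => (E x t ξ * ∑ k ∈ Finset.range m, ξ ^ k • T k x t) i k)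
      (lt_of_lt_of_le (by simp) (le_max_left _ _)) (lt_of_lt_of_le (by simp) (le_max_right _ _))
      ?_ ?_ ?_ ?_
    · filter_upwards [hball] with ξ hξ p
      have hs := h ξ hξ.1 hξ.2
      have := hs.smooth.hasFDerivAt p.1 p.2 i k
      rwa [(hs.deriv_x _ _).matDeriv_eq, (hs.deriv_t _ _).matDeriv_eq] at this
    · filter_upwards [hball] with ξ hξ x t hx ht
      exact hC ξ hξ.1 x t hx.le ht.le i k
    · filter_upwards [hball] with ξ hξ x t hx ht
      exact hD ξ hξ.1 x t hx.le ht.le i k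
    · exact fun p => ((hE p.1 p.2 i k).continuous.tendsto ξ₀).mono_left nhdsWithin_le_nhds
  have hs : MatSmooth fun x t => E x t ξ₀ := MatSmooth.of_hasFDerivAt
    (MatSmooth.sum_pow_smul hX.smooth m ξ₀) (MatSmooth.sum_pow_smul hT.smooth m ξ₀) hd
  refine ⟨hs, fun x t i k => ?_, fun x t i k => ?_, ?_⟩
  · have := (hd x t i k).comp_hasDerivAt x (f := fun y => (y, t))
      ((hasDerivAt_id x).prodMk (hasDerivAt_const x t))
    exact this.congr_deriv (by simp)
  · have := (hd x t i k).comp_hasDerivAt t (f := fun s => (x, s))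
      ((hasDerivAt_const t x).prodMk (hasDerivAt_id t))
    exact this.congr_deriv (by simp)
  · ext i k
    refine tendsto_nhds_unique (((hE 0 0 i k).continuous.tendsto ξ₀).mono_left
      (nhdsWithin_le_nhds (s := {ξ₀}ᶜ))) (tendsto_const_nhds.congr' ?_)
    filter_upwards [hball] with ξ hξ
    rw [(h ξ hξ.1 hξ.2).init]

end RemovableParameter

/-! ### The factorization of `E` through `ξ - A` with an entire factor. -/

section Extension

open Filter Topology

variable {n : ℕ}

/-- Division of an entire function by two of its zeros. -/
theorem exists_entire_quotient {f : ℂ → ℂ} (hf : Differentiable ℂ f) {z w : ℂ} (hzw : w ≠ z)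
    (hz : f z = 0) (hw : f w = 0) :
    ∃ g : ℂ → ℂ, Differentiable ℂ g ∧ ∀ ξ, f ξ = (ξ - z) * (ξ - w) * g ξ := by
  have hd : ∀ {f : ℂ → ℂ}, Differentiable ℂ f → ∀ c, Differentiable ℂ (dslope f c) :=
    fun hf c => differentiableOn_univ.mp
      ((Complex.differentiableOn_dslope univ_mem).mpr hf.differentiableOn)
  have h1 : ∀ ξ, (ξ - z) * dslope f z ξ = f ξ := fun ξ => by
    simpa [hz] using sub_smul_dslope f z ξ
  have h2 : dslope f z w = 0 := by
    have := h1 w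
    rw [hw] at this
    exact (mul_eq_zero.mp this).resolve_left (sub_ne_zero.mpr hzw)
  refine ⟨dslope (dslope f z) w, hd (hd hf z) w, fun ξ => ?_⟩
  have h3 := sub_smul_dslope (dslope f z) w ξ
  rw [h2, sub_zero, smul_eq_mul] at h3
  rw [mul_assoc, h3, h1]

/-- The two matrices have the same eigenspaces with the eigenvalues `z` and `z̄` exchanged, so the
product is scalar. -/
theorem smul_one_sub_mul_dressMatrix {ρ : CMat n} (hi : ρ * ρ = ρ) (z ξ : ℂ) :
    (ξ • (1 : CMat n) - dressMatrix z ρ) * (ξ • (1 : CMat n) - dressMatrix (conj z) ρ) =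
      ((ξ - z) * (ξ - conj z)) • (1 : CMat n) := by
  simp only [dressMatrix, Complex.conj_conj, sub_mul, mul_sub, add_mul, mul_add, smul_mul_assoc,
    mul_smul_comm, one_mul, mul_one, hi, smul_add, smul_sub]
  module

theorem smul_one_sub_mul_dressMatrix' {ρ : CMat n} (hi : ρ * ρ = ρ) (z ξ : ℂ) :
    (ξ • (1 : CMat n) - dressMatrix (conj z) ρ) * (ξ • (1 : CMat n) - dressMatrix z ρ) =
      ((ξ - z) * (ξ - conj z)) • (1 : CMat n) := by
  simp only [dressMatrix, Complex.conj_conj, sub_mul, mul_sub, add_mul, mul_add, smul_mul_assoc,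
    mul_smul_comm, one_mul, mul_one, hi, smul_add, smul_sub]
  module

theorem conj_ne_self {z : ℂ} (hz : z.im ≠ 0) : conj z ≠ z := fun h =>
  hz (Complex.conj_eq_iff_im.mp h)

theorem mul_right_cancel_dressMatrix {ρ Y Z : CMat n} (hi : ρ * ρ = ρ) {z ξ : ℂ} (h1 : ξ ≠ z)
    (h2 : ξ ≠ conj z) (h : Y * (ξ • (1 : CMat n) - dressMatrix z ρ) =
      Z * (ξ • (1 : CMat n) - dressMatrix z ρ)) : Y = Z := by
  have := congrArg (· * (ξ • (1 : CMat n) - dressMatrix (conj z) ρ)) h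
  simp only [mul_assoc, smul_one_sub_mul_dressMatrix hi, mul_smul_comm, mul_one] at this
  exact smul_right_injective _ (mul_ne_zero (sub_ne_zero.mpr h1) (sub_ne_zero.mpr h2)) this

theorem differentiable_smul_one_sub_apply (A : CMat n) (i k : Fin n) :
    Differentiable ℂ fun ξ : ℂ => (ξ • (1 : CMat n) - A) i k := by
  simp only [Matrix.sub_apply, Matrix.smul_apply, smul_eq_mul]
  fun_prop

theorem differentiable_mul_apply {Y Z : ℂ → CMat n} (hY : ∀ i k, Differentiable ℂ fun ξ => Y ξ i k)
    (hZ : ∀ i k, Differentiable ℂ fun ξ => Z ξ i k) (i k : Fin n) :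
    Differentiable ℂ fun ξ => (Y ξ * Z ξ) i k := by
  simp only [Matrix.mul_apply]
  exact Differentiable.fun_sum fun l _ => (hY i l).mul (hZ l k)

/-- Entire matrix functions which agree off two points are equal. -/
theorem eq_of_eq_off_pair {Y Z : ℂ → CMat n} (hY : ∀ i k, Differentiable ℂ fun ξ => Y ξ i k)
    (hZ : ∀ i k, Differentiable ℂ fun ξ => Z ξ i k) {z w : ℂ}
    (h : ∀ ξ, ξ ≠ z → ξ ≠ w → Y ξ = Z ξ) (ξ : ℂ) : Y ξ = Z ξ := by
  ext i k
  have hd : Dense ({z, w}ᶜ : Set ℂ) := (Set.toFinite {z, w}).countable.dense_compl ℝ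
  refine congrFun ((hY i k).continuous.ext_on hd (hZ i k).continuous fun ξ hξ => ?_) ξ
  simp only [Set.mem_compl_iff, Set.mem_insert_iff, Set.mem_singleton_iff, not_or] at hξ
  exact congrFun (congrFun (h ξ hξ.1 hξ.2) i) k

variable {m : ℕ} {X T X' T' : ℕ → ℝ → ℝ → CMat n} {E : ℝ → ℝ → ℂ → CMat n} {z : ℂ}
  {V : Submodule ℂ (EuclideanSpace ℂ (Fin n))} {ρ : ℝ → ℝ → CMat n}

/-- These relations make the numerator vanish at `z` and at `z̄`. The first is the adjoint of `RY =
Y`; the second holds because `E(z̄)` inverts `E(z)*` and so maps the moved subspace back to `V`. -/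
theorem hermProj_mul_mul_eq_zero (h : IsPolySystem m X T E)
    (hρ : ∀ x t, ρ x t = hermProj (imageSubspace (E x t z).conjTranspose V)) (x t : ℝ) :
    hermProj V * E x t z * (1 - ρ x t) = 0 ∧
      (1 - hermProj V) * E x t (conj z) * ρ x t = 0 := by
  constructor
  · have h1 := congrArg Matrix.conjTranspose (hermProj_imageSubspace_mul (E x t z) V)
    rw [← hρ] at h1
    simp only [Matrix.conjTranspose_mul, Matrix.conjTranspose_conjTranspose,
      hermProj_conjTranspose] at h1
    have hs : (ρ x t).conjTranspose = ρ x t := by rw [hρ, hermProj_conjTranspose]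
    rw [hs] at h1
    rw [mul_sub, mul_one, h1, sub_self]
  · rw [hρ, hermProj_imageSubspace_conjTranspose (h.det_ne_zero x t z)]
    have h2 := h.mul_conjTranspose x t (conj z)
    rw [Complex.conj_conj] at h2
    rw [mul_assoc, ← mul_assoc (E x t (conj z)), ← mul_assoc (E x t (conj z)), h2, one_mul,
      ← mul_assoc, sub_mul, one_mul, hermProj_mul_self, sub_self, zero_mul]

/-- The factorization `(ξ - A(0,0)) E = E' (ξ - A)` with `E'` entire in `ξ`. -/
theorem exists_entire_factor (hz : z.im ≠ 0) (h : IsPolySystem m X T E)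
    (hρ : ∀ x t, ρ x t = hermProj (imageSubspace (E x t z).conjTranspose V)) :
    ∃ E' : ℝ → ℝ → ℂ → CMat n, (∀ x t i k, Differentiable ℂ fun ξ => E' x t ξ i k) ∧
      ∀ x t ξ, (ξ • (1 : CMat n) - dressMatrix z (hermProj V)) * E x t ξ =
        E' x t ξ * (ξ • (1 : CMat n) - dressMatrix z (ρ x t)) := by
  -- Off `z` and `z̄` the inverse of `ξ - A` is `ξ - A*` divided by `(ξ - z)(ξ - z̄)`; this is the
  -- numerator of the sought factor.
  set N : ℝ → ℝ → ℂ → CMat n := fun x t ξ => (ξ • (1 : CMat n) - dressMatrix z (hermProj V)) *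
    E x t ξ * (ξ • (1 : CMat n) - dressMatrix (conj z) (ρ x t)) with hN
  have hNd : ∀ x t i k, Differentiable ℂ fun ξ => N x t ξ i k := fun x t =>
    differentiable_mul_apply (differentiable_mul_apply (differentiable_smul_one_sub_apply _)
      (h.differentiable_param x t)) (differentiable_smul_one_sub_apply _)
  have hA1 : ∀ (w : ℂ) (R : CMat n), w • (1 : CMat n) - dressMatrix w R = (w - conj w) • R := by
    intro w R
    rw [dressMatrix]
    module
  have hA2 : ∀ (w : ℂ) (R : CMat n), w • (1 : CMat n) - dressMatrix (conj w) R =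
      (w - conj w) • (1 - R) := by
    intro w R
    rw [dressMatrix, Complex.conj_conj]
    module
  have hN1 : ∀ x t, N x t z = 0 := fun x t => by
    simp only [hN]
    rw [hA1, hA2, smul_mul_assoc, smul_mul_smul_comm, (hermProj_mul_mul_eq_zero h hρ x t).1,
      smul_zero]
  have hN2 : ∀ x t, N x t (conj z) = 0 := fun x t => by
    have h1 := hA2 (conj z) (hermProj V)
    rw [Complex.conj_conj] at h1
    simp only [hN]
    rw [hA1, h1, smul_mul_assoc, smul_mul_smul_comm, (hermProj_mul_mul_eq_zero h hρ x t).2,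
      smul_zero]
  choose E' hE' hNE using fun x t i k => exists_entire_quotient (hNd x t i k) (conj_ne_self hz)
    (by rw [hN1]; rfl) (by rw [hN2]; rfl)
  have hi : ∀ x t, ρ x t * ρ x t = ρ x t := fun x t => by rw [hρ, hermProj_mul_self]
  refine ⟨fun x t ξ => Matrix.of fun i k => E' x t i k ξ, hE', fun x t => ?_⟩
  refine eq_of_eq_off_pair (z := z) (w := conj z)
    (differentiable_mul_apply (differentiable_smul_one_sub_apply _) (h.differentiable_param x t))
    (differentiable_mul_apply (hE' x t) (differentiable_smul_one_sub_apply _)) fun ξ h1 h2 => ?_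
  have h3 : N x t ξ = ((ξ - z) * (ξ - conj z)) • Matrix.of fun i k => E' x t i k ξ := by
    ext i k
    exact hNE x t i k ξ
  have h4 := congrArg (· * (ξ • (1 : CMat n) - dressMatrix z (ρ x t))) h3
  simp only [hN] at h4
  rw [mul_assoc _ (_ - _) (_ - _), smul_one_sub_mul_dressMatrix' (hi x t), mul_smul_comm, mul_one,
    smul_mul_assoc] at h4
  exact smul_right_injective _ (mul_ne_zero (sub_ne_zero.mpr h1) (sub_ne_zero.mpr h2)) h4

theorem apply_zero_zero_eq (h : IsPolySystem m X T E)
    (hρ : ∀ x t, ρ x t = hermProj (imageSubspace (E x t z).conjTranspose V)) :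
    ρ 0 0 = hermProj V := by
  rw [hρ, h.init, Matrix.conjTranspose_one, imageSubspace_eq_range, one_mul,
    range_toEuclideanLin_hermProj]

/-- The product rule applied to `(ξ - A₀)G = F(ξ - A)`. The right factor `ξ - A` stays in the
conclusion because it need not be invertible at `z` and `z̄`. -/
theorem hasMatDerivAt_factor {F G A : ℝ → CMat n} {A₀ F' B B' : CMat n} {ξ : ℂ} {s : ℝ}
    (hFG : ∀ s, (ξ • (1 : CMat n) - A₀) * G s = F s * (ξ • (1 : CMat n) - A s))
    (hF : HasMatDerivAt F F' s) (hG : HasMatDerivAt G (G s * B) s)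
    (hA : HasMatDerivAt A
      (B' * (ξ • (1 : CMat n) - A s) - (ξ • (1 : CMat n) - A s) * B) s) :
    F' * (ξ • (1 : CMat n) - A s) = F s * B' * (ξ • (1 : CMat n) - A s) := by
  have h1 := hG.const_mul (ξ • (1 : CMat n) - A₀)
  have h2 := hF.mul ((HasMatDerivAt.const (ξ • (1 : CMat n)) s).sub hA)
  simp only [hFG] at h1
  have h3 := h1.unique h2
  rw [← mul_assoc, hFG] at h3
  generalize ξ • (1 : CMat n) - A s = Y at h3 ⊢
  rw [← sub_eq_zero] at h3 ⊢
  rw [← neg_eq_zero, ← h3]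
  noncomm_ring

theorem smooth_factor {F G ρ : ℝ → ℝ → CMat n} {A₀ : CMat n} {ξ : ℂ}
    (hi : ∀ x t, ρ x t * ρ x t = ρ x t) (hρ : MatSmooth ρ) (hG : MatSmooth G) (h1 : ξ ≠ z)
    (h2 : ξ ≠ conj z) (hFG : ∀ x t, (ξ • (1 : CMat n) - A₀) * G x t =
      F x t * (ξ • (1 : CMat n) - dressMatrix z (ρ x t))) : MatSmooth F := by
  have hc : (ξ - z) * (ξ - conj z) ≠ 0 :=
    mul_ne_zero (sub_ne_zero.mpr h1) (sub_ne_zero.mpr h2)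
  have h3 : MatSmooth fun x t => (ξ - conj z) • (1 : CMat n) - (z - conj z) • ρ x t :=
    (MatSmooth.const _).sub (hρ.smul _)
  have h4 : MatSmooth fun x t => (ξ • (1 : CMat n) - A₀) * G x t := (MatSmooth.const _).mul hG
  have h5 := (h4.mul h3).smul ((ξ - z) * (ξ - conj z))⁻¹
  have h6 : F = fun x t => ((ξ - z) * (ξ - conj z))⁻¹ • ((ξ • (1 : CMat n) - A₀) * G x t *
      ((ξ - conj z) • (1 : CMat n) - (z - conj z) • ρ x t)) := by
    funext x t
    have h7 : (ξ - conj z) • (1 : CMat n) - (z - conj z) • ρ x t =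
        ξ • (1 : CMat n) - dressMatrix (conj z) (ρ x t) := by
      rw [dressMatrix, Complex.conj_conj]
      module
    rw [h7, hFG, mul_assoc, smul_one_sub_mul_dressMatrix (hi x t), mul_smul_comm, mul_one,
      inv_smul_smul₀ hc]
  rw [h6]
  exact h5

/-- The dressing transformation of a linear system. -/
theorem exists_isPolySystem_dressed (hz : z.im ≠ 0) (h : IsPolySystem m X T E)
    (hρ : ∀ x t, ρ x t = hermProj (imageSubspace (E x t z).conjTranspose V))
    (hX' : IsPolyCoeff X') (hT' : IsPolyCoeff T')
    (hx : ∀ x t (ξ : ℂ), HasMatDerivAt (fun y => dressMatrix z (ρ y t))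
      ((∑ k ∈ Finset.range m, ξ ^ k • X' k x t) * (ξ • (1 : CMat n) - dressMatrix z (ρ x t)) -
        (ξ • (1 : CMat n) - dressMatrix z (ρ x t)) * ∑ k ∈ Finset.range m, ξ ^ k • X k x t) x)
    (ht : ∀ x t (ξ : ℂ), HasMatDerivAt (fun s => dressMatrix z (ρ x s))
      ((∑ k ∈ Finset.range m, ξ ^ k • T' k x t) * (ξ • (1 : CMat n) - dressMatrix z (ρ x t)) -
        (ξ • (1 : CMat n) - dressMatrix z (ρ x t)) * ∑ k ∈ Finset.range m, ξ ^ k • T k x t) t) :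
    ∃ E' : ℝ → ℝ → ℂ → CMat n, IsPolySystem m X' T' E' ∧
      ∀ x t ξ, (ξ • (1 : CMat n) - dressMatrix z (hermProj V)) * E x t ξ =
        E' x t ξ * (ξ • (1 : CMat n) - dressMatrix z (ρ x t)) := by
  obtain ⟨E', hE', hf⟩ := exists_entire_factor hz h hρ
  refine ⟨E', ⟨hX', hT', ?_⟩, hf⟩
  have hi : ∀ x t, ρ x t * ρ x t = ρ x t := fun x t => by rw [hρ, hermProj_mul_self]
  have hρs : MatSmooth ρ := by
    have := (h.smooth z).hermProj_imageSubspace (fun x t => h.det_ne_zero x t z) V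
    simpa only [← hρ] using this
  have hsol : ∀ ξ, ξ ≠ z → ξ ≠ conj z → IsSolutionAt m X' T' ξ fun x t => E' x t ξ := by
    intro ξ h1 h2
    have hs := smooth_factor hi hρs (h.smooth ξ) h1 h2 fun x t => hf x t ξ
    refine ⟨hs, fun x t => ?_, fun x t => ?_, ?_⟩
    · refine (hs.hasMatDerivAt_x x t).congr_deriv
        (mul_right_cancel_dressMatrix (hi x t) h1 h2 ?_)
      exact hasMatDerivAt_factor (F := fun y => E' y t ξ) (G := fun y => E y t ξ)
        (A := fun y => dressMatrix z (ρ y t)) (fun y => hf y t ξ) (hs.hasMatDerivAt_x x t)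
        ((h.sol ξ).deriv_x x t) (hx x t ξ)
    · refine (hs.hasMatDerivAt_t x t).congr_deriv
        (mul_right_cancel_dressMatrix (hi x t) h1 h2 ?_)
      exact hasMatDerivAt_factor (F := fun s => E' x s ξ) (G := fun s => E x s ξ)
        (A := fun s => dressMatrix z (ρ x s)) (fun s => hf x s ξ) (hs.hasMatDerivAt_t x t)
        ((h.sol ξ).deriv_t x t) (ht x t ξ)
    · have h3 := hf 0 0 ξ
      rw [h.init, mul_one, ← apply_zero_zero_eq h hρ] at h3
      exact mul_right_cancel_dressMatrix (hi 0 0) h1 h2 (by rw [← h3, one_mul])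
  intro ξ₀
  by_cases h0 : ξ₀ ≠ z ∧ ξ₀ ≠ conj z
  · exact hsol ξ₀ h0.1 h0.2
  -- With this radius the open ball about one exceptional point omits the other.
  · have hr : 0 < ‖conj z - z‖ := norm_pos_iff.mpr (sub_ne_zero.mpr (conj_ne_self hz))
    refine isSolutionAt_of_punctured hX' hT' hE' hr fun ξ hξ hξ0 => hsol ξ ?_ ?_
    · rintro rfl
      rw [mem_ball_iff_norm] at hξ
      rcases (not_and_or.mp h0) with h0 | h0
      · exact hξ0 (not_not.mp h0).symm
      · rw [not_not.mp h0, norm_sub_rev] at hξ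
        exact lt_irrefl _ hξ
    · rintro rfl
      rw [mem_ball_iff_norm] at hξ
      rcases (not_and_or.mp h0) with h0 | h0
      · rw [not_not.mp h0] at hξ
        exact lt_irrefl _ hξ
      · exact hξ0 (not_not.mp h0).symm

end Extension

/-! ### The dressed potential, its fluxes, its flow and its trivialization. -/

section Dressing

variable {n : ℕ}

theorem sum_lie_laxX (α : Fin n → ℂ) (u : ℝ → ℝ → CMat n) (j : ℕ) (z : ℂ) (ρ : CMat n)
    (x t : ℝ) : ∑ k ∈ Finset.range (j + 2), ⁅ρ, laxX α u k x t⁆ * dressMatrix z ρ ^ k =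
      projectionField α z (u x t) ρ := by
  rw [Finset.sum_range_succ', Finset.sum_range_succ', Finset.sum_eq_zero fun k _ => by
    simp [laxX, Ring.lie_def]]
  simp only [laxX, zero_add, pow_zero, pow_one, mul_one]
  rw [add_comm, projectionField, dressMatrix]

theorem sum_lie_laxT (α : Fin n → ℂ) (b : CMat n) (u : ℝ → ℝ → CMat n) (j : ℕ) (z : ℂ)
    (ρ : CMat n) (x t : ℝ) :
    ∑ k ∈ Finset.range (j + 2), ⁅ρ, laxT α b j u k x t⁆ * dressMatrix z ρ ^ k =
      ∑ k ∈ Finset.range (j + 1), ⁅ρ, fluxAt α b u (j - k) x t⁆ * dressMatrix z ρ ^ k := by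
  rw [Finset.sum_range_succ, laxT, if_neg (by omega), Ring.lie_def ρ 0, mul_zero, zero_mul,
    sub_zero, zero_mul, add_zero]
  refine Finset.sum_congr rfl fun k hk => ?_
  rw [laxT, if_pos (Finset.mem_range_succ_iff.mp hk)]

theorem dressMatrix_lie (z : ℂ) (ρ B : CMat n) :
    ⁅dressMatrix z ρ, B⁆ = (conj z - z) • ⁅ρ, B⁆ := by
  simp only [dressMatrix, Ring.lie_def, add_mul, mul_add, smul_mul_assoc, mul_smul_comm, one_mul,
    mul_one]
  module

theorem smul_sum_lie_mul_pow (z : ℂ) (ρ : CMat n) (Q : ℕ → CMat n) (j : ℕ) :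
    (conj z - z) • ∑ k ∈ Finset.range (j + 1), ⁅ρ, Q (j - k)⁆ * dressMatrix z ρ ^ k =
      dressMatrix z ρ * Q j - gaugeFlux (dressMatrix z ρ) Q j * dressMatrix z ρ := by
  rw [mul_gaugeFlux_sub, Finset.smul_sum]
  refine Finset.sum_congr rfl fun k _ => ?_
  rw [dressMatrix_lie, smul_mul_assoc]

/-- The gauge transformation of the polynomial `∑ Q_{j-k} ξ^k`. -/
theorem sum_gaugeFlux_mul_sub (A : CMat n) (Q : ℕ → CMat n) (ξ : ℂ) (j : ℕ) :
    (∑ k ∈ Finset.range (j + 1), ξ ^ k • gaugeFlux A Q (j - k)) * (ξ • (1 : CMat n) - A) -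
        (ξ • (1 : CMat n) - A) * ∑ k ∈ Finset.range (j + 1), ξ ^ k • Q (j - k) =
      A * Q j - gaugeFlux A Q j * A := by
  -- Horner's scheme, which makes the induction on the degree possible.
  have hrec : ∀ (F : ℕ → CMat n) j, ∑ k ∈ Finset.range (j + 1 + 1), ξ ^ k • F (j + 1 - k) =
      ξ • (∑ k ∈ Finset.range (j + 1), ξ ^ k • F (j - k)) + F (j + 1) := by
    intro F j
    rw [Finset.sum_range_succ', Finset.smul_sum]
    simp [pow_succ', smul_smul]
  induction j with
  | zero =>
    simp only [zero_add, Finset.sum_range_one, pow_zero, one_smul, Nat.sub_zero, gaugeFlux, sub_mul,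
      mul_sub, smul_mul_assoc, mul_smul_comm, one_mul, mul_one]
    abel
  | succ j ih =>
    rw [hrec, hrec]
    have h : ∀ S S' Q₁ Q₁' : CMat n, (ξ • S' + Q₁') * (ξ • (1 : CMat n) - A) -
        (ξ • (1 : CMat n) - A) * (ξ • S + Q₁) =
        ξ • (S' * (ξ • (1 : CMat n) - A) - (ξ • (1 : CMat n) - A) * S) + ξ • (Q₁' - Q₁) +
          (A * Q₁ - Q₁' * A) := by
      intro S S' Q₁ Q₁'
      simp only [add_mul, sub_mul, mul_add, mul_sub, smul_mul_assoc, mul_smul_comm, one_mul,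
        mul_one, smul_sub]
      module
    rw [h, ih, gaugeFlux]
    module

/-- The potential `ũ = u + (z - z̄)[π̃, a]`. -/
noncomputable def dressedPotential (α : Fin n → ℂ) (z : ℂ) (u ρ : ℝ → ℝ → CMat n) (x t : ℝ) :
    CMat n :=
  u x t + (z - conj z) • ⁅ρ x t, (Matrix.diagonal α : CMat n)⁆

/-- The data of the dressing transformation. -/
structure IsDressing (α : Fin n → ℂ) (b : CMat n) (j : ℕ) (u : ℝ → ℝ → CMat n)
    (E : ℝ → ℝ → ℂ → CMat n) (z : ℂ) (V : Submodule ℂ (EuclideanSpace ℂ (Fin n)))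
    (ρ : ℝ → ℝ → CMat n) : Prop where
  skew_a : Matrix.diagonal α ∈ skewAdjoint (CMat n)
  skew_b : b ∈ skewAdjoint (CMat n)
  block : IsBlockScalar α b
  flow : IsFlowSolution α b j u
  system : IsPolySystem (j + 2) (laxX α u) (laxT α b j u) E
  im_ne_zero : z.im ≠ 0
  proj : ∀ x t, ρ x t = hermProj (imageSubspace (E x t z).conjTranspose V)

namespace IsDressing

variable {α : Fin n → ℂ} {b : CMat n} {j : ℕ} {u : ℝ → ℝ → CMat n} {E : ℝ → ℝ → ℂ → CMat n}
  {z : ℂ} {V : Submodule ℂ (EuclideanSpace ℂ (Fin n))} {ρ : ℝ → ℝ → CMat n}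

theorem hermitian (h : IsDressing α b j u E z V ρ) (x t : ℝ) :
    (ρ x t).conjTranspose = ρ x t := by rw [h.proj, hermProj_conjTranspose]

theorem idempotent (h : IsDressing α b j u E z V ρ) (x t : ℝ) : ρ x t * ρ x t = ρ x t := by
  rw [h.proj, hermProj_mul_self]

theorem smooth_proj (h : IsDressing α b j u E z V ρ) : MatSmooth ρ := by
  have := (h.system.smooth z).hermProj_imageSubspace (fun x t => h.system.det_ne_zero x t z) V
  simpa only [← h.proj] using this

theorem hasMatDerivAt_x (h : IsDressing α b j u E z V ρ) (x t : ℝ) :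
    HasMatDerivAt (fun y => ρ y t) (projectionField α z (u x t) (ρ x t)) x := by
  rw [← sum_lie_laxX α u j]
  exact (h.system.hasMatDerivAt_hermProj z V h.proj x t).1

theorem hasMatDerivAt_t (h : IsDressing α b j u E z V ρ) (x t : ℝ) :
    HasMatDerivAt (fun s => ρ x s) (∑ k ∈ Finset.range (j + 1),
      ⁅ρ x t, fluxAt α b u (j - k) x t⁆ * dressMatrix z (ρ x t) ^ k) t := by
  rw [← sum_lie_laxT]
  exact (h.system.hasMatDerivAt_hermProj z V h.proj x t).2

theorem isProjectionSystemSolution (h : IsDressing α b j u E z V ρ) :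
    IsProjectionSystemSolution α b j u z (hermProj V) ρ where
  smooth := h.smooth_proj
  deriv_x x t := by
    rw [(h.hasMatDerivAt_x x t).matDeriv_eq, projectionField]
    simp only [Ring.lie_def, mul_add, add_mul, sub_mul, smul_mul_assoc, mul_smul_comm, mul_one,
      smul_sub]
    module
  deriv_t x t := (h.hasMatDerivAt_t x t).matDeriv_eq
  hermitian := h.hermitian
  idempotent := h.idempotent
  init := apply_zero_zero_eq h.system h.proj

theorem mem_unitaryPerp (h : IsDressing α b j u E z V ρ) (x t : ℝ) :
    dressedPotential α z u ρ x t ∈ unitaryPerp (Matrix.diagonal α) :=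
  add_lie_mem_unitaryPerp h.skew_a (h.flow.mem_perp x t) (h.hermitian x t) z

theorem isSchwartz (h : IsDressing α b j u E z V ρ) (t : ℝ) (i k : Fin n) :
    IsSchwartz fun x => dressedPotential α z u ρ x t i k :=
  isSchwartz_dressed (v := fun x => u x t) (ρ := fun x => ρ x t)
    (re_eq_zero_of_skewAdjoint h.skew_a) h.im_ne_zero (fun x => h.hermitian x t)
    (fun x => h.idempotent x t) (fun x => h.hasMatDerivAt_x x t) (h.smooth_proj.smooth_x t)
    (h.flow.schwartz t) i k

theorem isFluxSequence (h : IsDressing α b j u E z V ρ) (t : ℝ) :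
    IsFluxSequence α b (fun x => dressedPotential α z u ρ x t)
      fun k x => gaugeFlux (dressMatrix z (ρ x t)) (fun k => fluxAt α b u k x t) k :=
  fluxQ_dressed (v := fun x => u x t) (ρ := fun x => ρ x t)
    (re_eq_zero_of_skewAdjoint h.skew_a) h.block h.im_ne_zero (fun x => h.hermitian x t)
    (fun x => h.idempotent x t) (fun x => h.hasMatDerivAt_x x t) (h.smooth_proj.smooth_x t)
    (h.flow.schwartz t) (fun x => isOffBlock_of_mem_unitaryPerp (h.flow.mem_perp x t))

/-- Uniqueness of the flux sequence: the gauge transforms satisfy the recursion of the dressed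
potential, which is Schwartz and off-block. -/
theorem fluxAt_dressed (h : IsDressing α b j u E z V ρ) (k : ℕ) (x t : ℝ) :
    fluxAt α b (dressedPotential α z u ρ) k x t =
      gaugeFlux (dressMatrix z (ρ x t)) (fun k => fluxAt α b u k x t) k :=
  ((h.isFluxSequence t).eq_fluxQ (h.isSchwartz t)
    (fun x => isOffBlock_of_mem_unitaryPerp (h.mem_unitaryPerp x t)) k x).symm

theorem smooth_dressed (h : IsDressing α b j u E z V ρ) :
    MatSmooth (dressedPotential α z u ρ) :=
  h.flow.smooth.add ((h.smooth_proj.lie (MatSmooth.const _)).smul _)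

theorem hasMatDerivAt_dressMatrix_t (h : IsDressing α b j u E z V ρ) (x t : ℝ) :
    HasMatDerivAt (fun s => dressMatrix z (ρ x s))
      (dressMatrix z (ρ x t) * fluxAt α b u j x t -
        fluxAt α b (dressedPotential α z u ρ) j x t * dressMatrix z (ρ x t)) t := by
  rw [h.fluxAt_dressed, ← smul_sum_lie_mul_pow z (ρ x t) (fun k => fluxAt α b u k x t) j]
  exact ((HasMatDerivAt.const (z • (1 : CMat n)) t).add
    ((h.hasMatDerivAt_t x t).smul (conj z - z))).congr_deriv (zero_add _)

/-- By the recursion the right-hand side of the flow is `[Q_{j+1}, a]`, so no derivative in `x`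
remains. -/
theorem matDeriv_flow {u : ℝ → ℝ → CMat n} {t : ℝ} (Q : ℕ → ℝ → CMat n)
    (hQ : IsFluxSequence α b (fun x => u x t) Q)
    (e : ∀ k x, fluxAt α b u k x t = Q k x) (j : ℕ) (x : ℝ) :
    matDeriv (fun y => fluxAt α b u j y t) x + ⁅u x t, fluxAt α b u j x t⁆ =
      ⁅Q (j + 1) x, (Matrix.diagonal α : CMat n)⁆ := by
  simp only [e]
  rw [(hQ.deriv j x).matDeriv_eq, sub_add_cancel]

/-- From `ũ = u + [a, A]` and `A_t = A Q_j - Q̃_j A` one gets `ũ_t = [Q_{j+1} + Q̃_j A - A Q_j, a]`,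
and the recursion of `gaugeFlux` identifies this with `[Q̃_{j+1}, a]`. -/
theorem isFlowSolution (h : IsDressing α b j u E z V ρ) :
    IsFlowSolution α b j (dressedPotential α z u ρ) where
  smooth := h.smooth_dressed
  mem_perp := h.mem_unitaryPerp
  schwartz := h.isSchwartz
  flow x t := by
    have hoff := fun x => isOffBlock_of_mem_unitaryPerp (h.flow.mem_perp x t)
    rw [matDeriv_flow _ (h.isFluxSequence t) (fun k x => h.fluxAt_dressed k x t)]
    have hu : matDeriv (fun s => u x s) t = _ := (h.flow.flow x t).trans
      (matDeriv_flow (fun k x => fluxAt α b u k x t)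
        (isFluxSequence_fluxQ h.block (h.flow.schwartz t) hoff) (fun _ _ => rfl) j x)
    have h1 := h.flow.smooth.hasMatDerivAt_t x t
    rw [hu] at h1
    have h2 := (h1.sub ((h.hasMatDerivAt_dressMatrix_t x t).mul_const (Matrix.diagonal α))).add
      ((h.hasMatDerivAt_dressMatrix_t x t).const_mul (Matrix.diagonal α))
    have h3 : (fun s => dressedPotential α z u ρ x s) = fun s =>
        u x s - dressMatrix z (ρ x s) * Matrix.diagonal α +
          Matrix.diagonal α * dressMatrix z (ρ x s) := by
      funext s
      simp only [dressedPotential, dressMatrix, Ring.lie_def, mul_add, add_mul, smul_mul_assoc,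
        mul_smul_comm, one_mul, mul_one]
      module
    rw [h3, h2.matDeriv_eq, h.fluxAt_dressed, gaugeFlux]
    simp only [Ring.lie_def]
    noncomm_ring

/-- The gauge formula transfers joint smoothness from the fluxes of `u`, where it is available up to
index `j`. -/
theorem smooth_gaugeFlux (h : IsDressing α b j u E z V ρ) {k : ℕ} (hk : k ≤ j) :
    MatSmooth (fluxAt α b (dressedPotential α z u ρ) k) := by
  have hA : MatSmooth fun x t => dressMatrix z (ρ x t) :=
    (MatSmooth.const _).add (h.smooth_proj.smul _)
  induction k with
  | zero =>
    have : fluxAt α b (dressedPotential α z u ρ) 0 = fun _ _ => b := rfl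
    rw [this]
    exact MatSmooth.const b
  | succ k ih =>
    have h1 := ((h.system.smooth_fluxAt hk).add ((ih (by omega)).mul hA)).sub
      (hA.mul (h.system.smooth_fluxAt (k := k) (by omega)))
    have h2 : fluxAt α b (dressedPotential α z u ρ) (k + 1) = fun x t =>
        fluxAt α b u (k + 1) x t + fluxAt α b (dressedPotential α z u ρ) k x t *
          dressMatrix z (ρ x t) - dressMatrix z (ρ x t) * fluxAt α b u k x t := by
      funext x t
      rw [h.fluxAt_dressed, h.fluxAt_dressed, gaugeFlux]
    rw [h2]
    exact h1

theorem isPolyCoeff_laxX (h : IsDressing α b j u E z V ρ) :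
    IsPolyCoeff (laxX α (dressedPotential α z u ρ)) := by
  refine ⟨fun k => ?_, laxX_conjTranspose h.skew_a h.mem_unitaryPerp⟩
  match k with
  | 0 => exact h.smooth_dressed
  | 1 => exact MatSmooth.const _
  | k + 2 => exact MatSmooth.const _

theorem isPolyCoeff_laxT (h : IsDressing α b j u E z V ρ) :
    IsPolyCoeff (laxT α b j (dressedPotential α z u ρ)) := by
  refine ⟨fun k => ?_,
    laxT_conjTranspose h.skew_a h.skew_b h.block h.mem_unitaryPerp h.isSchwartz⟩
  by_cases hk : k ≤ j
  · have : laxT α b j (dressedPotential α z u ρ) k =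
        fluxAt α b (dressedPotential α z u ρ) (j - k) := by
      funext x t
      rw [laxT, if_pos hk]
    rw [this]
    exact h.smooth_gaugeFlux (Nat.sub_le j k)
  · have : laxT α b j (dressedPotential α z u ρ) k = fun _ _ => 0 := by
      funext x t
      rw [laxT, if_neg hk]
    rw [this]
    exact MatSmooth.const _

/-- The dressed trivialization. -/
theorem exists_isPolySystem (h : IsDressing α b j u E z V ρ) :
    ∃ E' : ℝ → ℝ → ℂ → CMat n, IsPolySystem (j + 2) (laxX α (dressedPotential α z u ρ))
        (laxT α b j (dressedPotential α z u ρ)) E' ∧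
      ∀ x t ξ, (ξ • (1 : CMat n) - dressMatrix z (hermProj V)) * E x t ξ =
        E' x t ξ * (ξ • (1 : CMat n) - dressMatrix z (ρ x t)) := by
  refine exists_isPolySystem_dressed h.im_ne_zero h.system h.proj h.isPolyCoeff_laxX
    h.isPolyCoeff_laxT (fun x t ξ => ?_) fun x t ξ => ?_
  · rw [sum_laxX, sum_laxX]
    refine ((HasMatDerivAt.const (z • (1 : CMat n)) x).add
      ((h.hasMatDerivAt_x x t).smul (conj z - z))).congr_deriv ?_
    simp only [projectionField, dressMatrix, dressedPotential, Ring.lie_def, mul_add, add_mul,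
      sub_mul, mul_sub, smul_mul_assoc, mul_smul_comm, one_mul, mul_one, smul_add, smul_sub]
    module
  · rw [sum_laxT, sum_laxT]
    refine (h.hasMatDerivAt_dressMatrix_t x t).congr_deriv ?_
    simp only [h.fluxAt_dressed]
    exact (sum_gaugeFlux_mul_sub _ (fun k => fluxAt α b u k x t) ξ j).symm

end IsDressing

end Dressing

/-! ### The simple elements as members of the rational group. -/

section SimpleElement

open Filter Topology

variable {n : ℕ}

theorem simpleElement_eq {z ξ : ℂ} (h : ξ ≠ conj z) (ρ : CMat n) :
    simpleElement z ρ ξ = (ξ - conj z)⁻¹ • (ξ • (1 : CMat n) - dressMatrix z ρ) := by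
  have h0 := sub_ne_zero.mpr h
  have h1 : (ξ - conj z)⁻¹ • (ξ • (1 : CMat n) - dressMatrix z ρ) =
      ((ξ - conj z)⁻¹ * (ξ - conj z)) • ρ + ((ξ - conj z)⁻¹ * (ξ - z)) • (1 - ρ) := by
    rw [dressMatrix]
    module
  rw [h1, inv_mul_cancel₀ h0, one_smul, simpleElement, div_eq_inv_mul]

theorem simpleElement_mul_inv {z ξ : ℂ} (h1 : ξ ≠ z) (h2 : ξ ≠ conj z) {ρ : CMat n}
    (hi : ρ * ρ = ρ) : simpleElement z ρ ξ * (simpleElement z ρ ξ)⁻¹ = 1 := by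
  refine Matrix.mul_nonsing_inv _ ?_
  rw [← Matrix.isUnit_iff_isUnit_det]
  refine IsUnit.of_mul_eq_one
    ((ξ - z)⁻¹ • (ξ • (1 : CMat n) - dressMatrix (conj z) ρ)) ?_
  rw [simpleElement_eq h2, smul_mul_smul_comm, smul_one_sub_mul_dressMatrix hi, smul_smul]
  have h3 := sub_ne_zero.mpr h1
  have h4 := sub_ne_zero.mpr h2
  rw [show (ξ - conj z)⁻¹ * (ξ - z)⁻¹ * ((ξ - z) * (ξ - conj z)) = 1 by field_simp, one_smul]

theorem conjTranspose_simpleElement_mul {z ξ : ℂ} (h1 : ξ ≠ z) (h2 : ξ ≠ conj z) {ρ : CMat n}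
    (hs : ρ.conjTranspose = ρ) (hi : ρ * ρ = ρ) :
    (simpleElement z ρ (conj ξ)).conjTranspose * simpleElement z ρ ξ = 1 := by
  have h3 := sub_ne_zero.mpr h1
  have h4 := sub_ne_zero.mpr h2
  have h5 : conj ξ ≠ conj z := fun h => h1 ((starRingEnd ℂ).injective h)
  rw [simpleElement_eq h2, simpleElement_eq h5, Matrix.conjTranspose_smul,
    Matrix.conjTranspose_sub, Matrix.conjTranspose_smul, Matrix.conjTranspose_one]
  have h6 : (dressMatrix z ρ).conjTranspose = dressMatrix (conj z) ρ := by
    simp [dressMatrix, hs]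
  rw [h6, smul_mul_smul_comm]
  simp only [RCLike.star_def, map_inv₀, map_sub, Complex.conj_conj]
  rw [smul_one_sub_mul_dressMatrix' hi, smul_smul,
    show (ξ - z)⁻¹ * (ξ - conj z)⁻¹ * ((ξ - z) * (ξ - conj z)) = 1 by field_simp, one_smul]

theorem tendsto_simpleElement (z : ℂ) (ρ : CMat n) :
    Tendsto (simpleElement z ρ) (cocompact ℂ) (𝓝 1) := by
  rw [← Metric.cobounded_eq_cocompact]
  have h1 : Tendsto (fun ξ : ℂ => (ξ - conj z)⁻¹) (Bornology.cobounded ℂ) (𝓝 0) :=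
    tendsto_inv₀_cobounded.comp (tendsto_sub_const_cobounded (conj z))
  have h2 : Tendsto (fun ξ : ℂ => (ξ - z) / (ξ - conj z)) (Bornology.cobounded ℂ) (𝓝 1) := by
    have h3 : Tendsto (fun ξ : ℂ => 1 + (conj z - z) * (ξ - conj z)⁻¹)
        (Bornology.cobounded ℂ) (𝓝 1) := by
      simpa using (h1.const_mul (conj z - z)).const_add 1
    refine h3.congr' ?_
    have h4 : ∀ᶠ ξ : ℂ in Bornology.cobounded ℂ, ξ ≠ conj z :=
      Bornology.isBounded_def.mp Bornology.isBounded_singleton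
    filter_upwards [h4] with ξ hξ
    have := sub_ne_zero.mpr hξ
    field_simp
    ring
  have h5 := (h2.smul_const (1 - ρ)).const_add ρ
  rw [one_smul, add_sub_cancel] at h5
  exact h5

theorem memGMinus_simpleElement {z : ℂ} {ρ : CMat n} (hs : ρ.conjTranspose = ρ)
    (hi : ρ * ρ = ρ) : MemGMinus (simpleElement z ρ) := by
  refine ⟨Polynomial.X - Polynomial.C (conj z),
    Matrix.of fun i k => Polynomial.C ((1 : CMat n) i k) * Polynomial.X -
      Polynomial.C (dressMatrix z ρ i k),
    Polynomial.X_sub_C_ne_zero _, fun ξ hξ => ?_, tendsto_simpleElement z ρ, fun ξ h1 h2 => ?_⟩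
  · simp only [Polynomial.eval_sub, Polynomial.eval_X, Polynomial.eval_C] at hξ ⊢
    rw [simpleElement_eq (sub_ne_zero.mp hξ)]
    congr 1
    ext i k
    simp [mul_comm ξ]
  · simp only [Polynomial.eval_sub, Polynomial.eval_X, Polynomial.eval_C] at h1 h2
    refine conjTranspose_simpleElement_mul (fun h => h2 ?_) (sub_ne_zero.mp h1) hs hi
    rw [h, sub_self]

end SimpleElement

theorem corollary5p7 {n : ℕ} (α : Fin n → ℂ) (b : CMat n) (j : ℕ) (hj : 1 ≤ j)
    (ha : Matrix.diagonal α ∈ skewAdjoint (CMat n)) (hb : b ∈ skewAdjoint (CMat n))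
    (hab : ∃ p : Polynomial ℂ, b = Polynomial.aeval (Matrix.diagonal α : CMat n) p)
    (u : ℝ → ℝ → CMat n) (hu : IsFlowSolution α b j u)
    (E : ℝ → ℝ → ℂ → CMat n) (hE : IsTrivialization α b j u E)
    (z : ℂ) (hz : z.im ≠ 0) (V : Submodule ℂ (EuclideanSpace ℂ (Fin n)))
    (π : CMat n) (hπ : π = hermProj V)
    (π' : ℝ → ℝ → CMat n)
    (hπ' : ∀ x t, π' x t = hermProj (imageSubspace (E x t z).conjTranspose V))
    (u' : ℝ → ℝ → CMat n)
    (hu' : ∀ x t, u' x t = u x t + (z - conj z) • ⁅π' x t, (Matrix.diagonal α : CMat n)⁆) :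
    IsFlowSolution α b j u' ∧
    IsProjectionSystemSolution α b j u z π π' ∧
    ∃ E' : ℝ → ℝ → ℂ → CMat n,
      (∀ x t ξ, ξ ≠ z → ξ ≠ conj z →
        E' x t ξ = simpleElement z π ξ * E x t ξ * (simpleElement z (π' x t) ξ)⁻¹) ∧
      IsTrivialization α b j u' E' ∧
      (∀ x t, MemGPlus (E' x t)) ∧
      (∀ x t, MemGMinus (simpleElement z (π' x t))) ∧
      ∀ x t ξ, ξ ≠ conj z →
        simpleElement z π ξ * E x t ξ = E' x t ξ * simpleElement z (π' x t) ξ := by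
  obtain ⟨p, hp⟩ := hab
  have hblock : IsBlockScalar α b := hp ▸ isBlockScalar_aeval α p
  have h : IsDressing α b j u E z V π' :=
    ⟨ha, hb, hblock, hu, hE.isPolySystem ha hb hblock hu, hz, hπ'⟩
  have hu'' : u' = dressedPotential α z u π' := funext fun x => funext fun t => hu' x t
  subst hu'' hπ
  obtain ⟨E', hE', hf⟩ := h.exists_isPolySystem
  -- The identity with linear factors holds for every `ξ`, so only the pole `z̄` is excluded. At `ξ
  -- = z` it persists although the simple element need not be invertible there.
  have hfac : ∀ x t ξ, ξ ≠ conj z →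
      simpleElement z (hermProj V) ξ * E x t ξ = E' x t ξ * simpleElement z (π' x t) ξ := by
    intro x t ξ hξ
    rw [simpleElement_eq hξ, simpleElement_eq hξ, smul_mul_assoc, mul_smul_comm, hf]
  refine ⟨h.isFlowSolution, h.isProjectionSystemSolution, E', fun x t ξ h1 h2 => ?_,
    hE'.isTrivialization, fun x t => ⟨hE'.differentiable_param x t, hE'.conjTranspose_mul x t⟩,
    fun x t => memGMinus_simpleElement (h.hermitian x t) (h.idempotent x t), hfac⟩
  rw [hfac x t ξ h2, mul_assoc, simpleElement_mul_inv h1 h2 (h.idempotent x t), mul_one]
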